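/- Let $n\ge 4$ and $q\in(0,\infty)$. Let $B_n$ be the group of signed permutations, i.e. the permutations $w$ of $[\pm n]=\{-n,\dots,-1,1,\dots,n\}$ with $w(-i)=-w(i)$ for all $i$, under composition, with generators $s_0=(-1\ \,1)$ and $s_i=(i\ \,i{+}1)(-i\ \,{-i}{-}1)$ for $1\le i\le n-1$. Let $\ell(w)$ be the minimal number of factors in an expression of $w$ as a product of these generators, and let $\mathrm{des}(w)$ be the number of $i\in\{0,\dots,n-1\}$ with $\ell(ws_i)<\ell(w)$. Let $w$ be a random element of $B_n$ that is Mallows distributed with parameter $q$, i.e. $\mathbb P(w=w_0)=q^{\ell(w_0)}/\sum_{v\in B_n}q^{\ell(v)}$ for every $w_0\in B_n$. Let $\mu$ and $\sigma^2$ ($\sigma\ge0$) denote the mean and the variance of $\mathrm{des}(w)+\mathrm{des}(w^{-1})$, and let $Z$ be a standard normal random variable. Then for every piecewise continuously differentiable function $h:\mathbb R\to\mathbb R$ (i.e. $h$ is continuous, and it is differentiable with continuous derivative away from a set of points that has only finitely many elements in every bounded interval), $$\left|\mathbb E\,h\!\left(\frac{\mathrm{des}(w)+\mathrm{des}(w^{-1})-\mu}{\sigma}\right)-\mathbb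 E\,h(Z)\right|\le\left(360\,\|h\|_\infty+236\,\|h'\|_\infty\max\!\left(q^{-1/2},q^{1/2}\right)\right)n^{-1/2},$$ where $\|h\|_\infty=\sup_{x}|h(x)|\in[0,\infty]$ and $\|h'\|_\infty\in[0,\infty]$ is the supremum of $|h'(x)|$ over the points $x$ at which $h$ is differentiable. (If the right-hand side is infinite, nothing is claimed.) -/

import Mathlib

open MeasureTheory ProbabilityTheory

namespace TypeB

/-- The index set `[±n] = {-n, …, -1, 1, …, n}`. -/
abbrev SignedIndex (n : ℕ) : Type :=
  {k : ℤ // k ∈ (Finset.Icc (-(n : ℤ)) (n : ℤ)).erase 0}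

/-- Negation on `[±n]`. -/
instance (n : ℕ) : Neg (SignedIndex n) where
  neg k := ⟨-k.1, by
    have h := k.2
    simp only [Finset.mem_erase, Finset.mem_Icc] at h ⊢
    omega⟩

theorem coe_neg {n : ℕ} (k : SignedIndex n) : ((-k : SignedIndex n) : ℤ) = -(k : ℤ) := rfl

theorem coe_ne_zero {n : ℕ} (k : SignedIndex n) : (k : ℤ) ≠ 0 :=
  (Finset.mem_erase.mp k.2).1

/-- The group `B_n` of signed permutations: the permutations `w` of `[±n]` with
`w (-i) = - w i` for all `i`. The product is composition, `(v * w) i = v (w i)`. -/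
def B (n : ℕ) : Subgroup (Equiv.Perm (SignedIndex n)) where
  carrier := {w | ∀ i, w (-i) = -(w i)}
  mul_mem' {v w} hv hw i := by
    rw [Equiv.Perm.mul_apply, Equiv.Perm.mul_apply, hw i, hv (w i)]
  one_mem' _ := rfl
  inv_mem' {w} hw i := by
    have hw' : ∀ j, w (-j) = -(w j) := hw
    rw [Equiv.Perm.inv_eq_iff_eq, hw', ← Equiv.Perm.mul_apply, mul_inv_cancel, Equiv.Perm.one_apply]

/-- The element `i + 1` of `[±n]`, for `i ∈ {0, …, n - 1}`. -/
def pos {n : ℕ} (i : Fin n) : SignedIndex n :=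
  ⟨(i : ℤ) + 1, by
    have := i.2
    simp only [Finset.mem_erase, Finset.mem_Icc]
    omega⟩

theorem coe_pos {n : ℕ} (i : Fin n) : (pos i : ℤ) = (i : ℤ) + 1 := rfl

/-- The permutation of `[±n]` underlying the generator `s_i`: for `i = 0` it is the
transposition `(-1 1)`, and for `1 ≤ i ≤ n - 1` it is `(i i+1)(-i -(i+1))`. -/
def genPerm {n : ℕ} (i : Fin n) : Equiv.Perm (SignedIndex n) :=
  if (i : ℕ) = 0 then Equiv.swap (-(pos i)) (pos i)
  else
    Equiv.swap (pos ⟨(i : ℕ) - 1, by omega⟩) (pos i) *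
      Equiv.swap (-(pos ⟨(i : ℕ) - 1, by omega⟩)) (-(pos i))

theorem genPerm_mem {n : ℕ} (i : Fin n) : genPerm i ∈ B n := by
  intro k
  have hk := coe_ne_zero k
  unfold genPerm
  split_ifs with h0
  · simp only [Equiv.swap_apply_def, Subtype.ext_iff, coe_neg, coe_pos, h0]
    split_ifs <;> simp only [coe_neg, coe_pos, h0] <;> push_cast at * <;> omega
  · obtain ⟨m, hm⟩ := i
    obtain ⟨m, rfl⟩ : ∃ m', m = m' + 1 := ⟨m - 1, by simp only at h0; omega⟩
    simp only [Equiv.Perm.mul_apply, Equiv.swap_apply_def, Subtype.ext_iff]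
    split_ifs <;> simp only [coe_neg, coe_pos] at * <;> push_cast at * <;> omega

/-- The generators `s_0, …, s_{n-1}` of `B_n`. -/
def gen {n : ℕ} (i : Fin n) : B n := ⟨genPerm i, genPerm_mem i⟩

/-- The length `ℓ(w)`: the least number of factors in an expression of `w` as a product of
the generators. -/
noncomputable def length {n : ℕ} (w : B n) : ℕ :=
  sInf {k : ℕ | ∃ L : List (Fin n), L.length = k ∧ (L.map gen).prod = w}

/-- `w` has a (right) descent at `s_i` if `ℓ(w s_i) < ℓ(w)`. -/
def HasDescent {n : ℕ} (w : B n) (i : Fin n) : Prop :=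
  length (w * gen i) < length w

open Classical in
/-- The descent statistic `des(w)`: the number of generators at which `w` has a descent. -/
noncomputable def des {n : ℕ} (w : B n) : ℕ :=
  (Finset.univ.filter fun i : Fin n => HasDescent w i).card

/-- The two-sided descent statistic `des(w) + des(w⁻¹)`, as a real number. -/
noncomputable def twoSidedDes {n : ℕ} (w : B n) : ℝ :=
  (des w : ℝ) + (des w⁻¹ : ℝ)

noncomputable instance (n : ℕ) : Fintype (B n) := Fintype.ofFinite _

/-- Every subset of the finite set `B_n` is an event. -/
instance (n : ℕ) : MeasurableSpace (B n) := ⊤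

/-- The normalization constant of the Mallows measure. -/
noncomputable def mallowsZ (n : ℕ) (q : ℝ) : ℝ := ∑ w : B n, q ^ length w

/-- The Mallows measure on `B_n` with parameter `q`: the point `w` has mass `q ^ ℓ(w) / Z`. -/
noncomputable def mallows (n : ℕ) (q : ℝ) : Measure (B n) :=
  ∑ w : B n, ENNReal.ofReal (q ^ length w / mallowsZ n q) • Measure.dirac w

end TypeB

/-- The normalization `(X - E X) / √(Var X)` of a real random variable `X`. -/
noncomputable def standardized {Ω : Type*} [MeasurableSpace Ω] (X : Ω → ℝ) (P : Measure Ω)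
    (ω : Ω) : ℝ :=
  (X ω - ∫ ω', X ω' ∂P) / √(Var[X; P])

/-- `h : ℝ → ℝ` is piecewise continuously differentiable: it is continuous, and it is
differentiable with continuous derivative away from a set of break points that has only
finitely many points in every bounded interval. -/
def PiecewiseC1 (h : ℝ → ℝ) : Prop :=
  Continuous h ∧ ∃ S : Set ℝ, (∀ a b : ℝ, (S ∩ Set.Icc a b).Finite) ∧
    ∀ x ∉ S, DifferentiableAt ℝ h x ∧ ContinuousAt (deriv h) x

/-- The supremum norm `‖h‖_∞ ∈ [0, ∞]`. -/
noncomputable def supNorm (h : ℝ → ℝ) : ENNReal := ⨆ x : ℝ, ‖h x‖ₑ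

/-- `‖h'‖_∞ ∈ [0, ∞]`: the supremum of `|h'(x)|` over the points `x` where `h'(x)` exists. -/
noncomputable def derivSupNorm (h : ℝ → ℝ) : ENNReal :=
  ⨆ (x : ℝ) (_ : DifferentiableAt ℝ h x), ‖deriv h x‖ₑ

/-! Write T for `twoSidedDes`. The proof is Stein's method based on an exact identity. Right
multiplication by s_i pairs each w having an ascent at i with one having a descent there and q times
the mass (`avg_asc_mul`). The Mallows measure is invariant under inversion, so des(w⁻¹) contributes
as much as des(w), and for every φ one has (1+q) E[(T-μ)φ(T)] = 2q E Σ_i asc_i(w) (φ(T(w s_i)) -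
φ(T(w))) (`avg_centered_mul`). Let `drift` be the sum of the increments of T over the ascents and D
its mean. Taking φ linear gives (1+q)σ² = 2qD. Taking for φ the rescaled solution of f' - x f = h -
E h(Z) and expanding to first order leaves two errors: ‖f'‖ E|drift - D| / D, and a Taylor remainder
of order ‖f''‖ n/(σD). Since ‖f'‖ ≤ 4‖h‖ and ‖f''‖ ≤ 4‖h'‖ for smooth h (`Stein.exists_solution`)
and the increments at ascents are at most 2, it remains to show that the drift has variance O(n) and
that D grows linearly.

For the variance, the drift is, up to an error of 2, a function of the word w(1),…,w(n): a sum of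
`swapGain` over four consecutive letters, which sees only relative order, plus the number of
adjacent letters x, x+1 (`drift_eq`). The Mallows measure factors (`sum_pow_length`): signs are
chosen independently, -j against j with odds q^j, and the chosen letters are then arranged by a
Mallows law. Total variance is bounded by revealing the signs and then the letters one at a time;
each step moves the conditional mean by a bounded amount. The relative-order part has a mean
depending only on the number of letters (`mean_quadSum_eq`). The mean of the succession count moves
by at most 2 when a letter is inserted (`abs_mean_pairSum_insert_sub_le`), by comparison with
inserting a new maximum, whose deletion preserves the Mallows law (`mean_erase_max`).

For the mean, the gain at an ascent is reduced by a neighbour whose value lies between the swapped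
ones. Comparing masses inside cosets of S₃ and B₂ bounds these losses and gives D ≥ n/(3(1+q))
(`avg_drift_ge`). For q ≤ 1 this yields D ≥ n/6 and σ² ≥ qn/6, hence the constants. The map w ↦ -w
exchanges q and 1/q and settles q > 1. A piecewise C¹ function is Lipschitz with constant ‖h'‖ and
is approximated by its moving averages. -/

namespace MallowsWord

/-! ### Mallows arrangements of a finite set of integers. -/

/-- The `q`-analogue `1 + q + ⋯ + q ^ (k - 1)` of `k`. -/
noncomputable def qNat (q : ℝ) (k : ℕ) : ℝ := ∑ i ∈ Finset.range k, q ^ i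

theorem qNat_succ (q : ℝ) (k : ℕ) : qNat q (k + 1) = qNat q k + q ^ k := by
  simp [qNat, Finset.sum_range_succ]

theorem qNat_succ' (q : ℝ) (k : ℕ) : qNat q (k + 1) = q * qNat q k + 1 := by
  simp [qNat, Finset.sum_range_succ', pow_succ', Finset.mul_sum]

theorem qNat_pos {q : ℝ} (hq : 0 < q) (k : ℕ) : 0 < qNat q (k + 1) := by
  rw [qNat_succ']
  have : 0 ≤ qNat q k := Finset.sum_nonneg fun i _ => by positivity
  positivity

/-- The number of elements of `s` below `a`. -/
def below (s : Finset ℤ) (a : ℤ) : ℕ := (s.filter (· < a)).card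

/-- A new maximum leaves the other ranks alone and takes the next one, so the ranks run once through
0, …, |s|-1. This makes the weights in `mean` a probability distribution. -/
theorem sum_pow_below (q : ℝ) (s : Finset ℤ) : ∑ a ∈ s, q ^ below s a = qNat q s.card := by
  induction s using Finset.induction_on_max with
  | empty => simp [qNat]
  | insert M s hM ih =>
    have hMs : M ∉ s := fun h => lt_irrefl _ (hM M h)
    rw [Finset.sum_insert hMs, Finset.card_insert_of_notMem hMs, qNat_succ, ← ih, add_comm]
    congr 1
    · refine Finset.sum_congr rfl fun a ha => ?_
      rw [below, below, Finset.filter_insert, if_neg (hM a ha).le.not_gt]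
    · rw [below, Finset.filter_insert, if_neg (lt_irrefl _), Finset.filter_true_of_mem hM]

/-- The mean of `F` over the arrangements of the `k`-element set `s`, where an arrangement with
`m` inversions has mass proportional to `q ^ m`. -/
noncomputable def mean (q : ℝ) : ℕ → Finset ℤ → (List ℤ → ℝ) → ℝ
  | 0, _, F => F []
  | k + 1, s, F =>
    ∑ a ∈ s, q ^ below s a / qNat q (k + 1) * mean q k (s.erase a) fun l => F (a :: l)

theorem sum_weights {q : ℝ} (hq : 0 < q) {k : ℕ} {s : Finset ℤ} (hs : s.card = k + 1) :
    ∑ a ∈ s, q ^ below s a / qNat q (k + 1) = 1 := by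
  rw [← Finset.sum_div, sum_pow_below, hs, div_self (qNat_pos hq k).ne']

theorem weight_nonneg {q : ℝ} (hq : 0 < q) (k : ℕ) (s : Finset ℤ) (a : ℤ) :
    0 ≤ q ^ below s a / qNat q (k + 1) :=
  div_nonneg (by positivity) (qNat_pos hq k).le

theorem mean_add (q : ℝ) (k : ℕ) (s : Finset ℤ) (F G : List ℤ → ℝ) :
    mean q k s (fun l => F l + G l) = mean q k s F + mean q k s G := by
  induction k generalizing s F G with
  | zero => rfl
  | succ k ih => simp only [mean, ih, mul_add, Finset.sum_add_distrib]

theorem mean_smul (q : ℝ) (k : ℕ) (s : Finset ℤ) (c : ℝ) (F : List ℤ → ℝ) :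
    mean q k s (fun l => c * F l) = c * mean q k s F := by
  induction k generalizing s F with
  | zero => rfl
  | succ k ih => simp only [mean, ih, Finset.mul_sum]; exact Finset.sum_congr rfl fun a _ => by ring

theorem card_erase_of_card {k : ℕ} {s : Finset ℤ} (hs : s.card = k + 1) {a : ℤ} (ha : a ∈ s) :
    (s.erase a).card = k := by
  rw [Finset.card_erase_of_mem ha, hs, Nat.add_sub_cancel]

theorem mean_const {q : ℝ} (hq : 0 < q) {k : ℕ} {s : Finset ℤ} (hs : s.card = k) (c : ℝ) :
    mean q k s (fun _ => c) = c := by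
  induction k generalizing s with
  | zero => rfl
  | succ k ih =>
    rw [mean, Finset.sum_congr rfl fun a ha => by rw [ih (card_erase_of_card hs ha)],
      ← Finset.sum_mul, sum_weights hq hs, one_mul]

theorem mean_mono {q : ℝ} (hq : 0 < q) {k : ℕ} {s : Finset ℤ} (hs : s.card = k)
    {F G : List ℤ → ℝ} (h : ∀ l : List ℤ, l.Nodup → l.toFinset = s → F l ≤ G l) :
    mean q k s F ≤ mean q k s G := by
  induction k generalizing s F G with
  | zero => exact h [] List.nodup_nil (by simp [Finset.card_eq_zero.mp hs])
  | succ k ih =>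
    refine Finset.sum_le_sum fun a ha => mul_le_mul_of_nonneg_left ?_ (weight_nonneg hq _ _ _)
    refine ih (card_erase_of_card hs ha) fun l hl hls => h _ ?_ ?_
    · refine List.nodup_cons.mpr ⟨fun hal => ?_, hl⟩
      have := List.mem_toFinset.mpr hal
      simp [hls] at this
    · rw [List.toFinset_cons, hls, Finset.insert_erase ha]

theorem mean_congr {q : ℝ} (hq : 0 < q) {k : ℕ} {s : Finset ℤ} (hs : s.card = k)
    {F G : List ℤ → ℝ} (h : ∀ l : List ℤ, l.Nodup → l.toFinset = s → F l = G l) :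
    mean q k s F = mean q k s G :=
  le_antisymm (mean_mono hq hs fun l h1 h2 => (h l h1 h2).le)
    (mean_mono hq hs fun l h1 h2 => (h l h1 h2).ge)

theorem mean_const_add {q : ℝ} (hq : 0 < q) {k : ℕ} {s : Finset ℤ} (hs : s.card = k) (c : ℝ)
    (F : List ℤ → ℝ) : mean q k s (fun l => c + F l) = c + mean q k s F := by
  rw [mean_add, mean_const hq hs]

/-- Deleting the largest letter. -/
theorem mean_erase_max {q : ℝ} (hq : 0 < q) {k : ℕ} {s : Finset ℤ} (hs : s.card = k) {M : ℤ}
    (hM : ∀ x ∈ s, x < M) (F : List ℤ → ℝ) :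
    mean q (k + 1) (insert M s) (fun l => F (l.erase M)) = mean q k s F := by
  induction k generalizing s F with
  | zero =>
    obtain rfl := Finset.card_eq_zero.mp hs
    simp [mean, below, Finset.filter_singleton, qNat]
  | succ k ih =>
    have hMs : M ∉ s := fun h => lt_irrefl _ (hM M h)
    have h0 := qNat_pos hq k
    have h1 := qNat_pos hq (k + 1)
    rw [mean, Finset.sum_insert hMs, Finset.erase_insert hMs]
    have e1 : below (insert M s) M = k + 1 := by
      rw [below, Finset.filter_insert, if_neg (lt_irrefl _), Finset.filter_true_of_mem hM, hs]
    -- A first letter other than `M` keeps its weight in `s` up to the ratio of normalizations. This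
    -- ratio and the weight of `M` as first letter add up to 1.
    have e2 : ∀ a ∈ s, q ^ below (insert M s) a / qNat q (k + 1 + 1) *
        mean q (k + 1) ((insert M s).erase a) (fun l => F ((a :: l).erase M)) =
        qNat q (k + 1) / qNat q (k + 1 + 1) * (q ^ below s a / qNat q (k + 1) *
          mean q k (s.erase a) fun l => F (a :: l)) := by
      intro a ha
      have hne : a ≠ M := (hM a ha).ne
      rw [below, Finset.filter_insert, if_neg (hM a ha).le.not_gt,
        Finset.erase_insert_of_ne hne.symm]
      have : (fun l : List ℤ => F ((a :: l).erase M)) = fun l => (fun l' => F (a :: l')) (l.erase M) := by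
        funext l
        rw [List.erase_cons_tail (by simpa using hne)]
      rw [this, ih (card_erase_of_card hs ha) (fun x hx => hM x (Finset.mem_of_mem_erase hx))
        (fun l' => F (a :: l'))]
      rw [← below]
      field_simp
    rw [Finset.sum_congr rfl e2, ← Finset.mul_sum, ← mean, e1]
    simp only [List.erase_cons_head]
    rw [← add_mul, ← add_div, add_comm, ← qNat_succ, div_self h1.ne', one_mul]

theorem below_image {φ : ℤ → ℤ} {s : Finset ℤ} (hφ : StrictMonoOn φ s) {a : ℤ} (ha : a ∈ s) :
    below (s.image φ) (φ a) = below s a := by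
  rw [below, Finset.filter_image, Finset.card_image_of_injOn, below]
  · congr 1
    exact Finset.filter_congr fun x hx => hφ.lt_iff_lt hx ha
  · exact hφ.injOn.mono fun x hx => (Finset.mem_filter.mp hx).1

theorem image_erase_of_injOn {φ : ℤ → ℤ} {s : Finset ℤ} (hφ : Set.InjOn φ s) {a : ℤ} (ha : a ∈ s) :
    (s.image φ).erase (φ a) = (s.erase a).image φ := by
  ext y
  simp only [Finset.mem_erase, Finset.mem_image]
  constructor
  · rintro ⟨h, x, hx, rfl⟩
    exact ⟨x, ⟨fun e => h (e ▸ rfl), hx⟩, rfl⟩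
  · rintro ⟨x, ⟨h, hx⟩, rfl⟩
    exact ⟨fun e => h (hφ hx ha e), x, hx, rfl⟩

/-- Renaming the letters by an increasing map. -/
theorem mean_image {q : ℝ} {k : ℕ} {s : Finset ℤ} (hs : s.card = k) {φ : ℤ → ℤ}
    (hφ : StrictMonoOn φ s) (F : List ℤ → ℝ) :
    mean q k (s.image φ) F = mean q k s fun l => F (l.map φ) := by
  induction k generalizing s F with
  | zero => rfl
  | succ k ih =>
    rw [mean, mean, Finset.sum_image hφ.injOn]
    refine Finset.sum_congr rfl fun a ha => ?_
    rw [below_image hφ ha, image_erase_of_injOn hφ.injOn ha,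
      ih (card_erase_of_card hs ha) (hφ.mono (by simp))]
    rfl

theorem qNat_inv {q : ℝ} (hq : 0 < q) (k : ℕ) : qNat q⁻¹ (k + 1) * q ^ k = qNat q (k + 1) := by
  induction k with
  | zero => simp [qNat]
  | succ k ih =>
    rw [qNat_succ' q (k + 1), ← ih, qNat_succ]
    have : q⁻¹ ^ (k + 1) * q ^ (k + 1) = 1 := by rw [← mul_pow, inv_mul_cancel₀ hq.ne', one_pow]
    linear_combination this

/-- Negating the letters replaces `q` by `q⁻¹`. -/
theorem mean_image_neg {q : ℝ} (hq : 0 < q) {k : ℕ} {s : Finset ℤ} (hs : s.card = k)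
    (F : List ℤ → ℝ) :
    mean q⁻¹ k (s.image Neg.neg) F = mean q k s fun l => F (l.map Neg.neg) := by
  induction k generalizing s F with
  | zero => rfl
  | succ k ih =>
    rw [mean, mean, Finset.sum_image neg_injective.injOn]
    refine Finset.sum_congr rfl fun a ha => ?_
    rw [image_erase_of_injOn neg_injective.injOn ha, ih (card_erase_of_card hs ha)]
    -- Negation reverses ranks, r becoming k - r; the factor q^k is absorbed by the normalization
    -- (`qNat_inv`).
    have h1 : below (s.image Neg.neg) (-a) + below s a = k := by
      have e : below (s.image Neg.neg) (-a) = ((s.erase a).filter fun x => ¬ x < a).card := by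
        rw [below, Finset.filter_image, Finset.card_image_of_injective _ neg_injective]
        congr 1
        ext x
        simp only [Finset.mem_filter, Finset.mem_erase, neg_lt_neg_iff, not_lt]
        constructor
        · rintro ⟨h1, h2⟩; exact ⟨⟨h2.ne', h1⟩, h2.le⟩
        · rintro ⟨⟨h1, h2⟩, h3⟩; exact ⟨h2, lt_of_le_of_ne h3 (Ne.symm h1)⟩
      have e' : below s a = ((s.erase a).filter fun x => x < a).card := by
        rw [below, Finset.filter_erase, Finset.erase_eq_of_notMem]
        simp
      rw [e, e', add_comm, Finset.card_filter_add_card_filter_not, card_erase_of_card hs ha]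
    have h0 := qNat_pos hq k
    have h2 : q⁻¹ ^ below (s.image Neg.neg) (-a) / qNat q⁻¹ (k + 1) =
        q ^ below s a / qNat q (k + 1) := by
      rw [← qNat_inv hq k]
      have h3 := qNat_pos (inv_pos.mpr hq) k
      rw [← h1, pow_add, inv_pow]
      field_simp
    rw [h2]
    rfl

end MallowsWord

/-! ### Sums over consecutive letters and the effect of inserting a letter. -/

namespace MallowsWord

/-- The sum of `g x y` over the pairs `x, y` of consecutive letters. -/
def pairSum (g : ℤ → ℤ → ℝ) : List ℤ → ℝ
  | x :: y :: l => g x y + pairSum g (y :: l)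
  | _ => 0

/-- The sum of `ρ x y z t` over the quadruples `x, y, z, t` of consecutive letters. -/
def quadSum (ρ : ℤ → ℤ → ℤ → ℤ → ℝ) : List ℤ → ℝ
  | x :: y :: z :: t :: l => ρ x y z t + quadSum ρ (y :: z :: t :: l)
  | _ => 0

theorem pairSum_add (g g' : ℤ → ℤ → ℝ) : ∀ l : List ℤ,
    pairSum (fun x y => g x y + g' x y) l = pairSum g l + pairSum g' l
  | [] => by simp [pairSum]
  | [_] => by simp [pairSum]
  | x :: y :: l => by simp only [pairSum, pairSum_add g g' (y :: l)]; ring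

theorem pairSum_map {g g' : ℤ → ℤ → ℝ} {φ : ℤ → ℤ} : ∀ l : List ℤ,
    (∀ x ∈ l, ∀ y ∈ l, g (φ x) (φ y) = g' x y) → pairSum g (l.map φ) = pairSum g' l
  | [], _ => rfl
  | [_], _ => rfl
  | x :: y :: l, h => by
    have ih := pairSum_map (y :: l) fun a ha b hb =>
      h a (List.mem_cons_of_mem _ ha) b (List.mem_cons_of_mem _ hb)
    rw [List.map_cons] at ih
    rw [List.map_cons, List.map_cons, pairSum, ih, pairSum, h x (by simp) y (by simp)]

/-- Erasing `N` removes only pairs of value zero and creates at most one new pair, whose value is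
nonnegative. -/
theorem pairSum_le_pairSum_erase {g : ℤ → ℤ → ℝ} (h0 : ∀ x y, 0 ≤ g x y) {N : ℤ}
    (hl : ∀ x, g x N = 0) (hr : ∀ y, g N y = 0) : ∀ l : List ℤ,
    pairSum g l ≤ pairSum g (l.erase N)
  | [] => by simp
  | [x] => by by_cases h : x = N <;> simp [h, pairSum]
  | x :: y :: l => by
    by_cases hx : x = N
    · subst hx; simp [pairSum, hr]
    rw [List.erase_cons_tail (by simpa using hx)]
    by_cases hy : y = N
    · subst hy
      rw [List.erase_cons_head, pairSum, hl, zero_add]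
      cases l with
      | nil => simp [pairSum]
      | cons z l => simp only [pairSum, hr]; linarith [h0 x z]
    · have ih := pairSum_le_pairSum_erase h0 hl hr (y :: l)
      rw [List.erase_cons_tail (by simpa using hy)] at ih ⊢
      simp only [pairSum] at ih ⊢
      linarith

theorem pairSum_erase_le {g : ℤ → ℤ → ℝ} (h1 : ∀ x y, g x y ≤ 1) {N : ℤ}
    (hl : ∀ x, g x N = 0) (hr : ∀ y, g N y = 0) : ∀ l : List ℤ,
    pairSum g (l.erase N) ≤ pairSum g l + 1
  | [] => by simp [pairSum]
  | [x] => by by_cases h : x = N <;> simp [h, pairSum]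
  | x :: y :: l => by
    by_cases hx : x = N
    · subst hx; simp [pairSum, hr]
    rw [List.erase_cons_tail (by simpa using hx)]
    by_cases hy : y = N
    · subst hy
      rw [List.erase_cons_head, pairSum, hl, zero_add]
      cases l with
      | nil => simp [pairSum]
      | cons z l => simp only [pairSum, hr]; linarith [h1 x z]
    · have ih := pairSum_erase_le h1 hl hr (y :: l)
      rw [List.erase_cons_tail (by simpa using hy)] at ih ⊢
      simp only [pairSum] at ih ⊢
      linarith

/-- The least element of `T` above `x`. -/
def nextIn (T : Finset ℤ) (x : ℤ) : ℤ :=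
  -- The default `x + 1` makes `lt_nextIn` hold without any condition.
  if h : (T.filter (x < ·)).Nonempty then (T.filter (x < ·)).min' h else x + 1

theorem lt_nextIn (T : Finset ℤ) (x : ℤ) : x < nextIn T x := by
  unfold nextIn
  split_ifs with h
  · exact (Finset.mem_filter.mp (Finset.min'_mem _ h)).2
  · exact lt_add_one x

theorem nextIn_le {T : Finset ℤ} {x y : ℤ} (hy : y ∈ T) (hxy : x < y) : nextIn T x ≤ y := by
  have h : y ∈ T.filter (x < ·) := Finset.mem_filter.mpr ⟨hy, hxy⟩
  unfold nextIn
  rw [dif_pos ⟨y, h⟩]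
  exact Finset.min'_le _ _ h

theorem nextIn_mem {T : Finset ℤ} {x y : ℤ} (hy : y ∈ T) (hxy : x < y) : nextIn T x ∈ T := by
  have h : y ∈ T.filter (x < ·) := Finset.mem_filter.mpr ⟨hy, hxy⟩
  unfold nextIn
  rw [dif_pos ⟨y, h⟩]
  exact (Finset.mem_filter.mp (Finset.min'_mem _ ⟨y, h⟩)).1

/-- Inserting the letter `a` decreases, by at most one, the mean of a statistic of the pairs of
consecutive letters below `a`. -/
theorem mean_pairSum_insert_below {q : ℝ} (hq : 0 < q) {k : ℕ} {s : Finset ℤ} (hs : s.card = k)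
    {a : ℤ} (ha : a ∉ s) {g : ℤ → ℤ → ℝ} (h0 : ∀ x y, 0 ≤ g x y) (h1 : ∀ x y, g x y ≤ 1)
    (hl : ∀ x y, a ≤ x → g x y = 0) (hr : ∀ x y, a ≤ y → g x y = 0) :
    mean q (k + 1) (insert a s) (pairSum g) ≤ mean q k s (pairSum g) ∧
      mean q k s (pairSum g) ≤ mean q (k + 1) (insert a s) (pairSum g) + 1 := by
  obtain ⟨N, hN⟩ : ∃ N, ∀ x ∈ insert a s, x < N := by
    obtain ⟨N, hN⟩ := (insert a s).bddAbove
    exact ⟨N + 1, fun x hx => Int.lt_add_one_of_le (hN hx)⟩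
  have hNs : ∀ x ∈ s, x < N := fun x hx => hN x (Finset.mem_insert_of_mem hx)
  have haN : a < N := hN a (Finset.mem_insert_self _ _)
  have hNn : N ∉ s := fun h => lt_irrefl _ (hNs N h)
  set T := insert N s
  -- An increasing bijection from `insert a s` onto `insert N s` that fixes the letters below `a`.
  -- Pairs with a letter at or above `a` count zero, so inserting `a` acts on the mean like
  -- inserting the new maximum `N`, which can then be erased.
  set φ : ℤ → ℤ := fun x => if x < a then x else nextIn T x with hφ
  have hcard : (insert a s).card = k + 1 := by rw [Finset.card_insert_of_notMem ha, hs]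
  have hmono : StrictMonoOn φ (insert a s : Finset ℤ) := by
    intro x hx y hy hxy
    simp only [hφ]
    split_ifs with hxa hya hya
    · exact hxy
    · exact hxa.trans_le ((not_lt.mp hya).trans (lt_nextIn T y).le)
    · exact absurd (hxy.trans hya) hxa
    · refine lt_of_le_of_lt (nextIn_le (Finset.mem_insert_of_mem ?_) hxy) (lt_nextIn T y)
      refine (Finset.mem_insert.mp hy).resolve_left fun e => ?_
      subst e; exact hxa hxy
  have himg : (insert a s).image φ = T := by
    refine Finset.eq_of_subset_of_card_le (fun y hy => ?_) ?_
    · obtain ⟨x, hx, rfl⟩ := Finset.mem_image.mp hy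
      simp only [hφ]
      split_ifs with hxa
      · refine Finset.mem_insert_of_mem ((Finset.mem_insert.mp hx).resolve_left hxa.ne)
      · exact nextIn_mem (Finset.mem_insert_self _ _) (hN x hx)
    · rw [Finset.card_image_of_injOn hmono.injOn, hcard, Finset.card_insert_of_notMem hNn, hs]
  have e1 : mean q (k + 1) (insert a s) (pairSum g) = mean q (k + 1) T (pairSum g) := by
    rw [← himg, mean_image hcard hmono]
    refine mean_congr hq hcard fun l _ _ => (pairSum_map l fun x _ y _ => ?_).symm
    simp only [hφ]
    split_ifs with hx hy hy
    · rfl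
    · rw [hr _ _ (not_lt.mp hy), hr _ _ ((not_lt.mp hy).trans (lt_nextIn T y).le)]
    · rw [hl _ _ (not_lt.mp hx), hl _ _ ((not_lt.mp hx).trans (lt_nextIn T x).le)]
    · rw [hl _ _ (not_lt.mp hx), hl _ _ ((not_lt.mp hx).trans (lt_nextIn T x).le)]
  have hT : T.card = k + 1 := by rw [Finset.card_insert_of_notMem hNn, hs]
  rw [e1, ← mean_erase_max hq hs hNs]
  refine ⟨mean_mono hq hT fun l _ _ => pairSum_le_pairSum_erase h0 (fun x => hr _ _ haN.le)
    (fun y => hl _ _ haN.le) l, ?_⟩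
  rw [add_comm _ (1 : ℝ), ← mean_const_add hq hT]
  refine mean_mono hq hT fun l _ _ => ?_
  rw [add_comm]
  exact pairSum_erase_le h1 (fun x => hr _ _ haN.le) (fun y => hl _ _ haN.le) l

/-- Negating the letters turns `q` into `q⁻¹` and reduces this to letters below `a`. -/
theorem mean_pairSum_insert_above {q : ℝ} (hq : 0 < q) {k : ℕ} {s : Finset ℤ} (hs : s.card = k)
    {a : ℤ} (ha : a ∉ s) {g : ℤ → ℤ → ℝ} (h0 : ∀ x y, 0 ≤ g x y) (h1 : ∀ x y, g x y ≤ 1)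
    (hl : ∀ x y, x ≤ a → g x y = 0) (hr : ∀ x y, y ≤ a → g x y = 0) :
    mean q (k + 1) (insert a s) (pairSum g) ≤ mean q k s (pairSum g) ∧
      mean q k s (pairSum g) ≤ mean q (k + 1) (insert a s) (pairSum g) + 1 := by
  have key : ∀ (k : ℕ) (s : Finset ℤ), s.card = k → mean q k s (pairSum g) =
      mean q⁻¹ k (s.image Neg.neg) (pairSum fun x y => g (-x) (-y)) := by
    intro k s hs
    rw [mean_image_neg hq hs]
    exact mean_congr hq hs fun l _ _ => (pairSum_map l fun x _ y _ => by simp).symm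
  rw [key k s hs, key (k + 1) (insert a s) (by rw [Finset.card_insert_of_notMem ha, hs]),
    Finset.image_insert]
  refine mean_pairSum_insert_below (inv_pos.mpr hq)
    (by rw [Finset.card_image_of_injective _ neg_injective, hs]) (by simpa using ha)
    (fun _ _ => h0 _ _) (fun _ _ => h1 _ _) (fun x y h => hl _ _ (by linarith))
    (fun x y h => hr _ _ (by linarith))

/-- The indicator of consecutive integers. -/
def succInd (x y : ℤ) : ℝ := if y = x + 1 then 1 else 0

theorem pairSum_le_count {g : ℤ → ℤ → ℝ} {a : ℤ} (h : ∀ x y, g x y ≤ if x = a then 1 else 0) :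
    ∀ l : List ℤ, pairSum g l ≤ l.count a
  | [] => by simp [pairSum]
  | [x] => by simp only [pairSum]; positivity
  | x :: y :: l => by
    have ih := pairSum_le_count h (y :: l)
    have := h x y
    rw [pairSum, List.count_cons]
    push_cast
    simp only [beq_iff_eq]
    linarith

theorem pairSum_le_count' {g : ℤ → ℤ → ℝ} {a : ℤ} (h : ∀ x y, g x y ≤ if y = a then 1 else 0) :
    ∀ l : List ℤ, pairSum g l ≤ l.tail.count a
  | [] => by simp [pairSum]
  | [x] => by simp [pairSum]
  | x :: y :: l => by
    have ih := pairSum_le_count' h (y :: l)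
    have := h x y
    rw [pairSum, List.tail_cons, List.count_cons]
    push_cast
    simp only [beq_iff_eq]
    rw [List.tail_cons] at ih
    linarith

theorem pairSum_nonneg {g : ℤ → ℤ → ℝ} (h : ∀ x y, 0 ≤ g x y) : ∀ l : List ℤ, 0 ≤ pairSum g l
  | [] => by simp [pairSum]
  | [x] => by simp [pairSum]
  | x :: y :: l => by
    have ih := pairSum_nonneg h (y :: l)
    rw [pairSum]; linarith [h x y]

/-- Two consecutive integers cannot straddle `a`: a pair lies below `a`, lies above `a`, or contains
`a`. Inserting `a` lowers the mean count of each of the first two kinds by at most 1, and raises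
that of the third from 0 to at most 2, one pair on each side of `a`. -/
theorem abs_mean_pairSum_insert_sub_le {q : ℝ} (hq : 0 < q) {k : ℕ} {s : Finset ℤ}
    (hs : s.card = k) {a : ℤ} (ha : a ∉ s) :
    |mean q (k + 1) (insert a s) (pairSum succInd) - mean q k s (pairSum succInd)| ≤ 2 := by
  set g₁ : ℤ → ℤ → ℝ := fun x y => if y = x + 1 ∧ y < a then 1 else 0 with hg₁
  set g₂ : ℤ → ℤ → ℝ := fun x y => if y = x + 1 ∧ a < x then 1 else 0 with hg₂
  set g₃ : ℤ → ℤ → ℝ := fun x y => if y = x + 1 ∧ x = a then 1 else 0 with hg₃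
  set g₄ : ℤ → ℤ → ℝ := fun x y => if y = x + 1 ∧ y = a then 1 else 0 with hg₄
  have hc : (insert a s).card = k + 1 := by rw [Finset.card_insert_of_notMem ha, hs]
  have hsplit : pairSum succInd = fun l =>
      (pairSum g₁ l + pairSum g₂ l) + (pairSum g₃ l + pairSum g₄ l) := by
    funext l
    rw [← pairSum_add, ← pairSum_add, ← pairSum_add]
    congr 1
    funext x y
    simp only [succInd, hg₁, hg₂, hg₃, hg₄]
    by_cases h : y = x + 1
    · subst h
      rcases lt_trichotomy (x + 1) a with h | h | h
      · simp [h, h.ne, show ¬ a < x by omega, show x ≠ a by omega]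
      · simp [h, show ¬ a < x by omega, show x ≠ a by omega]
      · rcases (Int.lt_add_one_iff.mp h).lt_or_eq with h' | h'
        · simp [h', h.ne', h.not_gt, h'.ne']
        · simp [h']
    · simp [h]
  have b1 := mean_pairSum_insert_below hq hs ha (g := g₁)
    (fun x y => by simp only [hg₁]; positivity) (fun x y => by simp only [hg₁]; split_ifs <;> norm_num)
    (fun x y h => by simp only [hg₁]; rw [if_neg]; omega)
    (fun x y h => by simp only [hg₁]; rw [if_neg]; omega)
  have b2 := mean_pairSum_insert_above hq hs ha (g := g₂)
    (fun x y => by simp only [hg₂]; positivity) (fun x y => by simp only [hg₂]; split_ifs <;> norm_num)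
    (fun x y h => by simp only [hg₂]; rw [if_neg]; omega)
    (fun x y h => by simp only [hg₂]; rw [if_neg]; omega)
  have b3 : ∀ l : List ℤ, l.Nodup → pairSum g₃ l ≤ 1 := fun l hl =>
    (pairSum_le_count (a := a) (fun x y => by
      simp only [hg₃]; by_cases h : x = a <;> simp [h]; split_ifs <;> norm_num) l).trans
      (by exact_mod_cast List.nodup_iff_count_le_one.mp hl a)
  have b4 : ∀ l : List ℤ, l.Nodup → pairSum g₄ l ≤ 1 := fun l hl =>
    (pairSum_le_count' (a := a) (fun x y => by
      simp only [hg₄]; by_cases h : y = a <;> simp [h]; split_ifs <;> norm_num) l).trans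
      (by exact_mod_cast List.nodup_iff_count_le_one.mp (hl.sublist (List.tail_sublist l)) a)
  have n3 : ∀ l, 0 ≤ pairSum g₃ l := pairSum_nonneg fun x y => by simp only [hg₃]; positivity
  have n4 : ∀ l, 0 ≤ pairSum g₄ l := pairSum_nonneg fun x y => by simp only [hg₄]; positivity
  have z : mean q k s (fun l => pairSum g₃ l + pairSum g₄ l) = 0 := by
    rw [← mean_const hq hs 0]
    refine mean_congr hq hs fun l hl hls => ?_
    have hal : l.count a = 0 := List.count_eq_zero.mpr fun h => ha (hls ▸ List.mem_toFinset.mpr h)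
    have hal' : l.tail.count a = 0 :=
      List.count_eq_zero.mpr fun h => ha (hls ▸ List.mem_toFinset.mpr (List.mem_of_mem_tail h))
    have c3 : pairSum g₃ l ≤ 0 := (pairSum_le_count (a := a) (fun x y => by
      simp only [hg₃]; by_cases h : x = a <;> simp [h]; split_ifs <;> norm_num) l).trans (by simp [hal])
    have c4 : pairSum g₄ l ≤ 0 := (pairSum_le_count' (a := a) (fun x y => by
      simp only [hg₄]; by_cases h : y = a <;> simp [h]; split_ifs <;> norm_num) l).trans
        (by simp [hal'])
    linarith [n3 l, n4 l]
  have u : mean q (k + 1) (insert a s) (fun l => pairSum g₃ l + pairSum g₄ l) ≤ 2 := by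
    rw [← mean_const hq hc 2]
    exact mean_mono hq hc fun l hl _ => by linarith [b3 l hl, b4 l hl]
  have u' : 0 ≤ mean q (k + 1) (insert a s) (fun l => pairSum g₃ l + pairSum g₄ l) := by
    rw [← mean_const hq hc 0]
    exact mean_mono hq hc fun l hl _ => by linarith [n3 l, n4 l]
  rw [hsplit, mean_add, mean_add, mean_add q k, mean_add q k, z, abs_le]
  constructor <;> linarith [b1.1, b1.2, b2.1, b2.2]

end MallowsWord

/-! ### The word statistic and its variance for a fixed set of letters. -/

namespace MallowsWord

/-- The change in the number of descents, up to sign and apart from the pair itself, when an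
ascending pair `y < z` preceded by `x` and followed by `t` is swapped. -/
def swapGain (x y z t : ℤ) : ℝ :=
  if y < z then 1 - (if y < x ∧ x < z then 1 else 0) - (if y < t ∧ t < z then 1 else 0) else 0

theorem abs_swapGain_le (x y z t : ℤ) : |swapGain x y z t| ≤ 1 := by
  unfold swapGain
  split_ifs <;> norm_num

theorem quadSum_swapGain_map {φ : ℤ → ℤ} : ∀ l : List ℤ, StrictMonoOn φ {x | x ∈ l} →
    quadSum swapGain (l.map φ) = quadSum swapGain l
  | [], _ => rfl
  | [_], _ => rfl
  | [_, _], _ => rfl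
  | [_, _, _], _ => rfl
  | x :: y :: z :: t :: l, h => by
    have ih := quadSum_swapGain_map (y :: z :: t :: l) (h.mono fun a ha =>
      List.mem_cons_of_mem _ ha)
    simp only [List.map_cons] at ih
    simp only [List.map_cons, quadSum, ih]
    have hx : x ∈ {a | a ∈ x :: y :: z :: t :: l} := by simp
    have hy : y ∈ {a | a ∈ x :: y :: z :: t :: l} := by simp
    have hz : z ∈ {a | a ∈ x :: y :: z :: t :: l} := by simp
    have ht : t ∈ {a | a ∈ x :: y :: z :: t :: l} := by simp
    congr 1
    unfold swapGain
    simp only [h.lt_iff_lt hy hz, h.lt_iff_lt hy hx, h.lt_iff_lt hx hz, h.lt_iff_lt hy ht,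
      h.lt_iff_lt ht hz]

theorem below_strictMonoOn (s : Finset ℤ) : StrictMonoOn (fun a => (below s a : ℤ)) s := by
  intro a ha b hb hab
  simp only [below, Nat.cast_lt]
  refine Finset.card_lt_card (Finset.ssubset_iff_of_subset ?_ |>.mpr ⟨a, ?_, ?_⟩)
  · exact fun x hx => Finset.mem_filter.mpr
      ⟨(Finset.mem_filter.mp hx).1, (Finset.mem_filter.mp hx).2.trans hab⟩
  · exact Finset.mem_filter.mpr ⟨ha, hab⟩
  · simp

theorem image_below (s : Finset ℤ) :
    s.image (fun a => (below s a : ℤ)) = Finset.Ico 0 (s.card : ℤ) := by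
  refine Finset.eq_of_subset_of_card_le (fun y hy => ?_) ?_
  · obtain ⟨a, ha, rfl⟩ := Finset.mem_image.mp hy
    refine Finset.mem_Ico.mpr ⟨by positivity, ?_⟩
    rw [Nat.cast_lt]
    exact Finset.card_lt_card (Finset.filter_ssubset.mpr ⟨a, ha, lt_irrefl a⟩)
  · rw [Finset.card_image_of_injOn (below_strictMonoOn s).injOn]
    simp

/-- The mean of a statistic of the relative order depends only on the number of letters. -/
theorem mean_quadSum_eq {q : ℝ} (hq : 0 < q) {k : ℕ} {s t : Finset ℤ} (hs : s.card = k)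
    (ht : t.card = k) :
    mean q k s (quadSum swapGain) = mean q k t (quadSum swapGain) := by
  have key : ∀ s : Finset ℤ, s.card = k →
      mean q k s (quadSum swapGain) = mean q k (Finset.Ico 0 (k : ℤ)) (quadSum swapGain) := by
    intro s hs
    -- Standardization: each letter is replaced by its rank, which preserves all comparisons.
    rw [← hs, ← image_below s, mean_image rfl (below_strictMonoOn s)]
    refine mean_congr hq rfl fun l _ hl => (quadSum_swapGain_map l ?_).symm
    exact (below_strictMonoOn s).mono fun x hx => by
      rw [← hl]; exact List.mem_toFinset.mpr hx
  rw [key s hs, key t ht]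

theorem abs_quadSum_cons_sub_le (x : ℤ) : ∀ l : List ℤ,
    |quadSum swapGain (x :: l) - quadSum swapGain l| ≤ 1
  | [] => by simp [quadSum]
  | [_] => by simp [quadSum]
  | [_, _] => by simp [quadSum]
  | y :: z :: t :: l => by rw [quadSum, add_sub_cancel_right]; exact abs_swapGain_le x y z t

theorem pairSum_cons_bounds (x : ℤ) : ∀ l : List ℤ,
    pairSum succInd l ≤ pairSum succInd (x :: l) ∧
      pairSum succInd (x :: l) ≤ pairSum succInd l + 1
  | [] => by simp [pairSum]
  | y :: l => by
    rw [pairSum, succInd]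
    split_ifs <;> constructor <;> linarith

/-- The statistic of an arrangement `l` that follows the letters `x, y, z`. -/
def wordStat (x y z : ℤ) (l : List ℤ) : ℝ :=
  quadSum swapGain (x :: y :: z :: l) + pairSum succInd (z :: l)

theorem wordStat_cons (x y z a : ℤ) (l : List ℤ) :
    wordStat x y z (a :: l) = (swapGain x y z a + succInd z a) + wordStat y z a l := by
  simp only [wordStat, quadSum, pairSum]; ring

/-- The three preceding letters add at most three `swapGain` terms in [-1, 1] and one `succInd` term
in [0, 1]. -/
theorem abs_wordStat_sub_le (x y z : ℤ) (l : List ℤ) :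
    -3 ≤ wordStat x y z l - (quadSum swapGain l + pairSum succInd l) ∧
      wordStat x y z l - (quadSum swapGain l + pairSum succInd l) ≤ 4 := by
  have h1 := abs_le.mp (abs_quadSum_cons_sub_le x (y :: z :: l))
  have h2 := abs_le.mp (abs_quadSum_cons_sub_le y (z :: l))
  have h3 := abs_le.mp (abs_quadSum_cons_sub_le z l)
  have h4 := pairSum_cons_bounds z l
  unfold wordStat
  constructor <;> linarith [h1.1, h1.2, h2.1, h2.2, h3.1, h3.2, h4.1, h4.2]

theorem mean_bounds {q : ℝ} (hq : 0 < q) {k : ℕ} {s : Finset ℤ} (hs : s.card = k)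
    {F G : List ℤ → ℝ} {a b : ℝ} (h : ∀ l, a ≤ F l - G l ∧ F l - G l ≤ b) :
    a ≤ mean q k s F - mean q k s G ∧ mean q k s F - mean q k s G ≤ b := by
  have h1 : a + mean q k s G ≤ mean q k s F := by
    rw [← mean_const_add hq hs]
    exact mean_mono hq hs fun l _ _ => by linarith [(h l).1]
  have h2 : mean q k s F ≤ b + mean q k s G := by
    rw [← mean_const_add hq hs]
    exact mean_mono hq hs fun l _ _ => by linarith [(h l).2]
  constructor <;> linarith

/-- The second moment about any point `c` dominates the variance. -/
theorem weighted_variance_le {ι : Type*} {s : Finset ι} {p e : ι → ℝ} (hp : ∀ i ∈ s, 0 ≤ p i)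
    (h1 : ∑ i ∈ s, p i = 1) {c r : ℝ} (he : ∀ i ∈ s, |e i - c| ≤ r) :
    ∑ i ∈ s, p i * e i ^ 2 - (∑ i ∈ s, p i * e i) ^ 2 ≤ r ^ 2 := by
  have h2 : ∑ i ∈ s, p i * (e i - c) ^ 2 ≤ r ^ 2 := by
    calc ∑ i ∈ s, p i * (e i - c) ^ 2 ≤ ∑ i ∈ s, p i * r ^ 2 :=
          Finset.sum_le_sum fun i hi => mul_le_mul_of_nonneg_left
            (sq_le_sq' (abs_le.mp (he i hi)).1 (abs_le.mp (he i hi)).2) (hp i hi)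
      _ = r ^ 2 := by rw [← Finset.sum_mul, h1, one_mul]
  have h3 : ∑ i ∈ s, p i * (e i - c) ^ 2 =
      ∑ i ∈ s, p i * e i ^ 2 - 2 * c * ∑ i ∈ s, p i * e i + c ^ 2 * ∑ i ∈ s, p i := by
    rw [Finset.mul_sum, Finset.mul_sum, ← Finset.sum_sub_distrib, ← Finset.sum_add_distrib]
    exact Finset.sum_congr rfl fun i _ => by ring
  rw [h1] at h3
  nlinarith [sq_nonneg (∑ i ∈ s, p i * e i - c)]

/-- Law of total variance with the first letter revealed: the conditional mean stays within 7 of a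
constant, so every letter costs at most 49. The three remembered letters make the remaining
statistic one of the same form. -/
theorem variance_wordStat_le {q : ℝ} (hq : 0 < q) {k : ℕ} {s : Finset ℤ} (hs : s.card = k)
    (x y z : ℤ) :
    mean q k s (fun l => wordStat x y z l ^ 2) - mean q k s (wordStat x y z) ^ 2 ≤ 49 * k := by
  induction k generalizing s x y z with
  | zero => simp [mean]
  | succ k ih =>
    obtain ⟨t₀, ht₀⟩ : ∃ t : Finset ℤ, t.card = k := ⟨Finset.Ico 0 (k : ℤ), by simp⟩
    -- Apart from the two means, `e a` collects `b a` in [-1, 2], a prefix error in [-3, 4] and a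
    -- shift of at most 2 from erasing `a`: in total [-6, 8], that is 1 ± 7.
    set c := mean q k t₀ (quadSum swapGain) + mean q (k + 1) s (pairSum succInd) + 1
    set b : ℤ → ℝ := fun a => swapGain x y z a + succInd z a
    set e : ℤ → ℝ := fun a => b a + mean q k (s.erase a) (wordStat y z a)
    have he : ∀ a ∈ s, |e a - c| ≤ 7 := by
      intro a ha
      have hc := card_erase_of_card hs ha
      have h1 := mean_bounds hq hc (abs_wordStat_sub_le y z a)
      rw [mean_add] at h1
      have h2 := abs_mean_pairSum_insert_sub_le hq hc (Finset.notMem_erase a s)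
      rw [Finset.insert_erase ha] at h2
      have h3 := mean_quadSum_eq hq hc ht₀
      have h4 := abs_le.mp (abs_swapGain_le x y z a)
      have h5 : 0 ≤ succInd z a ∧ succInd z a ≤ 1 := by
        unfold succInd; split_ifs <;> norm_num
      rw [abs_le] at h2 ⊢
      simp only [e, b, c]
      constructor <;> linarith [h1.1, h1.2, h2.1, h2.2, h4.1, h4.2, h5.1, h5.2]
    have h1 : mean q (k + 1) s (wordStat x y z) =
        ∑ a ∈ s, q ^ below s a / qNat q (k + 1) * e a := by
      rw [mean]
      refine Finset.sum_congr rfl fun a ha => ?_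
      simp only [wordStat_cons]
      rw [mean_const_add hq (card_erase_of_card hs ha)]
    have h2 : mean q (k + 1) s (fun l => wordStat x y z l ^ 2) ≤
        ∑ a ∈ s, q ^ below s a / qNat q (k + 1) * (e a ^ 2 + 49 * k) := by
      rw [mean]
      refine Finset.sum_le_sum fun a ha =>
        mul_le_mul_of_nonneg_left ?_ (weight_nonneg hq _ _ _)
      have hc := card_erase_of_card hs ha
      have h3 : (fun l => wordStat x y z (a :: l) ^ 2) =
          fun l => b a ^ 2 + (2 * b a * wordStat y z a l + wordStat y z a l ^ 2) := by
        funext l; rw [wordStat_cons]; ring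
      rw [h3, mean_const_add hq hc, mean_add, mean_smul]
      have := ih hc y z a
      simp only [e]
      nlinarith
    have h3 := weighted_variance_le (fun a _ => weight_nonneg hq k s a) (sum_weights hq hs) he
    simp only [mul_add, Finset.sum_add_distrib, ← Finset.sum_mul] at h2
    rw [sum_weights hq hs] at h2
    rw [h1]
    push_cast
    linarith

/-! ### Independent random signs. -/

/-- The mean of `G` over the sets of representatives of `[±n]` modulo sign, in which `-j` is
chosen rather than `j` with odds `q ^ j`. -/
noncomputable def signMean (q : ℝ) : ℕ → (Finset ℤ → ℝ) → ℝ
  | 0, G => G ∅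
  | n + 1, G => (signMean q n (fun s => G (insert ((n : ℤ) + 1) s)) +
      q ^ (n + 1) * signMean q n (fun s => G (insert (-((n : ℤ) + 1)) s))) / (1 + q ^ (n + 1))

theorem card_insert_of_abs_le {n : ℕ} {s : Finset ℤ} (hc : s.card = n) (h : ∀ x ∈ s, |x| ≤ n)
    {j : ℤ} (hj : |j| = n + 1) :
    (insert j s).card = n + 1 ∧ ∀ x ∈ insert j s, |x| ≤ ((n + 1 : ℕ) : ℤ) := by
  have hjs : j ∉ s := fun hjs => by have := h j hjs; omega
  refine ⟨by rw [Finset.card_insert_of_notMem hjs, hc], fun x hx => ?_⟩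
  rcases Finset.mem_insert.mp hx with rfl | hx
  · push_cast; omega
  · have := h x hx; push_cast; omega

theorem abs_succ_cast (n : ℕ) : |((n : ℤ) + 1)| = n + 1 := abs_of_nonneg (by positivity)

theorem abs_neg_succ_cast (n : ℕ) : |-((n : ℤ) + 1)| = n + 1 := by
  rw [abs_neg, abs_succ_cast]

theorem signMean_mono {q : ℝ} (hq : 0 < q) {n : ℕ} {G G' : Finset ℤ → ℝ}
    (h : ∀ s : Finset ℤ, s.card = n → (∀ x ∈ s, |x| ≤ n) → G s ≤ G' s) :
    signMean q n G ≤ signMean q n G' := by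
  induction n generalizing G G' with
  | zero => exact h ∅ rfl (by simp)
  | succ n ih =>
    have h1 := ih (G := fun s => G (insert ((n : ℤ) + 1) s))
      (G' := fun s => G' (insert ((n : ℤ) + 1) s)) fun s hc hs =>
      have := card_insert_of_abs_le hc hs (abs_succ_cast n)
      h _ this.1 this.2
    have h2 := ih (G := fun s => G (insert (-((n : ℤ) + 1)) s))
      (G' := fun s => G' (insert (-((n : ℤ) + 1)) s)) fun s hc hs =>
      have := card_insert_of_abs_le hc hs (abs_neg_succ_cast n)
      h _ this.1 this.2
    rw [signMean, signMean]
    gcongr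

theorem signMean_add (q : ℝ) (n : ℕ) (G G' : Finset ℤ → ℝ) :
    signMean q n (fun s => G s + G' s) = signMean q n G + signMean q n G' := by
  induction n generalizing G G' with
  | zero => rfl
  | succ n ih => simp only [signMean, ih]; ring

theorem signMean_const {q : ℝ} (hq : 0 < q) (n : ℕ) (c : ℝ) : signMean q n (fun _ => c) = c := by
  induction n with
  | zero => rfl
  | succ n ih =>
    have : 0 < 1 + q ^ (n + 1) := by positivity
    rw [signMean, ih]; field_simp

/-- A statistic that changes by at most `D` when the sign of one representative is changed has
variance at most `n D ^ 2 / 4`. -/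
theorem variance_signMean_le {q : ℝ} (hq : 0 < q) {D : ℝ} {n : ℕ} {G : Finset ℤ → ℝ}
    (h : ∀ (s : Finset ℤ) (j : ℤ), s.card + 1 = n → j ∉ s → -j ∉ s →
      |G (insert j s) - G (insert (-j) s)| ≤ D) :
    signMean q n (fun s => G s ^ 2) - signMean q n G ^ 2 ≤ n * (D ^ 2 / 4) := by
  -- The difference bound is required only within [-n, n]. In this form it passes to `G (insert i
  -- ·)` with |i| = n + 1, since such an `i` is neither in `s` nor equal to ±j.
  suffices H : ∀ (n : ℕ) (G : Finset ℤ → ℝ),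
      (∀ (s : Finset ℤ) (j : ℤ), s.card + 1 = n → j ∉ s → -j ∉ s → |j| ≤ n → (∀ x ∈ s, |x| ≤ n) →
        |G (insert j s) - G (insert (-j) s)| ≤ D) →
      signMean q n (fun s => G s ^ 2) - signMean q n G ^ 2 ≤ n * (D ^ 2 / 4) from
    H n G fun s j h1 h2 h3 _ _ => h s j h1 h2 h3
  intro n
  induction n with
  | zero => intro G _; simp [signMean]
  | succ n ih =>
    intro G h
    have step : ∀ i : ℤ, |i| = n + 1 →
        signMean q n (fun s => G (insert i s) ^ 2) - signMean q n (fun s => G (insert i s)) ^ 2 ≤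
          n * (D ^ 2 / 4) := by
      intro i hi
      refine ih (fun s => G (insert i s)) fun s j hc hj hj' hjn hs => ?_
      have his : i ∉ s := fun his => by have := hs i his; omega
      have hij : i ≠ j := fun e => by subst e; omega
      have hij' : i ≠ -j := fun e => by rw [e, abs_neg] at hi; omega
      rw [Finset.insert_comm, Finset.insert_comm i]
      refine h _ _ ?_ ?_ ?_ ?_ ?_
      · rw [Finset.card_insert_of_notMem his, hc]
      · simp [hj, hij.symm]
      · simp [hj', hij'.symm]
      · push_cast; omega
      · intro x hx
        rcases Finset.mem_insert.mp hx with rfl | hx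
        · push_cast; omega
        · have := hs x hx; push_cast; omega
    have h1 := step _ (abs_succ_cast n)
    have h2 := step _ (abs_neg_succ_cast n)
    have hb : ∀ s : Finset ℤ, s.card = n → (∀ x ∈ s, |x| ≤ n) →
        |G (insert ((n : ℤ) + 1) s) - G (insert (-((n : ℤ) + 1)) s)| ≤ D := by
      intro s hc hs
      refine h s _ (by rw [hc]) (fun hm => ?_) (fun hm => ?_) (by push_cast; rw [abs_succ_cast]) ?_
      · have := hs _ hm; rw [abs_succ_cast] at this; omega
      · have := hs _ hm; rw [abs_neg_succ_cast] at this; omega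
      · intro x hx; have := hs x hx; push_cast; omega
    set A := signMean q n (fun s => G (insert ((n : ℤ) + 1) s))
    set B := signMean q n (fun s => G (insert (-((n : ℤ) + 1)) s))
    have hAB : |A - B| ≤ D := by
      have u : A ≤ D + B := by
        rw [← signMean_const hq n D, ← signMean_add]
        exact signMean_mono hq fun s hc hs => by linarith [(abs_le.mp (hb s hc hs)).2]
      have v : B ≤ D + A := by
        rw [← signMean_const hq n D, ← signMean_add]
        exact signMean_mono hq fun s hc hs => by linarith [(abs_le.mp (hb s hc hs)).1]
      rw [abs_le]; constructor <;> linarith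
    have hsq : (A - B) ^ 2 ≤ D ^ 2 := sq_le_sq' (by linarith [abs_le.mp hAB]) (abs_le.mp hAB).2
    set x := q ^ (n + 1)
    have hx : 0 < x := by positivity
    rw [signMean, signMean]
    set A' := signMean q n (fun s => G (insert ((n : ℤ) + 1) s) ^ 2)
    set B' := signMean q n (fun s => G (insert (-((n : ℤ) + 1)) s) ^ 2)
    -- Variance of a two-point mixture: the mean of the variances plus x/(1+x)² ≤ 1/4 times the
    -- squared gap of the means.
    have e : (A' + x * B') / (1 + x) - ((A + x * B) / (1 + x)) ^ 2 =
        ((A' - A ^ 2) + x * (B' - B ^ 2)) / (1 + x) + x / (1 + x) ^ 2 * (A - B) ^ 2 := by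
      field_simp; ring
    have e1 : ((A' - A ^ 2) + x * (B' - B ^ 2)) / (1 + x) ≤ n * (D ^ 2 / 4) := by
      rw [div_le_iff₀ (by positivity)]
      nlinarith
    have e2 : x / (1 + x) ^ 2 * (A - B) ^ 2 ≤ 1 / 4 * D ^ 2 := by
      refine mul_le_mul ?_ hsq (sq_nonneg _) (by norm_num)
      rw [div_le_iff₀ (by positivity)]
      nlinarith [sq_nonneg (1 - x)]
    change (A' + x * B') / (1 + x) - ((A + x * B) / (1 + x)) ^ 2 ≤ _
    rw [e]
    push_cast
    linarith

/-- The variance of the statistic `wordStat` of a random signed arrangement. -/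
theorem variance_signMean_wordStat_le {q : ℝ} (hq : 0 < q) (n : ℕ) :
    signMean q n (fun s => mean q n s fun l => wordStat 0 0 0 l ^ 2) -
      signMean q n (fun s => mean q n s (wordStat 0 0 0)) ^ 2 ≤ 317 / 4 * n := by
  have h1 : signMean q n (fun s => mean q n s fun l => wordStat 0 0 0 l ^ 2) ≤
      49 * n + signMean q n (fun s => mean q n s (wordStat 0 0 0) ^ 2) := by
    rw [← signMean_const hq n (49 * n), ← signMean_add]
    exact signMean_mono hq fun s hc _ => by linarith [variance_wordStat_le hq hc 0 0 0]
  -- Two prefix errors in [-3, 4] differ by at most 7, and the succession means for `j` and `-j` are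
  -- each within 2 of the one for `s`: 7 + 2 + 2 = 11. Then 49 + 11²/4 = 317/4.
  have h2 := variance_signMean_le hq (D := 11) (n := n)
    (G := fun s => mean q n s (wordStat 0 0 0)) fun s j hc hj hj' => by
      subst hc
      have c1 : (insert j s).card = s.card + 1 := Finset.card_insert_of_notMem hj
      have c2 : (insert (-j) s).card = s.card + 1 := Finset.card_insert_of_notMem hj'
      have a1 := mean_bounds hq c1 (abs_wordStat_sub_le 0 0 0)
      have a2 := mean_bounds hq c2 (abs_wordStat_sub_le 0 0 0)
      rw [mean_add, mean_quadSum_eq hq c1 c2] at a1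
      rw [mean_add] at a2
      have b1 := abs_le.mp (abs_mean_pairSum_insert_sub_le hq rfl hj)
      have b2 := abs_le.mp (abs_mean_pairSum_insert_sub_le hq rfl hj')
      rw [abs_le]
      constructor <;> linarith [a1.1, a1.2, a2.1, a2.2, b1.1, b1.2, b2.1, b2.2]
  linarith

end MallowsWord

/-! ### Signed permutations acting on ℤ, and the combinatorial length. -/

namespace TypeB

variable {n : ℕ}

/-- The action of a signed permutation on `ℤ`, trivial outside `[±n]`. -/
noncomputable def toPerm : B n →* Equiv.Perm ℤ := Equiv.Perm.ofSubtype.comp (B n).subtype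

theorem mem_index {k : ℤ} : k ∈ (Finset.Icc (-(n : ℤ)) (n : ℤ)).erase 0 ↔ k ≠ 0 ∧ |k| ≤ n := by
  rw [Finset.mem_erase, Finset.mem_Icc, abs_le]

theorem toPerm_coe (w : B n) (k : SignedIndex n) : toPerm w k = (w.1 k : ℤ) :=
  Equiv.Perm.ofSubtype_apply_coe w.1 k

theorem toPerm_of_notMem (w : B n) {k : ℤ} (hk : ¬ (k ≠ 0 ∧ |k| ≤ n)) : toPerm w k = k :=
  Equiv.Perm.ofSubtype_apply_of_not_mem w.1 (by rwa [mem_index])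

theorem toPerm_neg (w : B n) (k : ℤ) : toPerm w (-k) = -toPerm w k := by
  by_cases hk : k ≠ 0 ∧ |k| ≤ n
  · have h := toPerm_coe w (-⟨k, mem_index.mpr hk⟩ : SignedIndex n)
    rw [show w.1 (-⟨k, mem_index.mpr hk⟩) = -w.1 ⟨k, mem_index.mpr hk⟩ from w.2 _, coe_neg,
      coe_neg, ← toPerm_coe] at h
    exact h
  · rw [toPerm_of_notMem w hk, toPerm_of_notMem w (by rwa [abs_neg, neg_ne_zero])]

theorem toPerm_zero (w : B n) : toPerm w 0 = 0 := toPerm_of_notMem w (by simp)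

theorem toPerm_mem (w : B n) {k : ℤ} (hk : k ≠ 0 ∧ |k| ≤ n) :
    toPerm w k ≠ 0 ∧ |toPerm w k| ≤ n := by
  have h := toPerm_coe w ⟨k, mem_index.mpr hk⟩
  simp only at h
  rw [h]
  exact mem_index.mp (w.1 _).2

theorem toPerm_injective : Function.Injective (toPerm (n := n)) :=
  fun _ _ h => Subtype.ext (Equiv.Perm.ofSubtype_injective h)

theorem toPerm_inv_apply (w : B n) (k l : ℤ) : toPerm w⁻¹ k = l ↔ toPerm w l = k := by
  rw [map_inv, Equiv.Perm.inv_eq_iff_eq, eq_comm]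

/-- The action of the generator `s_i` on `ℤ`. -/
def genFun (i : ℕ) (k : ℤ) : ℤ :=
  if i = 0 then if k = 1 then -1 else if k = -1 then 1 else k
  else if k = i then i + 1 else if k = i + 1 then i
  else if k = -i then -(i + 1) else if k = -(i + 1) then -i else k

theorem toPerm_gen (i : Fin n) (k : ℤ) : toPerm (gen i) k = genFun i k := by
  have hi := i.2
  by_cases hk : k ≠ 0 ∧ |k| ≤ n
  · have h := toPerm_coe (gen i) ⟨k, mem_index.mpr hk⟩
    simp only at h
    rw [h]
    obtain ⟨hk0, -⟩ := hk
    simp only [gen, genPerm, genFun]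
    by_cases h0 : (i : ℕ) = 0
    · simp only [h0, if_true, Equiv.swap_apply_def, Subtype.ext_iff, coe_neg, coe_pos]
      split_ifs <;> simp only [coe_neg, coe_pos, h0] <;> push_cast at * <;> omega
    · obtain ⟨m, hm⟩ := i
      obtain ⟨m, rfl⟩ : ∃ m', m = m' + 1 := ⟨m - 1, by simp only at h0; omega⟩
      simp only [h0, if_false, Equiv.Perm.mul_apply, Equiv.swap_apply_def, Subtype.ext_iff]
      split_ifs <;> simp only [coe_neg, coe_pos] at * <;> push_cast at * <;> omega
  · rw [toPerm_of_notMem _ hk, genFun]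
    rw [not_and_or, not_not, not_le] at hk
    rw [Int.abs_eq_natAbs] at hk
    grind

theorem genFun_genFun (i : ℕ) (k : ℤ) : genFun i (genFun i k) = k := by
  unfold genFun
  grind

theorem gen_mul_gen (i : Fin n) : gen i * gen i = 1 := by
  refine toPerm_injective (Equiv.ext fun k => ?_)
  rw [map_mul, Equiv.Perm.mul_apply, toPerm_gen, toPerm_gen, genFun_genFun, map_one,
    Equiv.Perm.one_apply]

theorem gen_inv (i : Fin n) : (gen i)⁻¹ = gen i := inv_eq_of_mul_eq_one_left (gen_mul_gen i)

theorem toPerm_mul_gen (w : B n) (i : Fin n) (k : ℤ) :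
    toPerm (w * gen i) k = toPerm w (genFun i k) := by
  rw [map_mul, Equiv.Perm.mul_apply, toPerm_gen]

theorem toPerm_gen_mul (w : B n) (i : Fin n) (k : ℤ) :
    toPerm (gen i * w) k = genFun i (toPerm w k) := by
  rw [map_mul, Equiv.Perm.mul_apply, toPerm_gen]

/-- The letters `w(1), …, w(n)`. -/
noncomputable def word (w : B n) : List ℤ := (List.range n).map fun k : ℕ => toPerm w ((k : ℤ) + 1)

/-- The number of inversions of a word. -/
def inversions : List ℤ → ℕ
  | [] => 0
  | a :: l => l.countP (· < a) + inversions l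

/-- The sum of the absolute values of the negative letters of a word. -/
def negSum (l : List ℤ) : ℕ := (l.map fun x => (-x).toNat).sum

theorem inversions_swap {y z : ℤ} (h : y < z) (r : List ℤ) : ∀ p : List ℤ,
    inversions (p ++ z :: y :: r) = inversions (p ++ y :: z :: r) + 1
  | [] => by
    simp only [List.nil_append, inversions, List.countP_cons, decide_eq_true_eq, h, if_true,
      h.not_gt, if_false]
    simp; omega
  | a :: p => by
    rw [List.cons_append, List.cons_append, inversions, inversions, inversions_swap h r p,
      List.Perm.countP_eq _ ((List.Perm.swap y z r).append_left p), add_assoc]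

theorem negSum_append (p r : List ℤ) : negSum (p ++ r) = negSum p + negSum r := by
  simp [negSum]

theorem negSum_cons (a : ℤ) (r : List ℤ) : negSum (a :: r) = (-a).toNat + negSum r := by
  simp [negSum]

/-- The combinatorial length of a signed permutation. -/
noncomputable def wordLength (w : B n) : ℕ := inversions (word w) + negSum (word w)

theorem map_range_split (f : ℕ → ℤ) (i m : ℕ) :
    (List.range (i + (m + 2))).map f =
      (List.range i).map f ++ f i :: f (i + 1) :: (List.range m).map fun k => f (i + (k + 2)) := by
  rw [List.range_add, List.map_append, List.range_succ_eq_map, List.range_succ_eq_map]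
  simp [Function.comp_def, add_assoc]

/-- Swapping an adjacent ascent creates exactly one inversion and keeps the letters, hence `negSum`.
-/
theorem wordLength_mul_gen_of_pos {i : Fin n} (hi : (i : ℕ) ≠ 0) {w : B n}
    (h : toPerm w i < toPerm w (i + 1)) : wordLength (w * gen i) = wordLength w + 1 := by
  obtain ⟨i, hin⟩ := i
  obtain ⟨j, rfl⟩ : ∃ j, i = j + 1 := ⟨i - 1, by simp only at hi; omega⟩
  obtain ⟨m, rfl⟩ : ∃ m, n = j + (m + 2) := ⟨n - j - 2, by omega⟩
  simp only [Nat.cast_add, Nat.cast_one] at h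
  have e1 := map_range_split (fun k : ℕ => toPerm w ((k : ℤ) + 1)) j m
  have e2 := map_range_split (fun k : ℕ => toPerm (w * gen ⟨j + 1, hin⟩) ((k : ℤ) + 1)) j m
  have e3 : (List.range j).map (fun k : ℕ => toPerm (w * gen ⟨j + 1, hin⟩) ((k : ℤ) + 1)) =
      (List.range j).map fun k : ℕ => toPerm w ((k : ℤ) + 1) := by
    refine List.map_congr_left fun k hk => ?_
    rw [List.mem_range] at hk
    rw [toPerm_mul_gen]
    congr 1
    simp only [genFun]; push_cast
    split_ifs <;> omega
  have e4 : (List.range m).map (fun k : ℕ =>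
      toPerm (w * gen ⟨j + 1, hin⟩) (((j + (k + 2) : ℕ) : ℤ) + 1)) =
      (List.range m).map fun k : ℕ => toPerm w (((j + (k + 2) : ℕ) : ℤ) + 1) := by
    refine List.map_congr_left fun k hk => ?_
    rw [toPerm_mul_gen]
    congr 1
    simp only [genFun]; push_cast
    split_ifs <;> omega
  have e5 : toPerm (w * gen ⟨j + 1, hin⟩) ((j : ℤ) + 1) = toPerm w ((j : ℤ) + 1 + 1) := by
    rw [toPerm_mul_gen]
    congr 1
    simp only [genFun]; push_cast
    split_ifs <;> omega
  have e6 : toPerm (w * gen ⟨j + 1, hin⟩) (((j + 1 : ℕ) : ℤ) + 1) = toPerm w ((j : ℤ) + 1) := by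
    rw [toPerm_mul_gen]
    congr 1
    simp only [genFun]; push_cast
    split_ifs <;> omega
  rw [e3, e4, e5, e6] at e2
  rw [wordLength, wordLength, word, word, e1, e2]
  push_cast
  rw [inversions_swap h, negSum_append, negSum_append]
  simp only [negSum_cons]
  omega

/-- The absolute values of the letters are a permutation of 1, …, n; the inverse map is read off
from |w⁻¹(j)|. -/
theorem card_natAbs_lt (w : B n) {y : ℕ} (hy : (y : ℤ) ≤ n) :
    ((Finset.range n).filter fun k : ℕ => (toPerm w ((k : ℤ) + 1)).natAbs < y).card = y - 1 := by
  have hr : (Finset.Ico 1 y).card = y - 1 := by simp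
  rw [← hr]
  refine Finset.card_nbij' (fun k => (toPerm w ((k : ℤ) + 1)).natAbs)
    (fun j => (toPerm w⁻¹ (j : ℤ)).natAbs - 1) ?_ ?_ ?_ ?_
  · intro k hk
    simp only [Finset.coe_filter, Finset.mem_range, Set.mem_ofPred_eq] at hk
    have := toPerm_mem w (k := (k : ℤ) + 1) ⟨by omega, by rw [abs_of_nonneg] <;> omega⟩
    simp only [Finset.coe_Ico, Set.mem_Ico]
    omega
  · intro j hj
    simp only [Finset.coe_Ico, Set.mem_Ico] at hj
    have := toPerm_mem w⁻¹ (k := (j : ℤ)) ⟨by omega, by rw [abs_of_nonneg] <;> omega⟩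
    have e : ((((toPerm w⁻¹ (j : ℤ)).natAbs - 1 : ℕ) : ℤ) + 1) = |toPerm w⁻¹ (j : ℤ)| := by
      have := Int.abs_eq_natAbs (toPerm w⁻¹ (j : ℤ)); omega
    simp only [Finset.coe_filter, Finset.mem_range, Set.mem_ofPred_eq, e]
    refine ⟨by omega, ?_⟩
    rcases abs_choice (toPerm w⁻¹ (j : ℤ)) with h | h
    · rw [h, (toPerm_inv_apply w _ _).mp rfl]; omega
    · rw [h, toPerm_neg, (toPerm_inv_apply w _ _).mp rfl]; omega
  · intro k hk
    simp only [Finset.coe_filter, Finset.mem_range, Set.mem_ofPred_eq] at hk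
    have : toPerm w⁻¹ ((toPerm w ((k : ℤ) + 1)).natAbs : ℤ) = k + 1 ∨
        toPerm w⁻¹ ((toPerm w ((k : ℤ) + 1)).natAbs : ℤ) = -(k + 1) := by
      rw [toPerm_inv_apply, toPerm_inv_apply, toPerm_neg]
      omega
    simp only
    omega
  · intro j hj
    simp only [Finset.coe_Ico, Set.mem_Ico] at hj
    have := toPerm_mem w⁻¹ (k := (j : ℤ)) ⟨by omega, by rw [abs_of_nonneg] <;> omega⟩
    have e : ((((toPerm w⁻¹ (j : ℤ)).natAbs - 1 : ℕ) : ℤ) + 1) = |toPerm w⁻¹ (j : ℤ)| := by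
      have := Int.abs_eq_natAbs (toPerm w⁻¹ (j : ℤ)); omega
    simp only [e]
    rcases abs_choice (toPerm w⁻¹ (j : ℤ)) with h | h
    · rw [h, (toPerm_inv_apply w _ _).mp rfl]; omega
    · rw [h, toPerm_neg, (toPerm_inv_apply w _ _).mp rfl]; omega

/-- When the first letter y > 0 becomes -y, the y - 1 later letters of absolute value below y stop
forming inversions with it, while `negSum` grows by y: a net change of one. -/
theorem wordLength_mul_gen_of_zero {i : Fin n} (hi : (i : ℕ) = 0) {w : B n}
    (h : 0 < toPerm w 1) : wordLength (w * gen i) = wordLength w + 1 := by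
  obtain ⟨i, hin⟩ := i
  simp only at hi
  subst hi
  obtain ⟨m, rfl⟩ : ∃ m, n = m + 1 := ⟨n - 1, by omega⟩
  obtain ⟨y, hy⟩ : ∃ y : ℕ, toPerm w 1 = y := ⟨(toPerm w 1).toNat, by omega⟩
  have hyn := toPerm_mem w (k := 1) ⟨one_ne_zero, by simp⟩
  rw [hy, Nat.abs_cast] at hyn
  set r := (List.range m).map fun k : ℕ => toPerm w ((k : ℤ) + 1 + 1) with hr
  have e1 : word w = toPerm w 1 :: r := by
    rw [word, List.range_succ_eq_map]
    simp [r, Function.comp_def]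
  have e2 : word (w * gen ⟨0, hin⟩) = -toPerm w 1 :: r := by
    rw [word, List.range_succ_eq_map, List.map_cons, List.map_map]
    congr 1
    · rw [toPerm_mul_gen, ← toPerm_neg]; rfl
    · refine List.map_congr_left fun k _ => ?_
      rw [Function.comp_apply, toPerm_mul_gen]
      congr 1
  have e3 : r.countP (· < (y : ℤ)) = r.countP (· < -(y : ℤ)) + (y - 1) := by
    have hc := card_natAbs_lt w hyn.2
    have hc' : ((Finset.range (m + 1)).filter
        fun k : ℕ => (toPerm w ((k : ℤ) + 1)).natAbs < y).card =
        r.countP (fun x => x.natAbs < y) := by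
      have : r.countP (fun x => x.natAbs < y) = (word w).countP (fun x => x.natAbs < y) := by
        rw [e1, List.countP_cons, hy]; simp
      rw [this, word, List.countP_map, List.countP_eq_length_filter]
      rfl
    have hne : ∀ x ∈ r, x ≠ -(y : ℤ) := by
      intro x hx
      obtain ⟨k, -, rfl⟩ := List.mem_map.mp hx
      rw [← hy, ← toPerm_neg]
      intro e
      have := (toPerm w).injective e
      omega
    rw [← hc, hc']
    clear_value r
    clear hc hc' e1 e2 hr
    induction r with
    | nil => rfl
    | cons x r ih =>
      have := ih fun x hx => hne x (List.mem_cons_of_mem _ hx)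
      have hx := hne x (by simp)
      simp only [List.countP_cons, decide_eq_true_eq]
      split_ifs <;> omega
  rw [wordLength, wordLength, e1, e2, hy]
  simp only [inversions, negSum_cons, e3]
  have : 0 < y := by omega
  omega

theorem wordLength_mul_gen {i : Fin n} {w : B n} (h : toPerm w i < toPerm w (i + 1)) :
    wordLength (w * gen i) = wordLength w + 1 := by
  by_cases hi : (i : ℕ) = 0
  · refine wordLength_mul_gen_of_zero hi ?_
    simpa [hi, toPerm_zero] using h
  · exact wordLength_mul_gen_of_pos hi h

theorem toPerm_mul_gen_lt_iff (w : B n) (i : Fin n) :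
    toPerm (w * gen i) i < toPerm (w * gen i) (i + 1) ↔ toPerm w (i + 1) < toPerm w i := by
  rw [toPerm_mul_gen, toPerm_mul_gen]
  by_cases hi : (i : ℕ) = 0
  · simp [hi, genFun, toPerm_neg, toPerm_zero]
  · simp [genFun, hi]

theorem wordLength_mul_gen_of_gt {i : Fin n} {w : B n} (h : toPerm w (i + 1) < toPerm w i) :
    wordLength (w * gen i) + 1 = wordLength w := by
  have := wordLength_mul_gen ((toPerm_mul_gen_lt_iff w i).mpr h)
  rw [mul_assoc, gen_mul_gen, mul_one] at this
  exact this.symm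

theorem toPerm_succ_ne (w : B n) (k : ℤ) : toPerm w k ≠ toPerm w (k + 1) := fun h => by
  have := (toPerm w).injective h; omega

/-- Climbing from w(0) = 0 gives k ≤ w(k), and descending from w(n) ≤ n gives w(k) ≤ k. -/
theorem eq_one_of_forall_lt {w : B n} (h : ∀ i : Fin n, toPerm w i < toPerm w (i + 1)) : w = 1 := by
  have h1 : ∀ k : ℕ, k ≤ n → (k : ℤ) ≤ toPerm w k := by
    intro k
    induction k with
    | zero => intro _; rw [Nat.cast_zero, toPerm_zero]
    | succ k ih =>
      intro hk
      have a := h ⟨k, by omega⟩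
      have b := ih (by omega)
      simp only at a
      push_cast; omega
  have h2 : ∀ m : ℕ, m ≤ n → toPerm w ((n - m : ℕ) : ℤ) ≤ ((n - m : ℕ) : ℤ) := by
    intro m
    induction m with
    | zero =>
      intro _
      by_cases hn : n = 0
      · subst hn; simp [toPerm_zero]
      · have := toPerm_mem w (k := (n : ℤ)) ⟨by exact_mod_cast hn, by simp⟩
        rw [Nat.sub_zero]; exact (le_abs_self _).trans this.2
    | succ m ih =>
      intro hm
      have a := h ⟨n - (m + 1), by omega⟩
      have b := ih (by omega)
      have c : ((n - (m + 1) : ℕ) : ℤ) + 1 = ((n - m : ℕ) : ℤ) := by omega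
      simp only [c] at a
      omega
  have h3 : ∀ k : ℕ, toPerm w k = k := by
    intro k
    by_cases hk : k ≤ n
    · have := h2 (n - k) (by omega)
      rw [show n - (n - k) = k by omega] at this
      exact le_antisymm this (h1 k hk)
    · exact toPerm_of_notMem w (by rw [Nat.abs_cast]; omega)
  refine toPerm_injective (Equiv.ext fun k => ?_)
  rw [map_one, Equiv.Perm.one_apply]
  rcases Int.natAbs_eq k with e | e
  · rw [e, h3]
  · rw [e, toPerm_neg, h3]

theorem inversions_eq_zero : ∀ l : List ℤ, l.Pairwise (· ≤ ·) → inversions l = 0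
  | [], _ => rfl
  | a :: l, h => by
    rw [List.pairwise_cons] at h
    rw [inversions, inversions_eq_zero l h.2, List.countP_eq_zero.mpr fun x hx => by
      simpa using h.1 x hx]

theorem wordLength_one : wordLength (1 : B n) = 0 := by
  have e : word (1 : B n) = (List.range n).map fun k : ℕ => (k : ℤ) + 1 := by simp [word]
  rw [wordLength, e, inversions_eq_zero, negSum, List.sum_eq_zero]
  · rfl
  · intro x hx
    simp only [List.map_map, List.mem_map, List.mem_range, Function.comp_apply] at hx
    obtain ⟨k, -, rfl⟩ := hx
    omega
  · rw [List.pairwise_map]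
    exact List.pairwise_lt_range.imp fun h => by omega

/-- Sorting: as long as a descent remains, multiplying by its generator lowers `wordLength` by one.
-/
theorem exists_prod_eq (w : B n) :
    ∃ L : List (Fin n), L.length = wordLength w ∧ (L.map gen).prod = w := by
  induction hk : wordLength w using Nat.strong_induction_on generalizing w with
  | _ k ih =>
    by_cases h : ∀ i : Fin n, toPerm w i < toPerm w (i + 1)
    · obtain rfl := eq_one_of_forall_lt h
      exact ⟨[], by rw [← hk, wordLength_one]; rfl, rfl⟩
    · push Not at h
      obtain ⟨i, hi⟩ := h
      have h1 := wordLength_mul_gen_of_gt (lt_of_le_of_ne hi (toPerm_succ_ne w i).symm)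
      obtain ⟨L, hL, hw⟩ := ih _ (by omega) (w * gen i) rfl
      refine ⟨L ++ [i], by rw [List.length_append, hL, ← hk, ← h1]; rfl, ?_⟩
      rw [List.map_append, List.prod_append, hw, List.map_singleton, List.prod_singleton, mul_assoc,
        gen_mul_gen, mul_one]

theorem wordLength_prod_le (L : List (Fin n)) : wordLength (L.map gen).prod ≤ L.length := by
  induction L using List.reverseRecOn with
  | nil => simp [wordLength_one]
  | append_singleton L i ih =>
    rw [List.map_append, List.prod_append, List.map_singleton, List.prod_singleton,
      List.length_append, List.length_singleton]
    rcases lt_or_gt_of_ne (toPerm_succ_ne (L.map gen).prod i) with h | h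
    · rw [wordLength_mul_gen h]; omega
    · have := wordLength_mul_gen_of_gt h; omega

/-- A generator changes `wordLength` by one, so no expression is shorter; sorting attains the bound.
-/
theorem length_eq (w : B n) : length w = wordLength w := by
  obtain ⟨L, hL, hw⟩ := exists_prod_eq w
  refine le_antisymm (Nat.sInf_le ⟨L, hL, hw⟩) ?_
  have hne : {k : ℕ | ∃ L : List (Fin n), L.length = k ∧ (L.map gen).prod = w}.Nonempty :=
    ⟨_, L, hL, hw⟩
  obtain ⟨L', hL', hw'⟩ := Nat.sInf_mem hne
  rw [length, ← hL', ← hw']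
  exact wordLength_prod_le L'

theorem length_mul_gen {i : Fin n} {w : B n} (h : toPerm w i < toPerm w (i + 1)) :
    length (w * gen i) = length w + 1 := by
  rw [length_eq, length_eq, wordLength_mul_gen h]

theorem length_mul_gen_of_gt {i : Fin n} {w : B n} (h : toPerm w (i + 1) < toPerm w i) :
    length (w * gen i) + 1 = length w := by
  rw [length_eq, length_eq, wordLength_mul_gen_of_gt h]

theorem hasDescent_iff (w : B n) (i : Fin n) :
    HasDescent w i ↔ toPerm w (i + 1) < toPerm w i := by
  rw [HasDescent]
  rcases lt_or_gt_of_ne (toPerm_succ_ne w i) with h | h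
  · rw [length_mul_gen h]; simp [h.le]
  · have := length_mul_gen_of_gt h
    simp only [h, iff_true]; omega

theorem length_inv (w : B n) : length w⁻¹ = length w := by
  suffices H : ∀ v : B n, length v⁻¹ ≤ length v from
    le_antisymm (H w) (by simpa using H w⁻¹)
  intro v
  obtain ⟨L, hL, hv⟩ := exists_prod_eq v
  refine Nat.sInf_le ⟨L.reverse, by rw [List.length_reverse, hL, length_eq], ?_⟩
  rw [← hv, List.prod_inv_reverse, List.map_reverse, List.map_map]
  congr 2
  exact List.map_congr_left fun i _ => (gen_inv i).symm

end TypeB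

/-! ### Factorization of the Mallows weights into signs and arrangement. -/

namespace MallowsWord

open TypeB

/-- The arrangements of the `k`-element set `s`. -/
def words : ℕ → Finset ℤ → Finset (List ℤ)
  | 0, _ => {[]}
  | k + 1, s => s.biUnion fun a => (words k (s.erase a)).image (List.cons a)

theorem mem_words {k : ℕ} {s : Finset ℤ} (hs : s.card = k) {l : List ℤ} :
    l ∈ words k s ↔ l.Nodup ∧ l.toFinset = s := by
  induction k generalizing s l with
  | zero =>
    obtain rfl := Finset.card_eq_zero.mp hs
    simp only [words, Finset.mem_singleton, List.toFinset_eq_empty_iff]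
    exact ⟨fun h => ⟨h ▸ List.nodup_nil, h⟩, fun h => h.2⟩
  | succ k ih =>
    simp only [words, Finset.mem_biUnion, Finset.mem_image]
    constructor
    · rintro ⟨a, ha, l, hl, rfl⟩
      obtain ⟨h1, h2⟩ := (ih (card_erase_of_card hs ha)).mp hl
      refine ⟨List.nodup_cons.mpr ⟨fun hal => ?_, h1⟩, ?_⟩
      · have := List.mem_toFinset.mpr hal
        simp [h2] at this
      · rw [List.toFinset_cons, h2, Finset.insert_erase ha]
    · rintro ⟨h1, rfl⟩
      cases l with
      | nil => simp at hs
      | cons a l =>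
        rw [List.nodup_cons] at h1
        have hal : a ∉ l.toFinset := by simpa using h1.1
        refine ⟨a, by simp, l, ?_, rfl⟩
        rw [ih (card_erase_of_card hs (by simp))]
        exact ⟨h1.2, by rw [List.toFinset_cons, Finset.erase_insert hal]⟩

/-- A first letter `a` forms `below s a` inversions with the rest, which is its exponent in `mean`;
the normalizations multiply to a q-factorial. -/
theorem sum_words {q : ℝ} (hq : 0 < q) {k : ℕ} {s : Finset ℤ} (hs : s.card = k)
    (F : List ℤ → ℝ) :
    ∑ l ∈ words k s, q ^ inversions l * F l =
      (∏ i ∈ Finset.range k, qNat q (i + 1)) * mean q k s F := by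
  induction k generalizing s F with
  | zero => simp [words, mean, inversions]
  | succ k ih =>
    rw [words, Finset.sum_biUnion]
    · rw [mean, Finset.mul_sum]
      refine Finset.sum_congr rfl fun a ha => ?_
      have hc := card_erase_of_card hs ha
      rw [Finset.sum_image fun _ _ _ _ h => (List.cons_eq_cons.mp h).2]
      have e : ∀ l ∈ words k (s.erase a), q ^ inversions (a :: l) * F (a :: l) =
          q ^ below s a * (q ^ inversions l * F (a :: l)) := by
        intro l hl
        obtain ⟨h1, h2⟩ := (mem_words hc).mp hl
        have : l.countP (· < a) = below s a := by
          have h3 : below s a = ((s.erase a).filter (· < a)).card := by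
            rw [below, Finset.filter_erase, Finset.erase_eq_of_notMem]
            simp
          have h4 := List.toFinset_card_of_nodup (h1.filter fun x => decide (x < a))
          rw [List.toFinset_filter] at h4
          simp only [decide_eq_true_eq] at h4
          rw [h3, ← h2, h4, List.countP_eq_length_filter]
        rw [inversions, this, pow_add, mul_assoc]
      rw [Finset.sum_congr rfl e, ← Finset.mul_sum, ih hc fun l => F (a :: l),
        Finset.prod_range_succ]
      have := qNat_pos hq k
      field_simp
    · intro a _ b _ hab
      rw [Function.onFun, Finset.disjoint_left]
      intro l h1 h2
      obtain ⟨l1, -, rfl⟩ := Finset.mem_image.mp h1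
      obtain ⟨l2, -, h⟩ := Finset.mem_image.mp h2
      exact hab (List.cons_eq_cons.mp h).1.symm

/-- The sets of representatives of `[±n]` modulo sign. -/
def signSets : ℕ → Finset (Finset ℤ)
  | 0 => {∅}
  | n + 1 => (signSets n).image (insert ((n : ℤ) + 1)) ∪
      (signSets n).image (insert (-((n : ℤ) + 1)))

theorem mem_signSets {n : ℕ} {s : Finset ℤ} :
    s ∈ signSets n ↔ s.card = n ∧ ∀ x ∈ s, x ≠ 0 ∧ |x| ≤ n ∧ -x ∉ s := by
  induction n generalizing s with
  | zero =>
    simp only [signSets, Finset.mem_singleton]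
    constructor
    · rintro rfl; simp
    · exact fun h => Finset.card_eq_zero.mp h.1
  | succ n ih =>
    have key : ∀ j : ℤ, |j| = n + 1 → ∀ t, t ∈ signSets n →
        (insert j t).card = n + 1 ∧ ∀ x ∈ insert j t, x ≠ 0 ∧ |x| ≤ ((n + 1 : ℕ) : ℤ) ∧
          -x ∉ insert j t := by
      intro j hj t ht
      obtain ⟨h1, h2⟩ := ih.mp ht
      have h3 := card_insert_of_abs_le h1 (fun x hx => (h2 x hx).2.1) hj
      refine ⟨h3.1, fun x hx => ⟨?_, h3.2 x hx, ?_⟩⟩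
      · rcases Finset.mem_insert.mp hx with rfl | hx
        · rintro rfl; simp at hj; omega
        · exact (h2 x hx).1
      · rw [Finset.mem_insert, not_or]
        rcases Finset.mem_insert.mp hx with rfl | hx
        · refine ⟨fun e => ?_, fun h => ?_⟩
          · obtain rfl : x = 0 := by omega
            simp at hj; omega
          · have := (h2 _ h).2.1
            rw [abs_neg] at this; omega
        · refine ⟨fun e => ?_, (h2 x hx).2.2⟩
          have := (h2 x hx).2.1
          rw [← e, abs_neg] at hj; omega
    simp only [signSets, Finset.mem_union, Finset.mem_image]
    constructor
    · rintro (⟨t, ht, rfl⟩ | ⟨t, ht, rfl⟩)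
      · exact key _ (abs_succ_cast n) t ht
      · exact key _ (abs_neg_succ_cast n) t ht
    · rintro ⟨h1, h2⟩
      -- Pigeonhole: otherwise the absolute values inject the n + 1 elements of `s` into {1, …, n}.
      obtain ⟨j, hj, hjs⟩ : ∃ j : ℤ, (j = n + 1 ∨ j = -((n : ℤ) + 1)) ∧ j ∈ s := by
        by_contra hcon
        push Not at hcon
        have : s.card ≤ (Finset.Icc 1 n).card := by
          refine Finset.card_le_card_of_injOn Int.natAbs (fun x hx => ?_) fun x hx y hy hxy => ?_
          · have a := h2 x hx
            have b := hcon x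
            rw [Int.abs_eq_natAbs] at a
            simp only [Finset.coe_Icc, Set.mem_Icc]
            have c : ¬ (x = n + 1 ∨ x = -((n : ℤ) + 1)) := fun h => b h hx
            omega
          · rcases Int.natAbs_eq_natAbs_iff.mp hxy with h | h
            · exact h
            · exact absurd (h ▸ hx) (h2 y hy).2.2
        rw [Nat.card_Icc] at this
        omega
      have hmem : s.erase j ∈ signSets n := by
        refine ih.mpr ⟨card_erase_of_card h1 hjs, fun x hx => ?_⟩
        obtain ⟨hxj, hxs⟩ := Finset.mem_erase.mp hx
        obtain ⟨a, b, c⟩ := h2 x hxs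
        refine ⟨a, ?_, fun h => c (Finset.mem_of_mem_erase h)⟩
        have d : x ≠ -j := fun e => (h2 j hjs).2.2 (e ▸ hxs)
        rw [Int.abs_eq_natAbs] at b ⊢
        omega
      rcases hj with rfl | rfl
      · exact Or.inl ⟨_, hmem, Finset.insert_erase hjs⟩
      · exact Or.inr ⟨_, hmem, Finset.insert_erase hjs⟩

theorem sum_signSets {q : ℝ} (hq : 0 < q) (n : ℕ) (G : Finset ℤ → ℝ) :
    ∑ s ∈ signSets n, q ^ (∑ x ∈ s, (-x).toNat) * G s =
      (∏ j ∈ Finset.range n, (1 + q ^ (j + 1))) * signMean q n G := by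
  induction n generalizing G with
  | zero => simp [signSets, signMean]
  | succ n ih =>
    have hnot : ∀ j : ℤ, |j| = n + 1 → ∀ t ∈ signSets n, j ∉ t := fun j hj t ht h => by
      have := ((mem_signSets.mp ht).2 j h).2.1; omega
    have hinj : ∀ j : ℤ, |j| = n + 1 → Set.InjOn (insert j) (signSets n : Set (Finset ℤ)) := by
      intro j hj t ht t' ht' h
      rw [← Finset.erase_insert (hnot j hj t ht), ← Finset.erase_insert (hnot j hj t' ht')]
      exact congrArg (Finset.erase · j) h
    have hdisj : Disjoint ((signSets n).image (insert ((n : ℤ) + 1)))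
        ((signSets n).image (insert (-((n : ℤ) + 1)))) := by
      rw [Finset.disjoint_left]
      intro s h1 h2
      obtain ⟨t, ht, rfl⟩ := Finset.mem_image.mp h1
      obtain ⟨t', ht', h⟩ := Finset.mem_image.mp h2
      have : -((n : ℤ) + 1) ∈ insert ((n : ℤ) + 1) t := h ▸ Finset.mem_insert_self _ _
      rcases Finset.mem_insert.mp this with e | e
      · omega
      · exact hnot _ (abs_neg_succ_cast n) t ht e
    have e1 : ∀ t ∈ signSets n, q ^ (∑ x ∈ insert ((n : ℤ) + 1) t, (-x).toNat) *
        G (insert ((n : ℤ) + 1) t) =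
        q ^ (∑ x ∈ t, (-x).toNat) * G (insert ((n : ℤ) + 1) t) := by
      intro t ht
      rw [Finset.sum_insert (hnot _ (abs_succ_cast n) t ht)]
      rw [show (-((n : ℤ) + 1)).toNat = 0 by omega, zero_add]
    have e2 : ∀ t ∈ signSets n, q ^ (∑ x ∈ insert (-((n : ℤ) + 1)) t, (-x).toNat) *
        G (insert (-((n : ℤ) + 1)) t) =
        q ^ (n + 1) * (q ^ (∑ x ∈ t, (-x).toNat) * G (insert (-((n : ℤ) + 1)) t)) := by
      intro t ht
      rw [Finset.sum_insert (hnot _ (abs_neg_succ_cast n) t ht)]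
      rw [show (-(-((n : ℤ) + 1))).toNat = n + 1 by omega, pow_add, mul_assoc]
    rw [signSets, Finset.sum_union hdisj, Finset.sum_image (hinj _ (abs_succ_cast n)),
      Finset.sum_image (hinj _ (abs_neg_succ_cast n)), Finset.sum_congr rfl e1,
      Finset.sum_congr rfl e2, ← Finset.mul_sum, ih fun s => G (insert ((n : ℤ) + 1) s),
      ih fun s => G (insert (-((n : ℤ) + 1)) s), signMean, Finset.prod_range_succ]
    have : 0 < 1 + q ^ (n + 1) := by positivity
    field_simp

end MallowsWord

namespace TypeB

open MallowsWord

variable {n : ℕ}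

theorem length_word (w : B n) : (word w).length = n := by simp [word]

theorem getElem_word (w : B n) {i : ℕ} (hi : i < (word w).length) :
    (word w)[i] = toPerm w ((i : ℤ) + 1) := by simp [word]

theorem mem_word {w : B n} {x : ℤ} : x ∈ word w ↔ ∃ k : ℕ, k < n ∧ toPerm w ((k : ℤ) + 1) = x := by
  simp [word]

theorem nodup_word (w : B n) : (word w).Nodup := by
  refine List.Nodup.map (fun a b h => ?_) List.nodup_range
  have := (toPerm w).injective h
  omega

theorem word_toFinset_mem (w : B n) : (word w).toFinset ∈ signSets n := by
  refine mem_signSets.mpr ⟨by rw [List.toFinset_card_of_nodup (nodup_word w), length_word],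
    fun x hx => ?_⟩
  obtain ⟨k, hk, rfl⟩ := mem_word.mp (List.mem_toFinset.mp hx)
  have h := toPerm_mem w (k := (k : ℤ) + 1) ⟨by omega, by rw [abs_of_nonneg] <;> omega⟩
  refine ⟨h.1, h.2, fun h' => ?_⟩
  obtain ⟨k', -, e⟩ := mem_word.mp (List.mem_toFinset.mp h')
  rw [← toPerm_neg] at e
  have := (toPerm w).injective e
  omega

theorem word_injective : Function.Injective (word (n := n)) := by
  intro v w h
  have h1 : ∀ k : ℕ, toPerm v k = toPerm w k := by
    intro k
    by_cases hk : k ≠ 0 ∧ k ≤ n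
    · obtain ⟨j, rfl⟩ : ∃ j, k = j + 1 := ⟨k - 1, by omega⟩
      have e1 := getElem_word v (i := j) (by rw [length_word]; omega)
      have e2 := getElem_word w (i := j) (by rw [length_word]; omega)
      simp only [h] at e1
      push_cast
      rw [← e1, ← e2]
    · rw [toPerm_of_notMem v, toPerm_of_notMem w] <;>
      · rw [Nat.abs_cast]; omega
  refine toPerm_injective (Equiv.ext fun k => ?_)
  rcases Int.natAbs_eq k with e | e
  · rw [e, h1]
  · rw [e, toPerm_neg, toPerm_neg, h1]

theorem exists_word_eq {s : Finset ℤ} (hs : s ∈ signSets n) {l : List ℤ} (hl : l.Nodup)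
    (hls : l.toFinset = s) : ∃ w : B n, word w = l := by
  obtain ⟨hc, hs⟩ := mem_signSets.mp hs
  have hlen : l.length = n := by rw [← hc, ← hls, List.toFinset_card_of_nodup hl]
  have hmem : ∀ i (hi : i < l.length), l[i] ≠ 0 ∧ |l[i]| ≤ n ∧ -l[i] ∉ s := fun i hi =>
    hs _ (hls ▸ List.mem_toFinset.mpr (List.getElem_mem hi))
  have hmem' : ∀ i (hi : i < l.length), l[i] ∈ s := fun i hi =>
    hls ▸ List.mem_toFinset.mpr (List.getElem_mem hi)
  have hidx : ∀ k : SignedIndex n, (k : ℤ).natAbs - 1 < l.length := by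
    intro k
    have := mem_index.mp k.2
    rw [Int.abs_eq_natAbs] at this
    omega
  let f : SignedIndex n → SignedIndex n := fun k =>
    if 0 < (k : ℤ) then ⟨l[(k : ℤ).natAbs - 1]'(hidx k), mem_index.mpr
      ⟨(hmem _ _).1, (hmem _ _).2.1⟩⟩
    else ⟨-l[(k : ℤ).natAbs - 1]'(hidx k), mem_index.mpr
      ⟨neg_ne_zero.mpr (hmem _ _).1, by rw [abs_neg]; exact (hmem _ _).2.1⟩⟩
  have hf : ∀ k, ((f k : SignedIndex n) : ℤ) = if 0 < (k : ℤ) then l[(k : ℤ).natAbs - 1]'(hidx k)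
      else -l[(k : ℤ).natAbs - 1]'(hidx k) := by
    intro k; simp only [f]; split_ifs <;> rfl
  have hinj : Function.Injective f := by
    intro a b hab
    have e : ((f a : SignedIndex n) : ℤ) = f b := by rw [hab]
    rw [hf, hf] at e
    have ha := mem_index.mp a.2
    have hb := mem_index.mp b.2
    apply Subtype.ext
    have same : l[(a : ℤ).natAbs - 1]'(hidx a) = l[(b : ℤ).natAbs - 1]'(hidx b) →
        (a : ℤ).natAbs - 1 = (b : ℤ).natAbs - 1 := fun h => (hl.getElem_inj_iff).mp h
    have opp1 : l[(a : ℤ).natAbs - 1]'(hidx a) ≠ -l[(b : ℤ).natAbs - 1]'(hidx b) := fun h =>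
      (hmem _ (hidx b)).2.2 (h ▸ hmem' _ (hidx a))
    have opp2 : -l[(a : ℤ).natAbs - 1]'(hidx a) ≠ l[(b : ℤ).natAbs - 1]'(hidx b) := fun h =>
      (hmem _ (hidx a)).2.2 (h ▸ hmem' _ (hidx b))
    split_ifs at e
    · have := same e; omega
    · exact absurd e opp1
    · exact absurd e opp2
    · have := same (neg_injective e); omega
  have hneg : ∀ k, f (-k) = -f k := by
    intro k
    apply Subtype.ext
    rw [coe_neg, hf, hf]
    have := coe_ne_zero k
    simp only [coe_neg, Int.natAbs_neg]
    split_ifs <;> omega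
  let w : B n := ⟨Equiv.ofBijective f (Finite.injective_iff_bijective.mp hinj), hneg⟩
  refine ⟨w, List.ext_getElem (by rw [length_word, hlen]) fun i hi hi' => ?_⟩
  rw [getElem_word]
  rw [length_word] at hi
  have h := toPerm_coe w (pos ⟨i, hi⟩)
  rw [coe_pos] at h
  rw [h]
  change ((f (pos ⟨i, hi⟩) : SignedIndex n) : ℤ) = _
  rw [hf, if_pos (by rw [coe_pos]; positivity)]
  congr 1

/-- Summation over signed permutations by signs and relative order. -/
theorem sum_pow_length {q : ℝ} (hq : 0 < q) (F : List ℤ → ℝ) :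
    ∑ w : B n, q ^ length w * F (word w) =
      ((∏ j ∈ Finset.range n, (1 + q ^ (j + 1))) * ∏ i ∈ Finset.range n, qNat q (i + 1)) *
        signMean q n fun s => mean q n s F := by
  have h1 : ∀ s ∈ signSets n, ∑ l ∈ words n s, q ^ (inversions l + negSum l) * F l =
      q ^ (∑ x ∈ s, (-x).toNat) *
        ((∏ i ∈ Finset.range n, qNat q (i + 1)) * mean q n s F) := by
    intro s hs
    have hc := (mem_signSets.mp hs).1
    rw [← sum_words hq hc, Finset.mul_sum]
    refine Finset.sum_congr rfl fun l hl => ?_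
    obtain ⟨h1, rfl⟩ := (mem_words hc).mp hl
    rw [List.sum_toFinset _ h1, ← negSum, pow_add]
    ring
  have h2 : ∑ w : B n, q ^ length w * F (word w) =
      ∑ s ∈ signSets n, ∑ l ∈ words n s, q ^ (inversions l + negSum l) * F l := by
    rw [Finset.sum_sigma']
    refine Finset.sum_bij (fun w _ => ⟨(word w).toFinset, word w⟩) ?_ ?_ ?_ ?_
    · intro w _
      have := word_toFinset_mem w
      exact Finset.mem_sigma.mpr ⟨this, (mem_words (mem_signSets.mp this).1).mpr
        ⟨nodup_word w, rfl⟩⟩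
    · intro v _ w _ h
      exact word_injective (eq_of_heq (Sigma.mk.inj_iff.mp h).2)
    · rintro ⟨s, l⟩ h
      obtain ⟨hs, hl⟩ := Finset.mem_sigma.mp h
      obtain ⟨h1, h2⟩ := (mem_words (mem_signSets.mp hs).1).mp hl
      simp only at h2
      obtain ⟨w, hw⟩ := exists_word_eq hs h1 h2
      exact ⟨w, Finset.mem_univ _, by simp only [hw, h2]⟩
    · intro w _
      rw [length_eq, wordLength]
  rw [h2, Finset.sum_congr rfl h1, sum_signSets hq, mul_assoc]
  congr 1
  clear h1 h2
  generalize (∏ i ∈ Finset.range n, qNat q (i + 1)) = c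
  have : ∀ (m : ℕ) (G : Finset ℤ → ℝ), signMean q m (fun s => c * G s) = c * signMean q m G := by
    intro m
    induction m with
    | zero => intro G; rfl
    | succ m ih => intro G; simp only [signMean, ih]; ring
  exact this n _

end TypeB

/-! ### The characterizing identity and the increments of the statistic. -/

namespace TypeB

open MallowsWord

variable {n : ℕ}

/-- The expectation of `F` under the Mallows measure. -/
noncomputable def avg (q : ℝ) (F : B n → ℝ) : ℝ := (∑ w : B n, q ^ length w * F w) / mallowsZ n q

theorem mallowsZ_pos {q : ℝ} (hq : 0 < q) : 0 < mallowsZ n q :=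
  Finset.sum_pos (fun _ _ => by positivity) ⟨1, Finset.mem_univ _⟩

theorem avg_add (q : ℝ) (F G : B n → ℝ) : avg q (fun w => F w + G w) = avg q F + avg q G := by
  simp only [avg, mul_add, Finset.sum_add_distrib, add_div]

theorem avg_mul (q c : ℝ) (F : B n → ℝ) : avg q (fun w => c * F w) = c * avg q F := by
  rw [avg, avg, ← mul_div_assoc, Finset.mul_sum]
  congr 1
  exact Finset.sum_congr rfl fun w _ => by ring

theorem avg_sub (q : ℝ) (F G : B n → ℝ) : avg q (fun w => F w - G w) = avg q F - avg q G := by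
  simp only [avg, mul_sub, Finset.sum_sub_distrib, sub_div]

theorem avg_sum {ι : Type*} (q : ℝ) (s : Finset ι) (F : ι → B n → ℝ) :
    avg q (fun w => ∑ i ∈ s, F i w) = ∑ i ∈ s, avg q (F i) := by
  simp only [avg, Finset.mul_sum, ← Finset.sum_div]
  rw [Finset.sum_comm]

theorem avg_const {q : ℝ} (hq : 0 < q) (c : ℝ) : avg q (fun _ : B n => c) = c := by
  rw [avg, ← Finset.sum_mul, ← mallowsZ, mul_comm, mul_div_cancel_right₀ _ (mallowsZ_pos hq).ne']

theorem avg_mono {q : ℝ} (hq : 0 < q) {F G : B n → ℝ} (h : ∀ w, F w ≤ G w) :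
    avg q F ≤ avg q G :=
  div_le_div_of_nonneg_right (Finset.sum_le_sum fun w _ =>
    mul_le_mul_of_nonneg_left (h w) (by positivity)) (mallowsZ_pos hq).le

theorem avg_inv (q : ℝ) (F : B n → ℝ) : avg q (fun w => F w⁻¹) = avg q F := by
  rw [avg, avg]
  congr 1
  rw [← Equiv.sum_comp (Equiv.inv (B n))]
  exact Finset.sum_congr rfl fun w _ => by simp [length_inv]

/-- The indicator of an ascent at `s_i`. -/
noncomputable def asc (i : Fin n) (w : B n) : ℝ := if toPerm w i < toPerm w (i + 1) then 1 else 0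

theorem asc_mul_gen (i : Fin n) (w : B n) : asc i (w * gen i) = 1 - asc i w := by
  unfold asc
  simp only [toPerm_mul_gen_lt_iff]
  rcases lt_or_gt_of_ne (toPerm_succ_ne w i) with h | h <;> simp [h, h.not_gt]

/-- Multiplication by a generator that lengthens multiplies the mass by `q`. -/
theorem avg_asc_mul (q : ℝ) (i : Fin n) (F : B n → ℝ) :
    avg q (fun w => (1 - asc i w) * F (w * gen i)) = q * avg q fun w => asc i w * F w := by
  rw [avg, avg, ← mul_div_assoc, Finset.mul_sum]
  congr 1
  rw [← Equiv.sum_comp (Equiv.mulRight (gen i))]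
  refine Finset.sum_congr rfl fun w _ => ?_
  rw [Equiv.coe_mulRight, asc_mul_gen, mul_assoc w, gen_mul_gen, mul_one, sub_sub_cancel]
  unfold asc
  split_ifs with h
  · rw [length_mul_gen h, pow_succ]; ring
  · simp

/-- `avg_asc_mul` for `F (· * gen i)` expresses the descent part through ascents; adding the
decomposition of `avg q F` into both parts isolates it. -/
theorem avg_desc_mul {q : ℝ} (i : Fin n) (F : B n → ℝ) :
    (1 + q) * avg q (fun w => (1 - asc i w) * F w) =
      q * (avg q F + avg q fun w => asc i w * (F (w * gen i) - F w)) := by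
  have h1 := avg_asc_mul q i fun w => F (w * gen i)
  simp only [mul_assoc _ (gen i), gen_mul_gen, mul_one] at h1
  have h2 : avg q (fun w => (1 - asc i w) * F w) = avg q F - avg q fun w => asc i w * F w := by
    rw [← avg_sub]; congr 1; funext w; ring
  have h3 : avg q (fun w => asc i w * (F (w * gen i) - F w)) =
      avg q (fun w => asc i w * F (w * gen i)) - avg q fun w => asc i w * F w := by
    rw [← avg_sub]; congr 1; funext w; ring
  rw [h3]
  linear_combination h1 + q * h2

theorem avg_asc {q : ℝ} (hq : 0 < q) (i : Fin n) : avg q (asc i) = 1 / (1 + q) := by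
  have h := avg_desc_mul (q := q) i fun _ => 1
  simp only [sub_self, mul_zero, mul_one, avg_sub, avg_const hq] at h
  rw [eq_div_iff (by positivity)]
  linear_combination -h

theorem des_eq (w : B n) : (des w : ℝ) = ∑ i : Fin n, (1 - asc i w) := by
  rw [des, Finset.card_filter]
  push_cast
  refine Finset.sum_congr rfl fun i _ => ?_
  rw [asc, hasDescent_iff]
  rcases lt_or_gt_of_ne (toPerm_succ_ne w i) with h | h <;> simp [h, h.not_gt]

theorem twoSidedDes_inv (w : B n) : twoSidedDes w⁻¹ = twoSidedDes w := by
  rw [twoSidedDes, twoSidedDes, inv_inv, add_comm]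

/-- The characterizing identity of the two-sided descent statistic, from the coupling that turns
an ascent into a descent. -/
theorem avg_twoSidedDes_mul (q : ℝ) (φ : ℝ → ℝ) :
    (1 + q) * avg q (fun w : B n => twoSidedDes w * φ (twoSidedDes w)) =
      2 * q * (n * avg q (fun w : B n => φ (twoSidedDes w)) +
        avg q fun w : B n => ∑ i, asc i w *
          (φ (twoSidedDes (w * gen i)) - φ (twoSidedDes w))) := by
  -- Both the measure and `twoSidedDes` are invariant under inversion; this produces the factor 2.
  have h1 : avg q (fun w : B n => (des w⁻¹ : ℝ) * φ (twoSidedDes w)) =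
      avg q fun w : B n => (des w : ℝ) * φ (twoSidedDes w) := by
    rw [← avg_inv]
    simp only [inv_inv, twoSidedDes_inv]
  have h2 : avg q (fun w : B n => twoSidedDes w * φ (twoSidedDes w)) =
      2 * avg q fun w : B n => (des w : ℝ) * φ (twoSidedDes w) := by
    have : (fun w : B n => twoSidedDes w * φ (twoSidedDes w)) = fun w =>
        (des w : ℝ) * φ (twoSidedDes w) + (des w⁻¹ : ℝ) * φ (twoSidedDes w) := by
      funext w; rw [← add_mul]; rfl
    rw [this, avg_add, h1]; ring
  have h3 : (1 + q) * avg q (fun w : B n => (des w : ℝ) * φ (twoSidedDes w)) =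
      q * (n * avg q (fun w : B n => φ (twoSidedDes w)) +
        avg q fun w : B n => ∑ i, asc i w *
          (φ (twoSidedDes (w * gen i)) - φ (twoSidedDes w))) := by
    simp only [des_eq, Finset.sum_mul]
    rw [avg_sum, avg_sum, Finset.mul_sum]
    simp only [avg_desc_mul]
    rw [← Finset.mul_sum, Finset.sum_add_distrib]
    simp
  rw [h2]
  linear_combination 2 * h3

/-- The generator only moves values past their neighbours. `h1` excludes the pair ±1, which s_0
would also reverse, and `h2`, `h3` exclude the loss of a descent, so that only creation remains. -/
theorem desInd_gen_mul {i : ℕ} {a b : ℤ} (h1 : b ≠ -a)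
    (h2 : ¬ (a = i + 1 ∧ b = i)) (h3 : ¬ (a = -i ∧ b = -(i + 1))) :
    (if genFun i b < genFun i a then (1 : ℝ) else 0) - (if b < a then 1 else 0) =
      if (a = i ∧ b = i + 1) ∨ (b = -i ∧ a = -(i + 1)) then 1 else 0 := by
  have h4 : genFun i b < genFun i a ↔ b < a ∨ (a = i ∧ b = i + 1) ∨ (b = -i ∧ a = -(i + 1)) := by
    unfold genFun
    by_cases hi : i = 0
    · subst hi
      simp only [if_true, Nat.cast_zero] at *
      split_ifs <;> omega
    · simp only [hi, if_false]
      split_ifs <;> omega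
  by_cases h5 : (a = i ∧ b = i + 1) ∨ (b = -i ∧ a = -(i + 1))
  · have h6 : ¬ b < a := by omega
    rw [if_pos (h4.mpr (Or.inr h5)), if_neg h6, if_pos h5, sub_zero]
  · simp only [h4, h5, or_false, if_false, sub_self]

theorem des_eq_sum_range (w : B n) :
    (des w : ℝ) = ∑ j ∈ Finset.range n, if toPerm w ((j : ℤ) + 1) < toPerm w j then (1 : ℝ) else 0 := by
  rw [des_eq, Finset.sum_range]
  refine Finset.sum_congr rfl fun i _ => ?_
  rw [asc]
  rcases lt_or_gt_of_ne (toPerm_succ_ne w i) with h | h <;> simp [h, h.not_gt]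

/-- On the inverse the generator acts from the left. It creates a descent exactly when its two
values are adjacent in w⁻¹ (up to sign), that is when w(i) and w(i+1) are consecutive integers. -/
theorem des_gen_mul_inv_sub {i : Fin n} {w : B n} (h : toPerm w i < toPerm w (i + 1)) :
    (des (w * gen i)⁻¹ : ℝ) - des w⁻¹ = succInd (toPerm w i) (toPerm w (i + 1)) := by
  have hi := i.2
  rw [mul_inv_rev, gen_inv, des_eq_sum_range, des_eq_sum_range, ← Finset.sum_sub_distrib]
  have e : ∀ j ∈ Finset.range n,
      ((if toPerm (gen i * w⁻¹) ((j : ℤ) + 1) < toPerm (gen i * w⁻¹) j then (1 : ℝ) else 0) -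
        if toPerm w⁻¹ ((j : ℤ) + 1) < toPerm w⁻¹ j then (1 : ℝ) else 0) =
      if (toPerm w i = j ∧ toPerm w (i + 1) = j + 1) ∨
        (toPerm w i = -(j + 1) ∧ toPerm w (i + 1) = -j) then 1 else 0 := by
    intro j _
    have key : ∀ k l : ℤ, toPerm w⁻¹ k = l ↔ toPerm w l = k := toPerm_inv_apply w
    rw [toPerm_gen_mul, toPerm_gen_mul, desInd_gen_mul]
    · simp only [key, toPerm_neg]
      refine if_congr ?_ rfl rfl
      omega
    · rw [Ne, key, toPerm_neg, (key _ _).mp rfl]; omega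
    · simp only [key]; omega
    · simp only [key, toPerm_neg]; omega
  rw [Finset.sum_congr rfl e, succInd]
  have m1 := toPerm_mem w (k := (i : ℤ) + 1) ⟨by omega, by rw [abs_of_nonneg] <;> omega⟩
  rw [abs_le] at m1
  have m0 : -(n : ℤ) ≤ toPerm w i := by
    by_cases hi0 : (i : ℤ) = 0
    · rw [hi0, toPerm_zero]; omega
    · exact (abs_le.mp (toPerm_mem w (k := (i : ℤ)) ⟨hi0, by rw [Nat.abs_cast]; omega⟩).2).1
  split_ifs with hs
  -- The single affected position is w(i), or -w(i+1) if w(i) < 0; in the latter case w(i+1) is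
  -- negative too, since it is not zero.
  · rw [Finset.sum_eq_single (if 0 ≤ toPerm w i then (toPerm w i).toNat
      else (-toPerm w (i + 1)).toNat)]
    · rw [if_pos]
      split_ifs <;> omega
    · intro j _ hj
      rw [if_neg]
      split_ifs at hj <;> omega
    · intro hj
      exfalso
      apply hj
      rw [Finset.mem_range]
      split_ifs <;> omega
  · refine Finset.sum_eq_zero fun j _ => ?_
    rw [if_neg]
    omega

/-- `toPerm` fixes n + 1, so there is no descent at n. The extra term gives the last generator a
right neighbour like the others. -/
theorem des_eq_sum_range_succ (w : B n) :
    (des w : ℝ) =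
      ∑ j ∈ Finset.range (n + 1), if toPerm w ((j : ℤ) + 1) < toPerm w j then (1 : ℝ) else 0 := by
  rw [Finset.sum_range_succ, ← des_eq_sum_range, if_neg, add_zero]
  rw [toPerm_of_notMem w (k := (n : ℤ) + 1) (by rw [abs_of_nonneg] <;> omega)]
  by_cases hn : (n : ℤ) = 0
  · rw [hn, toPerm_zero]; norm_num
  · have := (abs_le.mp (toPerm_mem w (k := (n : ℤ)) ⟨hn, by simp⟩).2).2
    omega

/-- In the word only the descents at i - 1, i, i + 1 can change: one appears at i, and one is lost
for each neighbour whose value lies strictly between the swapped ones. -/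
theorem twoSidedDes_mul_gen_of_pos {i : Fin n} (hi0 : (i : ℕ) ≠ 0) {w : B n}
    (h : toPerm w i < toPerm w (i + 1)) :
    twoSidedDes (w * gen i) - twoSidedDes w =
      swapGain (toPerm w (i - 1)) (toPerm w i) (toPerm w (i + 1)) (toPerm w (i + 2)) +
        succInd (toPerm w i) (toPerm w (i + 1)) := by
  rw [← des_gen_mul_inv_sub h, twoSidedDes, twoSidedDes, add_sub_add_comm]
  congr 1
  obtain ⟨i, hi⟩ := i
  obtain ⟨k, rfl⟩ : ∃ k, i = k + 1 := ⟨i - 1, by simp only at hi0; omega⟩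
  rw [des_eq_sum_range_succ, des_eq_sum_range_succ, ← Finset.sum_sub_distrib]
  have hsub : ({k, k + 1, k + 2} : Finset ℕ) ⊆ Finset.range (n + 1) := by
    intro x hx
    simp only [Finset.mem_insert, Finset.mem_singleton] at hx
    rw [Finset.mem_range]; omega
  rw [← Finset.sum_subset hsub]
  · have e1 : genFun (k + 1) (k : ℤ) = k := by
      unfold genFun; push_cast; split_ifs <;> omega
    have e2 : genFun (k + 1) ((k : ℤ) + 1) = k + 1 + 1 := by
      unfold genFun; push_cast; split_ifs <;> omega
    have e3 : genFun (k + 1) ((k : ℤ) + 1 + 1) = k + 1 := by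
      unfold genFun; push_cast; split_ifs <;> omega
    have e4 : genFun (k + 1) ((k : ℤ) + 2 + 1) = k + 2 + 1 := by
      unfold genFun; push_cast; split_ifs <;> omega
    have e5 : (k : ℤ) + 1 + 1 = k + 2 := by ring
    have e6 : (k : ℤ) + 1 + 2 = k + 2 + 1 := by ring
    rw [Finset.sum_insert (by simp), Finset.sum_insert (by simp), Finset.sum_singleton]
    push_cast
    simp only [toPerm_mul_gen, e1, e2, e5, e4, e6] at h ⊢
    rw [← e5, e3, e5]
    push_cast at h
    rw [e5] at h
    rw [add_sub_cancel_right, swapGain, if_pos h, if_neg h.not_gt, if_pos h]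
    have a1 := toPerm_succ_ne w k
    have a2 := toPerm_succ_ne w (k + 2)
    have a3 : toPerm w k ≠ toPerm w (k + 2) := fun e => by
      have := (toPerm w).injective e; omega
    have a4 : toPerm w (k + 1) ≠ toPerm w (k + 2 + 1) := fun e => by
      have := (toPerm w).injective e; omega
    split_ifs <;> first | omega | norm_num
  · intro j _ hj
    simp only [Finset.mem_insert, Finset.mem_singleton, not_or] at hj
    have e1 : genFun (k + 1) (j : ℤ) = j := by
      unfold genFun; push_cast; split_ifs <;> omega
    have e2 : genFun (k + 1) ((j : ℤ) + 1) = j + 1 := by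
      unfold genFun; push_cast; split_ifs <;> omega
    rw [toPerm_mul_gen, toPerm_mul_gen, e1, e2, sub_self]

/-- Only the descents at 0 and 1 are affected: the first appears, and the second is lost when w(2)
lies between -w(1) and w(1). -/
theorem twoSidedDes_mul_gen_of_zero {i : Fin n} (hi0 : (i : ℕ) = 0) {w : B n}
    (h : toPerm w i < toPerm w (i + 1)) :
    twoSidedDes (w * gen i) - twoSidedDes w =
      1 - (if -toPerm w 1 < toPerm w 2 ∧ toPerm w 2 < toPerm w 1 then 1 else 0) +
        succInd (toPerm w i) (toPerm w (i + 1)) := by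
  rw [← des_gen_mul_inv_sub h, twoSidedDes, twoSidedDes, add_sub_add_comm]
  congr 1
  obtain ⟨i, hi⟩ := i
  simp only at hi0
  subst hi0
  rw [des_eq_sum_range_succ, des_eq_sum_range_succ, ← Finset.sum_sub_distrib]
  have hsub : ({0, 1} : Finset ℕ) ⊆ Finset.range (n + 1) := by
    intro x hx
    simp only [Finset.mem_insert, Finset.mem_singleton] at hx
    rw [Finset.mem_range]; omega
  rw [← Finset.sum_subset hsub]
  · have e2 : genFun 0 1 = -1 := rfl
    have e3 : genFun 0 2 = 2 := rfl
    have e5 : (1 : ℤ) + 1 = 2 := rfl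
    rw [Finset.sum_insert (by simp), Finset.sum_singleton]
    simp only [toPerm_mul_gen, Nat.cast_zero, Nat.cast_one, zero_add, e2, e3, e5, toPerm_zero,
      toPerm_neg] at h ⊢
    have a1 : toPerm w 1 ≠ toPerm w 2 := toPerm_succ_ne w 1
    have a2 : toPerm w (-1) ≠ toPerm w 2 := fun e => by
      have := (toPerm w).injective e; omega
    rw [toPerm_neg] at a2
    rw [if_pos (by omega), if_neg (by omega)]
    split_ifs <;> first | omega | norm_num
  · intro j _ hj
    simp only [Finset.mem_insert, Finset.mem_singleton, not_or] at hj
    have e1 : genFun 0 (j : ℤ) = j := by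
      rw [genFun, if_pos rfl, if_neg (by omega), if_neg (by omega)]
    have e2 : genFun 0 ((j : ℤ) + 1) = j + 1 := by
      rw [genFun, if_pos rfl, if_neg (by omega), if_neg (by omega)]
    rw [toPerm_mul_gen, toPerm_mul_gen]
    simp only [e1, e2, sub_self]

end TypeB

/-! ### Stein's equation: solution and derivative bounds. -/

namespace Stein

open Filter Topology Real

theorem hasDerivAt_exp_neg_sq (x : ℝ) :
    HasDerivAt (fun x : ℝ => exp (-(x ^ 2 / 2))) (-x * exp (-(x ^ 2 / 2))) x := by
  have h : HasDerivAt (fun x : ℝ => -(x ^ 2 / 2)) (-x) x :=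
    (((hasDerivAt_id x).pow 2).div_const 2).neg.congr_deriv (by simp)
  exact h.exp.congr_deriv (by ring)

theorem tendsto_exp_neg_sq {l : Filter ℝ} (hl : Tendsto (fun x : ℝ => x ^ 2) l atTop) :
    Tendsto (fun x : ℝ => exp (-(x ^ 2 / 2))) l (𝓝 0) :=
  tendsto_exp_neg_atTop_nhds_zero.comp (hl.atTop_div_const two_pos)

theorem tendsto_sq_atTop : Tendsto (fun x : ℝ => x ^ 2) atTop atTop :=
  tendsto_pow_atTop two_ne_zero

theorem tendsto_sq_atBot : Tendsto (fun x : ℝ => x ^ 2) atBot atTop := by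
  have := tendsto_sq_atTop.comp tendsto_neg_atBot_atTop
  simpa [Function.comp_def] using this

/-- A Mills ratio bound for functions with a Gaussian-dominated derivative. -/
theorem le_mills {v k : ℝ → ℝ} {K : ℝ} (hv : ∀ x, HasDerivAt v (exp (-(x ^ 2 / 2)) * k x) x)
    (hk : ∀ x, |k x| ≤ K) (h0 : Tendsto v atTop (𝓝 0)) {x : ℝ} (hx : 0 < x) :
    v x ≤ K / x * exp (-(x ^ 2 / 2)) := by
  set D : ℝ → ℝ := fun y => K / y * exp (-(y ^ 2 / 2)) - v y with hD
  have hderiv : ∀ y ∈ Set.Ioi (0 : ℝ), HasDerivAt D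
      (-(exp (-(y ^ 2 / 2)) * (K + K / y ^ 2 + k y))) y := by
    intro y hy
    have hy0 : y ≠ 0 := (Set.mem_Ioi.mp hy).ne'
    have h1 : HasDerivAt (fun y : ℝ => K / y) (-(K / y ^ 2)) y := 
      ((hasDerivAt_inv hy0).const_mul K).congr_deriv (by ring)
    refine ((h1.mul (hasDerivAt_exp_neg_sq y)).sub (hv y)).congr_deriv ?_
    field_simp
    ring
  have hanti : AntitoneOn D (Set.Ioi 0) := by
    refine antitoneOn_of_deriv_nonpos (convex_Ioi 0)
      (fun y hy => (hderiv y hy).continuousAt.continuousWithinAt) ?_ ?_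
    · rw [interior_Ioi]
      exact fun y hy => (hderiv y hy).differentiableAt.differentiableWithinAt
    · rw [interior_Ioi]
      intro y hy
      rw [(hderiv y hy).deriv, neg_nonpos]
      have hK : 0 ≤ K := (abs_nonneg _).trans (hk 0)
      have := (abs_le.mp (hk y)).1
      have : 0 ≤ K / y ^ 2 := by positivity
      exact mul_nonneg (exp_pos _).le (by linarith)
  have hlim : Tendsto D atTop (𝓝 0) := by
    have h1 : Tendsto (fun y : ℝ => K / y) atTop (𝓝 0) := tendsto_const_nhds.div_atTop tendsto_id
    simpa using (h1.mul (tendsto_exp_neg_sq tendsto_sq_atTop)).sub h0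
  have hle : 0 ≤ D x := by
    refine le_of_tendsto hlim ?_
    filter_upwards [eventually_ge_atTop x] with y hy
    exact hanti hx (hx.trans_le hy) hy
  simpa [hD] using hle

/-- The function exp(-x²/2) u has derivative exp(-x²/2) k, so `le_mills` applies to it and its
negative, and to their reflections for negative x. -/
theorem abs_mul_le_of_hasDerivAt {u k : ℝ → ℝ} {K : ℝ}
    (hu : ∀ x, HasDerivAt u (x * u x + k x) x) (hk : ∀ x, |k x| ≤ K)
    (htop : Tendsto (fun x => exp (-(x ^ 2 / 2)) * u x) atTop (𝓝 0))
    (hbot : Tendsto (fun x => exp (-(x ^ 2 / 2)) * u x) atBot (𝓝 0)) (x : ℝ) :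
    |x * u x| ≤ K := by
  have hv : ∀ x, HasDerivAt (fun x => exp (-(x ^ 2 / 2)) * u x) (exp (-(x ^ 2 / 2)) * k x) x := 
    fun x => ((hasDerivAt_exp_neg_sq x).mul (hu x)).congr_deriv (by ring)
  have key : ∀ {y z : ℝ}, 0 < y → exp (-(y ^ 2 / 2)) * z ≤ K / y * exp (-(y ^ 2 / 2)) →
      y * z ≤ K := by
    intro y z hy h
    rw [mul_comm (K / y)] at h
    have := le_of_mul_le_mul_left h (exp_pos _)
    rw [le_div_iff₀ hy] at this
    linarith
  rcases lt_trichotomy x 0 with hx | rfl | hx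
  · have hx' : 0 < -x := by linarith
    have h1 : ∀ x, HasDerivAt (fun x => exp (-((-x) ^ 2 / 2)) * u (-x))
        (exp (-(x ^ 2 / 2)) * -k (-x)) x := by
      intro x
      exact ((hv (-x)).comp x (hasDerivAt_neg x)).congr_deriv (by simp)
    have h2 := le_mills h1 (fun x => by rw [abs_neg]; exact hk _)
      (hbot.comp tendsto_neg_atTop_atBot) hx'
    have h3 := le_mills (fun x => (h1 x).neg.congr_deriv (mul_neg _ _).symm)
      (fun x => by rw [abs_neg, abs_neg]; exact hk _)
      (by rw [← neg_zero]; exact (hbot.comp tendsto_neg_atTop_atBot).neg) hx'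
    simp only [neg_neg, Pi.neg_apply] at h2 h3
    rw [← neg_sq x, ← mul_neg] at h3
    rw [← neg_sq x] at h2
    have a := key hx' h2
    have b := key hx' h3
    rw [abs_le]
    constructor <;> linarith
  · rw [zero_mul, abs_zero]; exact (abs_nonneg _).trans (hk 0)
  · have h2 := le_mills hv hk htop hx
    have h3 := le_mills (fun x => (hv x).neg.congr_deriv (mul_neg _ _).symm)
      (fun x => by rw [abs_neg]; exact hk _) (by rw [← neg_zero]; exact htop.neg) hx
    simp only [Pi.neg_apply] at h3
    rw [← mul_neg] at h3
    have a := key hx h2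
    have b := key hx h3
    rw [abs_le]
    constructor <;> linarith

/-- A maximum principle for `f'' - x f' - f = k`. -/
theorem le_of_hasDerivAt {f f' k : ℝ → ℝ} {L : ℝ} (hf : ∀ x, HasDerivAt f (f' x) x)
    (hf' : ∀ x, HasDerivAt f' (x * f' x + f x + k x) x) (hk : ∀ x, |k x| ≤ L)
    (h0 : Tendsto f (cocompact ℝ) (𝓝 0)) (x : ℝ) : f x ≤ L := by
  by_contra! hx
  have hL : 0 ≤ L := (abs_nonneg _).trans (hk 0)
  have hcont : Continuous f := continuous_iff_continuousAt.mpr fun y => (hf y).continuousAt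
  obtain ⟨z, hz⟩ := hcont.exists_forall_ge' x ((h0.eventually_lt_const (hL.trans_lt hx)).mono
    fun _ => le_of_lt)
  have hmax : IsLocalMax f z := Eventually.of_forall hz
  have hd : deriv f = f' := funext fun y => (hf y).deriv
  have hz0 : f' z = 0 := hmax.hasDerivAt_eq_zero (hf z)
  -- At a maximum above `L` the equation forces a positive second derivative. The point is then also
  -- a local minimum, so `f` is locally constant and the second derivative vanishes.
  have hpos : 0 < deriv (deriv f) z := by
    rw [hd, (hf' z).deriv, hz0]
    have := (abs_le.mp (hk z)).1
    have := hz x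
    linarith
  have hmin : IsLocalMin f z :=
    isLocalMin_of_deriv_deriv_pos hpos (by rw [hd, hz0]) (hf z).continuousAt
  have heq : f =ᶠ[𝓝 z] fun _ => f z := by
    filter_upwards [hmin] with y hy
    exact le_antisymm (hz y) hy
  have hd0 : deriv f =ᶠ[𝓝 z] fun _ => 0 := by
    have := heq.deriv
    simpa using this
  rw [hd0.deriv_eq] at hpos
  simp at hpos

theorem abs_integral_gaussian_le {h : ℝ → ℝ} {M : ℝ} (hM : ∀ x, |h x| ≤ M) :
    |∫ x, h x ∂gaussianReal 0 1| ≤ M := by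
  have := norm_integral_le_of_norm_le_const (μ := gaussianReal 0 1) (f := h) (C := M)
    (Eventually.of_forall hM)
  simpa using this

/-- The solution of Stein's equation for a smooth bounded test function. -/
theorem exists_solution {h h' : ℝ → ℝ} {M L : ℝ} (hh : ∀ x, HasDerivAt h (h' x) x)
    (hM : ∀ x, |h x| ≤ M) (hL : ∀ x, |h' x| ≤ L) :
    ∃ f f' f'' : ℝ → ℝ, (∀ x, HasDerivAt f (f' x) x) ∧ (∀ x, HasDerivAt f' (f'' x) x) ∧
      (∀ x, f' x - x * f x = h x - ∫ y, h y ∂gaussianReal 0 1) ∧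
      (∀ x, |f' x| ≤ 4 * M) ∧ ∀ x, |f'' x| ≤ 4 * L := by
  set c := ∫ y, h y ∂gaussianReal 0 1 with hc
  set k : ℝ → ℝ := fun x => h x - c with hk
  have hcM : |c| ≤ M := abs_integral_gaussian_le hM
  have hkM : ∀ x, |k x| ≤ 2 * M := fun x => by
    have := abs_sub (h x) c
    simp only [hk]; linarith [hM x]
  have hhc : Continuous h := continuous_iff_continuousAt.mpr fun y => (hh y).continuousAt
  have hkc : Continuous k := hhc.sub continuous_const
  set ψ : ℝ → ℝ := fun x => exp (-(x ^ 2 / 2)) * k x with hψ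
  have hψc : Continuous ψ := by fun_prop
  have hgi : Integrable fun x : ℝ => exp (-(x ^ 2 / 2)) := by
    have := integrable_exp_neg_mul_sq (b := 1 / 2) (by norm_num)
    refine this.congr (Eventually.of_forall fun x => ?_)
    simp only
    congr 1; ring
  have hψi : Integrable ψ := by
    refine (hgi.mul_const (2 * M)).mono' hψc.aestronglyMeasurable
      (Eventually.of_forall fun x => ?_)
    rw [norm_eq_abs, abs_mul, abs_of_pos (exp_pos _)]
    exact mul_le_mul_of_nonneg_left (hkM x) (exp_pos _).le
  -- Centring makes the weighted integral vanish, so its primitive `F` tends to 0 at both ends, as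
  -- the Mills estimate requires.
  have hψ0 : ∫ x, ψ x = 0 := by
    have hhi : Integrable h (gaussianReal 0 1) :=
      Integrable.of_bound hhc.aestronglyMeasurable M (Eventually.of_forall hM)
    have h1 : ∫ x, k x ∂gaussianReal 0 1 = 0 := by
      rw [hk, integral_sub hhi (integrable_const c)]
      simp [hc]
    rw [integral_gaussianReal_eq_integral_smul one_ne_zero] at h1
    have h2 : ∀ x, gaussianPDFReal 0 1 x • k x = (√(2 * π))⁻¹ * ψ x := by
      intro x
      simp only [gaussianPDFReal, hψ, NNReal.coe_one, mul_one, sub_zero, smul_eq_mul]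
      rw [mul_assoc, neg_div]
    simp only [h2] at h1
    rw [integral_const_mul] at h1
    exact (mul_eq_zero.mp h1).resolve_left (by positivity)
  set A := ∫ x in Set.Iic 0, ψ x with hA
  set F : ℝ → ℝ := fun x => A + ∫ y in (0 : ℝ)..x, ψ y with hF
  have hFd : ∀ x, HasDerivAt F (ψ x) x := fun x =>
    (intervalIntegral.integral_hasDerivAt_right (hψc.intervalIntegrable _ _)
      (hψc.stronglyMeasurableAtFilter _ _) hψc.continuousAt).const_add A
  have hFtop : Tendsto F atTop (𝓝 0) := by
    have h1 := intervalIntegral_tendsto_integral_Ioi 0 hψi.integrableOn tendsto_id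
    have h2 : A + ∫ x in Set.Ioi 0, ψ x = 0 := by
      rw [hA, ← hψ0]
      exact intervalIntegral.integral_Iic_add_Ioi hψi.integrableOn hψi.integrableOn
    rw [← h2]
    exact h1.const_add A
  have hFbot : Tendsto F atBot (𝓝 0) := by
    have h1 := (intervalIntegral_tendsto_integral_Iic 0 hψi.integrableOn tendsto_id).const_sub A
    rw [← hA, sub_self] at h1
    refine h1.congr fun x => ?_
    simp only [hF, id]
    rw [intervalIntegral.integral_symm 0 x]; ring
  set f : ℝ → ℝ := fun x => exp (x ^ 2 / 2) * F x with hf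
  have hexp : ∀ x : ℝ, exp (-(x ^ 2 / 2)) * exp (x ^ 2 / 2) = 1 := fun x => by
    rw [← exp_add]; simp
  have hfd : ∀ x, HasDerivAt f (x * f x + k x) x := by
    intro x
    have h1 : HasDerivAt (fun x : ℝ => x ^ 2 / 2) x x := 
      (((hasDerivAt_id x).pow 2).div_const 2).congr_deriv (by simp)
    refine (h1.exp.mul (hFd x)).congr_deriv ?_
    simp only [hf, hψ]
    linear_combination k x * hexp x
  have hfF : (fun x => exp (-(x ^ 2 / 2)) * f x) = F := by
    funext x
    simp only [hf]
    linear_combination F x * hexp x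
  have hxf := abs_mul_le_of_hasDerivAt hfd hkM (by rwa [hfF]) (by rwa [hfF])
  set f' : ℝ → ℝ := fun x => x * f x + k x with hf'
  have hf'M : ∀ x, |f' x| ≤ 4 * M := fun x => by
    have := abs_add_le (x * f x) (k x)
    simp only [hf']
    linarith [hxf x, hkM x]
  -- `f'` solves an equation of the same form with source f + h'. Once the maximum principle gives
  -- |f| ≤ L, the source is at most 2L and the Mills estimate applies again.
  have hf'd : ∀ x, HasDerivAt f' (x * f' x + f x + h' x) x := by
    intro x
    refine (((hasDerivAt_id x).mul (hfd x)).add ((hh x).sub_const c)).congr_deriv ?_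
    simp only [id, hf']
    ring
  have hf0 : Tendsto f (cocompact ℝ) (𝓝 0) := by
    have h1 : Tendsto (fun x : ℝ => 2 * M / |x|) (cocompact ℝ) (𝓝 0) :=
      tendsto_const_nhds.div_atTop tendsto_norm_cocompact_atTop
    refine squeeze_zero_norm' ?_ h1
    filter_upwards [tendsto_norm_cocompact_atTop.eventually_gt_atTop (0 : ℝ)] with x hx
    rw [norm_eq_abs] at hx
    rw [norm_eq_abs, le_div_iff₀ hx, mul_comm, ← abs_mul]
    exact hxf x
  have hfL : ∀ x, |f x| ≤ L := by
    intro x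
    have h1 := le_of_hasDerivAt hfd hf'd hL hf0 x
    have h2 := le_of_hasDerivAt (f := fun x => -f x) (f' := fun x => -f' x) (k := fun x => -h' x)
      (fun x => (hfd x).neg) (fun x => (hf'd x).neg.congr_deriv (by ring))
      (fun x => by rw [abs_neg]; exact hL x) (by simpa using hf0.neg) x
    rw [abs_le]
    constructor <;> linarith
  have hbdd : ∀ {l : Filter ℝ}, Tendsto (fun x : ℝ => x ^ 2) l atTop →
      Tendsto (fun x => exp (-(x ^ 2 / 2)) * f' x) l (𝓝 0) := by
    intro l hl
    have h1 : Tendsto (fun x : ℝ => exp (-(x ^ 2 / 2)) * (4 * M)) l (𝓝 0) := by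
      simpa using (tendsto_exp_neg_sq hl).mul_const (4 * M)
    refine squeeze_zero_norm (fun x => ?_) h1
    rw [norm_eq_abs, abs_mul, abs_of_pos (exp_pos _)]
    exact mul_le_mul_of_nonneg_left (hf'M x) (exp_pos _).le
  have hkL : ∀ x, |f x + h' x| ≤ 2 * L := fun x => by
    linarith [abs_add_le (f x) (h' x), hfL x, hL x]
  have hxf' := abs_mul_le_of_hasDerivAt (fun x => (hf'd x).congr_deriv (add_assoc _ _ _)) hkL
    (hbdd tendsto_sq_atTop) (hbdd tendsto_sq_atBot)
  refine ⟨f, f', fun x => x * f' x + f x + h' x, hfd, hf'd, fun x => by simp [hf', hk], hf'M,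
    fun x => ?_⟩
  simp only [add_assoc]
  linarith [abs_add_le (x * f' x) (f x + h' x), hxf' x, hkL x]

end Stein

/-! ### Regularity of test functions and Taylor's formula. -/

namespace Stein

open Filter Topology Real

/-- The break points are countable, so the fundamental theorem of calculus holds for the continuous
`h`. -/
theorem abs_sub_le_of_piecewiseC1 {h : ℝ → ℝ} (hh : PiecewiseC1 h) {L : ℝ}
    (hL : ∀ x, DifferentiableAt ℝ h x → |deriv h x| ≤ L) (a b : ℝ) :
    |h b - h a| ≤ L * |b - a| := by
  obtain ⟨hc, S, hS, hd⟩ := hh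
  have hcount : S.Countable := by
    have : S = ⋃ m : ℕ, S ∩ Set.Icc (-(m : ℝ)) m := by
      rw [← Set.inter_iUnion, Set.left_eq_inter]
      intro x _
      obtain ⟨m, hm⟩ := exists_nat_ge |x|
      exact Set.mem_iUnion.mpr ⟨m, abs_le.mp hm⟩
    rw [this]
    exact Set.countable_iUnion fun m => (hS _ _).countable
  have hbound : ∀ x, ‖deriv h x‖ ≤ L := by
    intro x
    rw [norm_eq_abs]
    by_cases hx : DifferentiableAt ℝ h x
    · exact hL x hx
    -- `deriv` is 0 here by default, and 0 ≤ L because some point avoids the countable set `S`.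
    · rw [deriv_zero_of_not_differentiableAt hx, abs_zero]
      obtain ⟨y, hy⟩ : ∃ y, y ∉ S := by
        by_contra! hS'
        have : S = Set.univ := Set.eq_univ_of_forall hS'
        exact Set.not_countable_univ (α := ℝ) (this ▸ hcount)
      exact (abs_nonneg _).trans (hL y (hd y hy).1)
  have hint : IntervalIntegrable (deriv h) volume a b := by
    refine (intervalIntegrable_const (c := L)).mono_fun' (measurable_deriv h).aestronglyMeasurable
      (Eventually.of_forall hbound)
  rw [← MeasureTheory.integral_eq_of_hasDerivAt_off_countable h (deriv h) hcount hc.continuousOn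
    (fun x hx => (hd x hx.2).1.hasDerivAt) hint]
  exact intervalIntegral.norm_integral_le_of_norm_le_const fun x _ => hbound x

/-- Approximation of a bounded Lipschitz function by its moving averages. -/
theorem exists_smooth_approx {h : ℝ → ℝ} (hc : Continuous h) {M L ε : ℝ} (hM : ∀ x, |h x| ≤ M)
    (hL : ∀ a b, |h b - h a| ≤ L * |b - a|) (hε : 0 < ε) :
    ∃ g g' : ℝ → ℝ, (∀ x, HasDerivAt g (g' x) x) ∧ (∀ x, |g x| ≤ M) ∧ (∀ x, |g' x| ≤ L) ∧
      ∀ x, |g x - h x| ≤ L * ε := by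
  have hii : ∀ a b, IntervalIntegrable h volume a b := fun a b => hc.intervalIntegrable a b
  have hG : ∀ x, HasDerivAt (fun x => ∫ y in (0 : ℝ)..x, h y) (h x) x := fun x =>
    intervalIntegral.integral_hasDerivAt_right (hii _ _) (hc.stronglyMeasurableAtFilter _ _)
      hc.continuousAt
  have hg : ∀ x, ((∫ y in (0 : ℝ)..(x + ε), h y) - ∫ y in (0 : ℝ)..x, h y) =
      ∫ y in x..(x + ε), h y := fun x => by
    rw [intervalIntegral.integral_interval_sub_left (hii _ _) (hii _ _)]
  refine ⟨fun x => ((∫ y in (0 : ℝ)..(x + ε), h y) - ∫ y in (0 : ℝ)..x, h y) / ε,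
    fun x => (h (x + ε) - h x) / ε, fun x => ?_, fun x => ?_, fun x => ?_, fun x => ?_⟩
  · exact (((hG (x + ε)).comp_add_const x ε).sub (hG x)).div_const ε
  · beta_reduce
    rw [hg, abs_div, abs_of_pos hε, div_le_iff₀ hε]
    have := intervalIntegral.norm_integral_le_of_norm_le_const (f := h) (a := x) (b := x + ε)
      (C := M) fun y _ => hM y
    rwa [add_sub_cancel_left, abs_of_pos hε] at this
  · rw [abs_div, abs_of_pos hε, div_le_iff₀ hε]
    have := hL x (x + ε)
    rwa [add_sub_cancel_left, abs_of_pos hε] at this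
  · have h1 : (∫ y in x..(x + ε), h y) / ε - h x = (∫ y in x..(x + ε), (h y - h x)) / ε := by
      rw [intervalIntegral.integral_sub (hii _ _) (by simp), intervalIntegral.integral_const]
      simp only [add_sub_cancel_left, smul_eq_mul]
      field_simp
    beta_reduce
    rw [hg, h1, abs_div, abs_of_pos hε, div_le_iff₀ hε]
    have := intervalIntegral.norm_integral_le_of_norm_le_const (f := fun y => h y - h x) (a := x)
      (b := x + ε) (C := L * ε) fun y hy => by
        rw [Set.uIoc_of_le (by linarith)] at hy
        refine (hL x y).trans ?_
        have h0 : 0 ≤ L := by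
          have := (abs_nonneg _).trans (hL 0 1)
          simpa using this
        refine mul_le_mul_of_nonneg_left ?_ h0
        rw [abs_of_nonneg] <;> linarith [hy.1, hy.2]
    rwa [add_sub_cancel_left, abs_of_pos hε] at this

/-- Two applications of the mean value inequality; the factor 1/2 is given up. -/
theorem abs_taylor_le {f f' f'' : ℝ → ℝ} {C : ℝ} (hf : ∀ x, HasDerivAt f (f' x) x)
    (hf' : ∀ x, HasDerivAt f' (f'' x) x) (hC : ∀ x, |f'' x| ≤ C) (x d : ℝ) :
    |f (x + d) - f x - d * f' x| ≤ C * d ^ 2 := by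
  have h1 : ∀ y, |f' y - f' x| ≤ C * |y - x| := fun y =>
    Convex.norm_image_sub_le_of_norm_hasDerivWithin_le (fun z _ => (hf' z).hasDerivWithinAt)
      (fun z _ => hC z) convex_univ (Set.mem_univ x) (Set.mem_univ y)
  have h0 : 0 ≤ C := (abs_nonneg _).trans (hC 0)
  have h2 := Convex.norm_image_sub_le_of_norm_hasDerivWithin_le (s := Set.uIcc x (x + d))
    (f := fun y => f y - y * f' x) (f' := fun y => f' y - 1 * f' x) (C := C * |d|)
    (fun z _ => ((hf z).sub ((hasDerivAt_id z).mul_const _)).hasDerivWithinAt)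
    (fun z hz => by
      rw [one_mul]
      refine (h1 z).trans (mul_le_mul_of_nonneg_left ?_ h0)
      have := Set.abs_sub_left_of_mem_uIcc hz
      rwa [add_sub_cancel_left] at this)
    (convex_uIcc x (x + d)) Set.left_mem_uIcc Set.right_mem_uIcc
  rw [norm_eq_abs, norm_eq_abs, add_sub_cancel_left, mul_assoc, abs_mul_abs_self] at h2
  rw [pow_two]
  convert h2 using 2
  ring

end Stein

/-! ### The drift as a word statistic, and its variance. -/

namespace MallowsWord

theorem pairSum_map_range (g : ℤ → ℤ → ℝ) (m : ℕ) (f : ℕ → ℤ) :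
    pairSum g ((List.range (m + 1)).map f) = ∑ i ∈ Finset.range m, g (f i) (f (i + 1)) := by
  induction m generalizing f with
  | zero => simp [pairSum]
  | succ m ih =>
    have h := ih fun k => f (k + 1)
    rw [List.range_succ_eq_map, List.map_cons, List.map_map] at h ⊢
    rw [List.range_succ_eq_map, List.map_cons, List.map_map, pairSum, Finset.sum_range_succ',
      add_comm]
    exact congrArg (· + _) h

theorem quadSum_map_range (ρ : ℤ → ℤ → ℤ → ℤ → ℝ) (m : ℕ) (f : ℕ → ℤ) :
    quadSum ρ ((List.range (m + 3)).map f) =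
      ∑ i ∈ Finset.range m, ρ (f i) (f (i + 1)) (f (i + 2)) (f (i + 3)) := by
  have key : ∀ (m : ℕ) (f : ℕ → ℤ), (List.range (m + 1)).map f =
      f 0 :: (List.range m).map fun k => f (k + 1) := fun m f => by
    rw [List.range_succ_eq_map, List.map_cons, List.map_map]; rfl
  induction m generalizing f with
  | zero => simp [quadSum, key]
  | succ m ih =>
    have h := ih fun k => f (k + 1)
    simp only [key] at h ⊢
    rw [quadSum, Finset.sum_range_succ', add_comm]
    exact congrArg (· + _) h

end MallowsWord

namespace TypeB

open MallowsWord

variable {n : ℕ}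

/-- The mean change of the two-sided descent statistic, up to the factor `1 / n`, when a random
ascent is turned into a descent. -/
noncomputable def drift (w : B n) : ℝ :=
  ∑ i, asc i w * (twoSidedDes (w * gen i) - twoSidedDes w)

/-- The loss at the first position. -/
noncomputable def headGain (y t : ℤ) : ℝ := if 0 < y then 1 - (if -y < t ∧ t < y then 1 else 0) else 0

theorem headGain_bounds (y t : ℤ) : 0 ≤ headGain y t ∧ headGain y t ≤ 1 := by
  unfold headGain
  split_ifs <;> norm_num

theorem succInd_bounds (y z : ℤ) : 0 ≤ succInd y z ∧ succInd y z ≤ 1 := by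
  unfold succInd
  split_ifs <;> norm_num

theorem asc_mul_succInd (i : Fin n) (w : B n) :
    asc i w * succInd (toPerm w i) (toPerm w (i + 1)) =
      succInd (toPerm w i) (toPerm w (i + 1)) := by
  unfold asc succInd
  split_ifs <;> first | omega | norm_num

theorem asc_mul_gain_of_pos {i : Fin n} (hi : (i : ℕ) ≠ 0) (w : B n) :
    asc i w * (twoSidedDes (w * gen i) - twoSidedDes w) =
      swapGain (toPerm w (i - 1)) (toPerm w i) (toPerm w (i + 1)) (toPerm w (i + 2)) +
        succInd (toPerm w i) (toPerm w (i + 1)) := by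
  rw [← asc_mul_succInd]
  by_cases h : toPerm w i < toPerm w (i + 1)
  · rw [asc, if_pos h, twoSidedDes_mul_gen_of_pos hi h, one_mul, one_mul]
  · rw [asc, if_neg h, swapGain, if_neg h]; ring

theorem asc_mul_gain_of_zero {i : Fin n} (hi : (i : ℕ) = 0) (w : B n) :
    asc i w * (twoSidedDes (w * gen i) - twoSidedDes w) =
      headGain (toPerm w 1) (toPerm w 2) + succInd (toPerm w i) (toPerm w (i + 1)) := by
  rw [← asc_mul_succInd]
  have h0 : toPerm w i < toPerm w (i + 1) ↔ 0 < toPerm w 1 := by simp [hi, toPerm_zero]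
  by_cases h : toPerm w i < toPerm w (i + 1)
  · rw [asc, if_pos h, twoSidedDes_mul_gen_of_zero hi h, one_mul, one_mul, headGain,
      if_pos (h0.mp h)]
  · rw [asc, if_neg h, headGain, if_neg (h0.not.mp h)]; ring

theorem abs_asc_mul_gain_le (i : Fin n) (w : B n) :
    |asc i w * (twoSidedDes (w * gen i) - twoSidedDes w)| ≤ 2 := by
  have h1 := succInd_bounds (toPerm w i) (toPerm w (i + 1))
  by_cases hi : (i : ℕ) = 0
  · rw [asc_mul_gain_of_zero hi, abs_le]
    have h2 := headGain_bounds (toPerm w 1) (toPerm w 2)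
    constructor <;> linarith [h1.1, h1.2, h2.1, h2.2]
  · rw [asc_mul_gain_of_pos hi, abs_le]
    have h2 := abs_le.mp (abs_swapGain_le (toPerm w (i - 1)) (toPerm w i) (toPerm w (i + 1))
      (toPerm w (i + 2)))
    constructor <;> linarith [h1.1, h1.2, h2.1, h2.2]

theorem zero_cons_word (w : B n) :
    0 :: word w = (List.range (n + 1)).map fun k : ℕ => toPerm w k := by
  rw [List.range_succ_eq_map, List.map_cons, List.map_map, Nat.cast_zero, toPerm_zero]
  congr 1

theorem exists_word_eq_cons {m : ℕ} (w : B (m + 2)) :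
    ∃ r, word w = toPerm w 1 :: toPerm w 2 :: r := by
  have h := map_range_split (fun k : ℕ => toPerm w ((k : ℤ) + 1)) 0 m
  simp only [zero_add, List.range_zero, List.map_nil, List.nil_append, Nat.cast_zero,
    Nat.cast_one, one_add_one_eq_two] at h
  exact ⟨_, h⟩

/-- The zero next to the word is w(0); the others fill the window of four letters. The two sides
differ only at position 0, where a sign change replaces the swap, and by the `swapGain` term at the
last position, each time by at most 1. -/
theorem drift_eq (hn : 4 ≤ n) (w : B n) : |drift w - wordStat 0 0 0 (word w)| ≤ 2 := by
  obtain ⟨m, rfl⟩ : ∃ m, n = m + 2 := ⟨n - 2, by omega⟩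
  have h1 : drift w = headGain (toPerm w 1) (toPerm w 2) +
      (∑ i ∈ Finset.range m, swapGain (toPerm w (i : ℕ)) (toPerm w ((i + 1 : ℕ) : ℤ))
          (toPerm w ((i + 2 : ℕ) : ℤ)) (toPerm w ((i + 3 : ℕ) : ℤ)) +
        swapGain (toPerm w (m : ℕ)) (toPerm w ((m + 1 : ℕ) : ℤ))
          (toPerm w ((m + 2 : ℕ) : ℤ)) (toPerm w ((m + 3 : ℕ) : ℤ))) +
      ∑ i ∈ Finset.range (m + 2), succInd (toPerm w (i : ℕ)) (toPerm w ((i + 1 : ℕ) : ℤ)) := by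
    have e : ∀ i : Fin (m + 2), asc i w * (twoSidedDes (w * gen i) - twoSidedDes w) =
        (if (i : ℕ) = 0 then headGain (toPerm w 1) (toPerm w 2) else
          swapGain (toPerm w ((i : ℕ) - 1 : ℤ)) (toPerm w (i : ℕ)) (toPerm w ((i : ℕ) + 1 : ℤ))
            (toPerm w ((i : ℕ) + 2 : ℤ))) +
        succInd (toPerm w (i : ℕ)) (toPerm w (((i : ℕ) + 1 : ℕ) : ℤ)) := by
      intro i
      push_cast
      split_ifs with hi
      · exact asc_mul_gain_of_zero hi w
      · exact asc_mul_gain_of_pos hi w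
    rw [drift, Finset.sum_congr rfl fun i _ => e i, Finset.sum_add_distrib,
      Fin.sum_univ_eq_sum_range (fun i => succInd (toPerm w (i : ℕ)) (toPerm w ((i + 1 : ℕ) : ℤ))),
      Fin.sum_univ_eq_sum_range (fun i : ℕ => if i = 0 then headGain (toPerm w 1) (toPerm w 2) else
          swapGain (toPerm w ((i : ℕ) - 1 : ℤ)) (toPerm w (i : ℕ)) (toPerm w ((i : ℕ) + 1 : ℤ))
            (toPerm w ((i : ℕ) + 2 : ℤ))), Finset.sum_range_succ', if_pos rfl, add_comm (Finset.sum _ _),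
      Finset.sum_range_succ]
    congr 3
    · refine Finset.sum_congr rfl fun i _ => ?_
      rw [if_neg (by omega)]
      congr 2 <;> push_cast <;> ring
    · rw [if_neg (by omega)]
      congr 2 <;> push_cast <;> ring
  have h2 : wordStat 0 0 0 (word w) = swapGain 0 0 (toPerm w 1) (toPerm w 2) +
      ∑ i ∈ Finset.range m, swapGain (toPerm w (i : ℕ)) (toPerm w ((i + 1 : ℕ) : ℤ))
          (toPerm w ((i + 2 : ℕ) : ℤ)) (toPerm w ((i + 3 : ℕ) : ℤ)) +
      ∑ i ∈ Finset.range (m + 2), succInd (toPerm w (i : ℕ)) (toPerm w ((i + 1 : ℕ) : ℤ)) := by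
    rw [wordStat, ← pairSum_map_range succInd (m + 2) fun k : ℕ => toPerm w k, ← zero_cons_word,
      ← quadSum_map_range swapGain m fun k : ℕ => toPerm w k, ← zero_cons_word]
    congr 1
    obtain ⟨r, e⟩ := exists_word_eq_cons w
    rw [e, quadSum, quadSum, show swapGain 0 0 0 (toPerm w 1) = 0 from if_neg (lt_irrefl _), zero_add]
  rw [h1, h2]
  have h3 := abs_le.mp (abs_swapGain_le (toPerm w (m : ℕ)) (toPerm w ((m + 1 : ℕ) : ℤ))
          (toPerm w ((m + 2 : ℕ) : ℤ)) (toPerm w ((m + 3 : ℕ) : ℤ)))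
  have h4 : -1 ≤ headGain (toPerm w 1) (toPerm w 2) - swapGain 0 0 (toPerm w 1) (toPerm w 2) ∧
      headGain (toPerm w 1) (toPerm w 2) - swapGain 0 0 (toPerm w 1) (toPerm w 2) ≤ 0 := by
    unfold headGain swapGain
    split_ifs <;> first | omega | norm_num
  rw [abs_le]
  constructor <;> linarith [h3.1, h3.2, h4.1, h4.2]

theorem avg_word {q : ℝ} (hq : 0 < q) (F : List ℤ → ℝ) :
    avg q (fun w : B n => F (word w)) = signMean q n fun s => mean q n s F := by
  have h1 := sum_pow_length (n := n) hq fun _ => 1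
  have h2 : signMean q n (fun s => mean q n s fun _ => (1 : ℝ)) = 1 := by
    refine Eq.trans ?_ (signMean_const hq n 1)
    exact le_antisymm (signMean_mono hq fun s hs _ => (mean_const hq hs 1).le)
      (signMean_mono hq fun s hs _ => (mean_const hq hs 1).ge)
  rw [h2] at h1
  simp only [mul_one] at h1
  rw [avg, sum_pow_length hq, mallowsZ, h1]
  refine mul_div_cancel_left₀ _ ?_
  have h3 : ∀ i, qNat q (i + 1) ≠ 0 := fun i => (qNat_pos hq i).ne'
  have h4 : ∀ i, 1 + q ^ (i + 1) ≠ 0 := fun i => by positivity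
  exact mul_ne_zero (Finset.prod_ne_zero_iff.mpr fun i _ => h4 i)
    (Finset.prod_ne_zero_iff.mpr fun i _ => h3 i)

theorem avg_sq_sub (q : ℝ) (F : B n → ℝ) (c : ℝ) :
    avg q (fun w => (F w - c) ^ 2) =
      avg q (fun w => F w ^ 2) - 2 * c * avg q F + c ^ 2 * avg q fun _ : B n => 1 := by
  rw [← avg_mul, ← avg_mul, ← avg_sub, ← avg_add]
  congr 1; funext w; ring

/-- By (a+b)² ≤ 2a² + 2b², the error of 2 in `drift_eq` gives 2·(317/4)n + 8, which is rounded up to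
15² n. -/
theorem variance_drift_le {q : ℝ} (hq : 0 < q) (hn : 4 ≤ n) :
    avg q (fun w : B n => (drift w - avg q (drift (n := n))) ^ 2) ≤ 225 * n := by
  set c := avg q fun w : B n => wordStat 0 0 0 (word w) with hc
  have h1 : avg q (fun w : B n => (wordStat 0 0 0 (word w) - c) ^ 2) ≤ 317 / 4 * n := by
    rw [avg_sq_sub, avg_const hq, ← hc]
    have h := variance_signMean_wordStat_le hq n
    rw [← avg_word hq (wordStat 0 0 0), ← avg_word hq fun l => wordStat 0 0 0 l ^ 2, ← hc] at h
    linarith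
  have h2 : avg q (fun w : B n => (drift w - avg q (drift (n := n))) ^ 2) ≤
      avg q fun w : B n => (drift w - c) ^ 2 := by
    rw [avg_sq_sub, avg_sq_sub, avg_const hq]
    nlinarith [sq_nonneg (avg q (drift (n := n)) - c)]
  have h3 : avg q (fun w : B n => (drift w - c) ^ 2) ≤
      avg q fun w : B n => 2 * (wordStat 0 0 0 (word w) - c) ^ 2 + 8 := by
    refine avg_mono hq fun w => ?_
    have h := sq_le_sq' (abs_le.mp (drift_eq hn w)).1 (abs_le.mp (drift_eq hn w)).2
    nlinarith [sq_nonneg ((drift w - wordStat 0 0 0 (word w)) - (wordStat 0 0 0 (word w) - c))]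
  rw [avg_add, avg_mul, avg_const hq] at h3
  have : (4 : ℝ) ≤ n := by exact_mod_cast hn
  linarith

end TypeB

/-! ### Lower bound for the mean drift. -/

namespace TypeB

open MallowsWord

variable {n : ℕ}

/-- The indicator of `w(a) < w(b) < w(c)`. -/
noncomputable def ordInd (a b c : ℤ) (w : B n) : ℝ :=
  if toPerm w a < toPerm w b ∧ toPerm w b < toPerm w c then 1 else 0

theorem avg_nonneg {q : ℝ} (hq : 0 < q) {F : B n → ℝ} (h : ∀ w, 0 ≤ F w) : 0 ≤ avg q F :=
  (avg_const (n := n) hq 0).symm.le.trans (avg_mono hq h)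

theorem avg_ordInd_nonneg {q : ℝ} (hq : 0 < q) (a b c : ℤ) :
    0 ≤ avg q (ordInd (n := n) a b c) :=
  avg_nonneg hq fun w => by unfold ordInd; split_ifs <;> norm_num

/-- All w in the event have an ascent at `i`, so multiplication by s_i carries the event to the one
with moved positions and multiplies its mass by `q`. -/
theorem avg_ordInd_gen (q : ℝ) (i : Fin n) {a b c : ℤ}
    (h : ∀ w : B n, toPerm w a < toPerm w b → toPerm w b < toPerm w c →
      toPerm w i < toPerm w (i + 1)) :
    avg q (ordInd (n := n) (genFun i a) (genFun i b) (genFun i c)) =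
      q * avg q (ordInd (n := n) a b c) := by
  have h1 : ∀ w : B n, asc i w * ordInd a b c w = ordInd a b c w := by
    intro w
    unfold ordInd
    split_ifs with hw
    · rw [asc, if_pos (h w hw.1 hw.2), one_mul]
    · rw [mul_zero]
  have h2 : ∀ w : B n, (1 - asc i w) * ordInd a b c (w * gen i) =
      ordInd (genFun i a) (genFun i b) (genFun i c) w := by
    intro w
    rw [← asc_mul_gen, h1]
    simp only [ordInd, toPerm_mul_gen]
  have h3 := avg_asc_mul q i (ordInd (n := n) a b c)
  simp only [h1, h2] at h3
  exact h3

theorem toPerm_ne (w : B n) {a b : ℤ} (h : a ≠ b) : toPerm w a ≠ toPerm w b :=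
  fun e => h ((toPerm w).injective e)

/-- Among the arrangements of three consecutive letters with a given ascent, those in which the
third letter has its value between the two have mass at most one third. -/
theorem avg_ordInd_le_third {q : ℝ} (hq : 0 < q) {k : ℕ} (hk : k ≠ 0) (hkn : k + 1 < n) :
    avg q (ordInd (n := n) (k + 1) k (k + 2)) ≤ 1 / 3 * (1 / (1 + q)) ∧
      avg q (ordInd (n := n) k (k + 2) (k + 1)) ≤ 1 / 3 * (1 / (1 + q)) := by
  set i : Fin n := ⟨k, by omega⟩ with hi
  set j : Fin n := ⟨k + 1, hkn⟩ with hj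
  have gi : ∀ x : ℤ, genFun i x = if x = k then (k : ℤ) + 1 else if x = k + 1 then (k : ℤ)
      else if x = -k then -((k : ℤ) + 1) else if x = -(k + 1) then -k else x := fun x => by
    rw [genFun, if_neg hk]
  have gj : ∀ x : ℤ, genFun j x = if x = k + 1 then (k : ℤ) + 2 else if x = k + 2 then (k : ℤ) + 1
      else if x = -(k + 1) then -((k : ℤ) + 2) else if x = -(k + 2) then -(k + 1) else x := fun x => by
    rw [genFun, if_neg (by simp [hj])]
    push_cast [hj]
    simp only [add_assoc]
    norm_num
  have i0 : genFun i k = k + 1 := by rw [gi]; simp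
  have i1 : genFun i ((k : ℤ) + 1) = k := by rw [gi]; simp
  have i2 : genFun i ((k : ℤ) + 2) = k + 2 := by rw [gi]; split_ifs <;> omega
  have j0 : genFun j k = k := by rw [gj]; split_ifs <;> omega
  have j1 : genFun j ((k : ℤ) + 1) = k + 2 := by rw [gj]; simp
  have j2 : genFun j ((k : ℤ) + 2) = k + 1 := by rw [gj]; simp
  have hjc : ((j : ℕ) : ℤ) = k + 1 := by push_cast [hj]; rfl
  have hjc' : ((k : ℤ) + 1) + 1 = k + 2 := by ring
  -- If T is the mass of the increasing order, an ascent at `i` has mass (1 + q + q²)T = 1/(1+q),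
  -- and the two events in question have mass qT each. The claim is 3q ≤ 1 + q + q².
  have e1 := avg_ordInd_gen q i (a := k) (b := k + 1) (c := k + 2) fun w h _ => h
  have e2 := avg_ordInd_gen q j (a := k) (b := k + 1) (c := k + 2) fun w _ h => by
    rw [hjc, hjc']; exact h
  have e3 := avg_ordInd_gen q i (a := k) (b := k + 2) (c := k + 1) fun w h h' => h.trans h'
  have e4 := avg_ordInd_gen q j (a := k + 1) (b := k) (c := k + 2) fun w h h' => by
    rw [hjc, hjc']; exact h.trans h'
  rw [i0, i1, i2] at e1 e3
  rw [j0, j1, j2] at e2 e4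
  have ne1 : ∀ w : B n, toPerm w k ≠ toPerm w (k + 1) := fun w => toPerm_ne w (by omega)
  have ne2 : ∀ w : B n, toPerm w k ≠ toPerm w (k + 2) := fun w => toPerm_ne w (by omega)
  have ne3 : ∀ w : B n, toPerm w (k + 1) ≠ toPerm w (k + 2) := fun w => toPerm_ne w (by omega)
  have s1 : asc i = fun w : B n =>
      ordInd k (k + 1) (k + 2) w + ordInd k (k + 2) (k + 1) w + ordInd (k + 2) k (k + 1) w := by
    funext w
    have := ne1 w; have := ne2 w; have := ne3 w
    simp only [asc, ordInd, hi]
    split_ifs <;> first | omega | norm_num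
  have s2 : asc j = fun w : B n =>
      ordInd k (k + 1) (k + 2) w + ordInd (k + 1) k (k + 2) w + ordInd (k + 1) (k + 2) k w := by
    funext w
    have := ne1 w; have := ne2 w; have := ne3 w
    simp only [asc, ordInd, hjc, hjc']
    split_ifs <;> first | omega | norm_num
  have t1 := avg_asc hq i
  have t2 := avg_asc hq j
  rw [s1, avg_add, avg_add, e2, e4] at t1
  rw [s2, avg_add, avg_add, e1, e3, e2] at t2
  have hT := avg_ordInd_nonneg (n := n) hq k (k + 1) (k + 2)
  rw [e1] at t1
  rw [e1, e2, ← t1]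
  generalize avg q (ordInd (n := n) k (k + 1) (k + 2)) = T at hT t1 ⊢
  have : 0 ≤ (1 - q) ^ 2 * T := by positivity
  constructor <;> nlinarith

/-- The same comparison in cosets of B₂: an ascent has mass (1 + q + q² + q³)T, each of the two sums
is (q + q²)T, and the gap is proportional to (1+q)(1-q)² ≥ 0. -/
theorem avg_ordInd_le_half {q : ℝ} (hq : 0 < q) (hn : 1 < n) :
    avg q (ordInd (n := n) 0 (-1) 2) + avg q (ordInd (n := n) 0 2 (-1)) ≤ 1 / 2 * (1 / (1 + q)) ∧
      avg q (ordInd (n := n) 0 2 1) + avg q (ordInd (n := n) 0 (-2) 1) ≤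
        1 / 2 * (1 / (1 + q)) := by
  set i : Fin n := ⟨0, by omega⟩ with hi
  set j : Fin n := ⟨1, hn⟩ with hj
  have hic : ∀ w : B n, toPerm w i < toPerm w (i + 1) ↔ 0 < toPerm w 1 := fun w => by
    simp [hi, toPerm_zero]
  have hjc : ∀ w : B n, toPerm w j < toPerm w (j + 1) ↔ toPerm w 1 < toPerm w 2 := fun w => by
    simp [hj]
  have e1 := avg_ordInd_gen q i (a := 0) (b := 1) (c := 2) fun w h _ => by
    rwa [hic, ← toPerm_zero w]
  have e2 := avg_ordInd_gen q j (a := 0) (b := 1) (c := 2) fun w _ h => by rwa [hjc]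
  have e3 := avg_ordInd_gen q i (a := 0) (b := 2) (c := 1) fun w h h' => by
    rw [hic, ← toPerm_zero w]; exact h.trans h'
  have e4 := avg_ordInd_gen q j (a := 0) (b := -1) (c := 2) fun w h h' => by
    rw [hjc]; rw [toPerm_zero, toPerm_neg] at h; rw [toPerm_neg] at h'; omega
  have e5 := avg_ordInd_gen q i (a := 0) (b := -2) (c := 1) fun w h h' => by
    rw [hic, ← toPerm_zero w]; exact h.trans h'
  have e6 := avg_ordInd_gen q j (a := 0) (b := 2) (c := -1) fun w h h' => by
    rw [hjc]; rw [toPerm_zero] at h; rw [toPerm_neg] at h'; omega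
  simp only [hi, hj, show genFun 0 0 = 0 from rfl, show genFun 0 1 = -1 from rfl,
    show genFun 0 2 = 2 from rfl, show genFun 1 0 = 0 from rfl, show genFun 1 1 = 2 from rfl,
    show genFun 1 2 = 1 from rfl, show genFun 1 (-1) = -2 from rfl,
    show genFun 0 (-2) = -2 from rfl] at e1 e2 e3 e4 e5 e6
  have ne1 : ∀ w : B n, toPerm w 1 ≠ 0 := fun w => by
    rw [← toPerm_zero w]; exact toPerm_ne w (by omega)
  have ne2 : ∀ w : B n, toPerm w 2 ≠ 0 := fun w => by
    rw [← toPerm_zero w]; exact toPerm_ne w (by omega)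
  have ne3 : ∀ w : B n, toPerm w 1 ≠ toPerm w 2 := fun w => toPerm_ne w (by omega)
  have ne4 : ∀ w : B n, -toPerm w 1 ≠ toPerm w 2 := fun w => by
    rw [← toPerm_neg]; exact toPerm_ne w (by omega)
  have s1 : asc i = fun w : B n =>
      ordInd 0 1 2 w + ordInd 0 2 1 w + (ordInd 0 (-2) 1 w + ordInd 0 1 (-2) w) := by
    funext w
    have := ne1 w; have := ne2 w; have := ne3 w; have := ne4 w
    simp only [asc, ordInd, hic, toPerm_zero, toPerm_neg]
    split_ifs <;> first | omega | norm_num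
  have s2 : asc j = fun w : B n =>
      ordInd 0 1 2 w + ordInd 0 (-1) 2 w + (ordInd 0 2 (-1) w + ordInd 0 (-2) (-1) w) := by
    funext w
    have := ne1 w; have := ne2 w; have := ne3 w; have := ne4 w
    simp only [asc, ordInd, hjc, toPerm_zero, toPerm_neg]
    split_ifs <;> first | omega | norm_num
  have t1 := avg_asc hq i
  have t2 := avg_asc hq j
  rw [s1, avg_add, avg_add, avg_add, e6, e4, e3, e2, e1] at t1
  have hT := avg_ordInd_nonneg (n := n) hq 0 1 2
  rw [e4, e3, e2, e1, ← t1]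
  generalize avg q (ordInd (n := n) 0 1 2) = T at hT t1 ⊢
  have : 0 ≤ (1 + q) * (1 - q) ^ 2 * T := by positivity
  constructor <;> nlinarith

theorem avg_drift_ge {q : ℝ} (hq : 0 < q) (hn : 4 ≤ n) :
    (n : ℝ) / 3 * (1 / (1 + q)) ≤ avg q (drift (n := n)) := by
  have hp : 0 < 1 / (1 + q) := by positivity
  -- In units of 1/(1+q): position 0 keeps 1 - 1/2, position 1 keeps 1 - 1/2 - 1/3, and every other
  -- position at least 1 - 1/3 - 1/3. The surplus 1/6 at 0 cancels the deficit at 1.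
  have term : ∀ i : Fin n, (1 / 3 + (if (i : ℕ) = 0 then 1 / 6 else 0) -
      (if (i : ℕ) = 1 then 1 / 6 else 0)) * (1 / (1 + q)) ≤
      avg q fun w : B n => asc i w * (twoSidedDes (w * gen i) - twoSidedDes w) := by
    intro i
    by_cases h0 : (i : ℕ) = 0
    · have h1 : avg q (fun w : B n => asc i w - (ordInd 0 2 1 w + ordInd 0 (-2) 1 w)) ≤
          avg q fun w : B n => asc i w * (twoSidedDes (w * gen i) - twoSidedDes w) := by
        refine avg_mono hq fun w => ?_
        rw [asc_mul_gain_of_zero h0]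
        have := (succInd_bounds (toPerm w i) (toPerm w (i + 1))).1
        have ne2 : toPerm w 2 ≠ 0 := by
          rw [← toPerm_zero w]; exact toPerm_ne w (by omega)
        have : asc i w - (ordInd 0 2 1 w + ordInd 0 (-2) 1 w) ≤
            headGain (toPerm w 1) (toPerm w 2) := by
          simp only [asc, ordInd, headGain, h0, Nat.cast_zero, zero_add, toPerm_zero, toPerm_neg]
          split_ifs <;> first | omega | norm_num
        linarith
      rw [avg_sub, avg_add, avg_asc hq] at h1
      have h2 := (avg_ordInd_le_half (n := n) hq (by omega)).2
      simp only [h0, if_true, zero_ne_one, if_false]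
      linarith
    obtain ⟨k, hk⟩ : ∃ k : ℕ, (i : ℕ) = k + 1 := ⟨i - 1, by omega⟩
    have hkn : k + 1 < n := hk ▸ i.2
    have c1 : ((i : ℕ) : ℤ) = k + 1 := by rw [hk]; push_cast; rfl
    have c2 : (k : ℤ) + 1 - 1 = k := by ring
    have c3 : (k : ℤ) + 1 + 1 = k + 2 := by ring
    have c4 : (k : ℤ) + 1 + 2 = k + 3 := by ring
    have h1 : avg q (fun w : B n => asc i w - ordInd (k + 1) k (k + 2) w -
        ordInd (k + 1) (k + 3) (k + 2) w) ≤
        avg q fun w : B n => asc i w * (twoSidedDes (w * gen i) - twoSidedDes w) := by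
      refine avg_mono hq fun w => ?_
      rw [asc_mul_gain_of_pos h0, c1, c2, c3, c4]
      have := (succInd_bounds (toPerm w (k + 1)) (toPerm w (k + 2))).1
      have : asc i w - ordInd (k + 1) k (k + 2) w - ordInd (k + 1) (k + 3) (k + 2) w ≤
          swapGain (toPerm w k) (toPerm w (k + 1)) (toPerm w (k + 2)) (toPerm w (k + 3)) := by
        simp only [asc, ordInd, swapGain, c1, c3]
        split_ifs <;> first | omega | norm_num
      linarith
    rw [avg_sub, avg_sub, avg_asc hq] at h1
    have h2 : avg q (ordInd (n := n) (k + 1) (k + 3) (k + 2)) ≤ 1 / 3 * (1 / (1 + q)) := by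
      by_cases hlast : k + 2 < n
      · have := (avg_ordInd_le_third (n := n) hq (k := k + 1) (by omega) hlast).2
        push_cast at this
        rwa [c3, c4] at this
      -- At the last position the right neighbour is the fixed value n + 1, which exceeds all
      -- letters.
      · have : avg q (ordInd (n := n) (k + 1) (k + 3) (k + 2)) ≤ 0 := by
          refine (avg_mono hq fun w => ?_).trans (avg_const hq 0).le
          rw [ordInd, if_neg]
          rw [toPerm_of_notMem w (k := (k : ℤ) + 3) (by rw [abs_of_nonneg] <;> omega)]
          have := toPerm_mem w (k := (k : ℤ) + 2) ⟨by omega, by rw [abs_of_nonneg] <;> omega⟩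
          have := (abs_le.mp this.2).2
          omega
        linarith
    by_cases hk0 : k = 0
    · subst hk0
      have h3 : avg q (ordInd (n := n) (((0 : ℕ) : ℤ) + 1) ((0 : ℕ) : ℤ) (((0 : ℕ) : ℤ) + 2)) ≤
          avg q fun w : B n => ordInd 0 (-1) 2 w + ordInd 0 2 (-1) w := by
        refine avg_mono hq fun w => ?_
        have ne4 : -toPerm w 1 ≠ toPerm w 2 := by
          rw [← toPerm_neg]; exact toPerm_ne w (by omega)
        simp only [ordInd, Nat.cast_zero, zero_add, toPerm_zero, toPerm_neg]
        split_ifs <;> first | omega | norm_num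
      rw [avg_add] at h3
      have h4 := (avg_ordInd_le_half (n := n) hq (by omega)).1
      simp only [Nat.cast_zero, zero_add] at h1 h2 h3 h4
      simp only [hk, zero_add, one_ne_zero, if_true, if_false]
      linarith
    · have h3 := (avg_ordInd_le_third (n := n) hq hk0 hkn).1
      simp only [h0, show ¬ (i : ℕ) = 1 by omega, if_false]
      linarith
  have hs : drift (n := n) = fun w => ∑ i, asc i w * (twoSidedDes (w * gen i) - twoSidedDes w) := rfl
  rw [hs, avg_sum]
  refine le_trans (le_of_eq ?_) (Finset.sum_le_sum fun i _ => term i)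
  rw [← Finset.sum_mul, Finset.sum_sub_distrib, Finset.sum_add_distrib]
  have f0 : ∑ i : Fin n, (if (i : ℕ) = 0 then (1 / 6 : ℝ) else 0) = 1 / 6 := by
    rw [Finset.sum_eq_single ⟨0, by omega⟩]
    · simp
    · intro i _ hi
      rw [if_neg fun h => hi (Fin.ext h)]
    · simp
  have f1 : ∑ i : Fin n, (if (i : ℕ) = 1 then (1 / 6 : ℝ) else 0) = 1 / 6 := by
    rw [Finset.sum_eq_single ⟨1, by omega⟩]
    · simp
    · intro i _ hi
      rw [if_neg fun h => hi (Fin.ext h)]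
    · simp
  rw [f0, f1]
  rw [Finset.sum_const, Finset.card_univ, Fintype.card_fin, nsmul_eq_mul]
  ring

end TypeB

/-! ### Normal approximation for q ≤ 1. -/

namespace TypeB

variable {n : ℕ}

theorem abs_avg_le {q : ℝ} (hq : 0 < q) (F : B n → ℝ) : |avg q F| ≤ avg q fun w => |F w| := by
  rw [abs_le]
  refine ⟨?_, avg_mono hq fun w => le_abs_self _⟩
  have h1 := avg_mono hq (F := fun w => -1 * |F w|) (G := F) fun w => by
    linarith [neg_abs_le (F w)]
  rw [avg_mul] at h1
  linarith

/-- The mean of the two-sided descent statistic. -/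
noncomputable def desMean (n : ℕ) (q : ℝ) : ℝ := avg q (twoSidedDes (n := n))

/-- The variance of the two-sided descent statistic. -/
noncomputable def desVar (n : ℕ) (q : ℝ) : ℝ :=
  avg q fun w : B n => (twoSidedDes w - desMean n q) ^ 2

theorem one_add_mul_desMean {q : ℝ} (hq : 0 < q) : (1 + q) * desMean n q = 2 * q * n := by
  have h := avg_twoSidedDes_mul (n := n) q fun _ => 1
  simp only [mul_one, sub_self, mul_zero, Finset.sum_const_zero, avg_const hq, add_zero] at h
  exact h

theorem avg_centered_mul {q : ℝ} (hq : 0 < q) (φ : ℝ → ℝ) :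
    (1 + q) * avg q (fun w : B n => (twoSidedDes w - desMean n q) * φ (twoSidedDes w)) =
      2 * q * avg q fun w : B n => ∑ i, asc i w *
        (φ (twoSidedDes (w * gen i)) - φ (twoSidedDes w)) := by
  simp only [sub_mul (twoSidedDes _)]
  rw [avg_sub, avg_mul]
  linear_combination avg_twoSidedDes_mul (n := n) q φ -
    (avg q fun w : B n => φ (twoSidedDes w)) * one_add_mul_desMean (n := n) hq

theorem one_add_mul_desVar {q : ℝ} (hq : 0 < q) :
    (1 + q) * desVar n q = 2 * q * avg q (drift (n := n)) := by
  have h := avg_centered_mul (n := n) hq fun x => x - desMean n q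
  simp only [sub_sub_sub_cancel_right, ← sq] at h
  exact h

/-- Instead of Cauchy–Schwarz, 30√n |x| ≤ x² + 225n is averaged. -/
theorem avg_abs_drift_sub_le {q : ℝ} (hq : 0 < q) (hn : 4 ≤ n) :
    avg q (fun w : B n => |drift w - avg q (drift (n := n))|) ≤ 15 * √n := by
  have hr : 0 < √(n : ℝ) := Real.sqrt_pos.mpr (by exact_mod_cast (by omega : 0 < n))
  have hr2 : √(n : ℝ) ^ 2 = n := Real.sq_sqrt (Nat.cast_nonneg n)
  set c := avg q (drift (n := n))
  have h1 : avg q (fun w : B n => (30 * √n) * |drift w - c|) ≤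
      avg q fun w : B n => (drift w - c) ^ 2 + 225 * n := avg_mono hq fun w => by
    nlinarith [sq_nonneg (|drift w - c| - 15 * √n), sq_abs (drift w - c)]
  rw [avg_mul, avg_add, avg_const hq] at h1
  have h2 := variance_drift_le hq hn
  have h3 : (30 * √n) * avg q (fun w : B n => |drift w - c|) ≤ (30 * √n) * (15 * √n) := by
    nlinarith
  exact le_of_mul_le_mul_left h3 (by positivity)

/-- The normal approximation for smooth test functions. -/
theorem abs_avg_sub_integral_le_of_smooth {q : ℝ} (hq : 0 < q) (hq1 : q ≤ 1) (hn : 4 ≤ n)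
    {h h' : ℝ → ℝ} {M L : ℝ} (hh : ∀ x, HasDerivAt h (h' x) x)
    (hM : ∀ x, |h x| ≤ M) (hL : ∀ x, |h' x| ≤ L) :
    |avg q (fun w : B n => h ((twoSidedDes w - desMean n q) / √(desVar n q))) -
        ∫ y, h y ∂gaussianReal 0 1| ≤ (360 * M + 236 * L * (√q)⁻¹) * (√n)⁻¹ := by
  obtain ⟨f, f', f'', hf, hf', hs, hM', hL'⟩ := Stein.exists_solution hh hM hL
  set I := ∫ y, h y ∂gaussianReal 0 1
  set μ := desMean n q with hμ
  set V := desVar n q with hV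
  set D := avg q (drift (n := n)) with hD
  have hM0 : 0 ≤ M := (abs_nonneg _).trans (hM 0)
  have hL0 : 0 ≤ L := (abs_nonneg _).trans (hL 0)
  have hn0 : (0 : ℝ) < n := by exact_mod_cast (by omega : 0 < n)
  have hr : 0 < √(n : ℝ) := Real.sqrt_pos.mpr hn0
  have hr2 : √(n : ℝ) ^ 2 = n := Real.sq_sqrt hn0.le
  have hs0 : 0 < √q := Real.sqrt_pos.mpr hq
  have hs2 : √q ^ 2 = q := Real.sq_sqrt hq.le
  have hDn : (n : ℝ) / 6 ≤ D := by
    refine le_trans ?_ (avg_drift_ge hq hn)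
    rw [mul_one_div, le_div_iff₀ (by positivity)]
    nlinarith
  have hD0 : 0 < D := by linarith [div_pos hn0 (by norm_num : (0 : ℝ) < 6)]
  have hVD : (1 + q) * V = 2 * q * D := one_add_mul_desVar hq
  have hVn : q * n / 6 ≤ V := by
    refine le_of_mul_le_mul_left ?_ (by positivity : 0 < 1 + q)
    rw [hVD]
    nlinarith [mul_le_mul_of_nonneg_left hDn hq.le, mul_pos hq hn0]
  have hV0 : 0 < V := lt_of_lt_of_le (by positivity) hVn
  set σ := √V with hσ
  have hσ0 : 0 < σ := Real.sqrt_pos.mpr hV0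
  have hσ2 : σ ^ 2 = V := Real.sq_sqrt hV0.le
  set W : B n → ℝ := fun w => (twoSidedDes w - μ) / σ with hW
  set S : B n → ℝ := fun w => ∑ i, asc i w * (f (W (w * gen i)) - f (W w)) with hS
  have hSavg : (1 + q) * (σ * avg q fun w => W w * f (W w)) = 2 * q * avg q S := by
    have := avg_centered_mul (n := n) hq fun x => f ((x - μ) / σ)
    rw [← avg_mul]
    refine Eq.trans ?_ this
    congr 2
    funext w
    simp only [hW]
    field_simp
    ring
  -- Increments at ascents are at most 2/σ after scaling, so each Taylor remainder is at most
  -- 4L·(2/σ)².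
  have hrem : ∀ w, |S w - σ⁻¹ * drift w * f' (W w)| ≤ 16 * L * n / V := by
    intro w
    have e : S w - σ⁻¹ * drift w * f' (W w) = ∑ i, asc i w * (f (W w +
        (twoSidedDes (w * gen i) - twoSidedDes w) / σ) - f (W w) -
        (twoSidedDes (w * gen i) - twoSidedDes w) / σ * f' (W w)) := by
      rw [hS, drift, Finset.mul_sum, Finset.sum_mul, ← Finset.sum_sub_distrib]
      refine Finset.sum_congr rfl fun i _ => ?_
      have : W (w * gen i) = W w + (twoSidedDes (w * gen i) - twoSidedDes w) / σ := by
        simp only [hW]; ring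
      rw [this]
      ring
    rw [e]
    have hi : ∀ i ∈ (Finset.univ : Finset (Fin n)), |asc i w * (f (W w +
        (twoSidedDes (w * gen i) - twoSidedDes w) / σ) - f (W w) -
        (twoSidedDes (w * gen i) - twoSidedDes w) / σ * f' (W w))| ≤ 16 * L / V := by
      intro i _
      have hg := abs_asc_mul_gain_le i w
      by_cases ha : toPerm w i < toPerm w (i + 1)
      · have ha1 : asc i w = 1 := if_pos ha
        rw [ha1, one_mul] at hg ⊢
        refine (Stein.abs_taylor_le hf hf' hL' _ _).trans ?_
        rw [div_pow, hσ2, ← mul_div_assoc]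
        have := mul_le_mul_of_nonneg_left (sq_le_sq' (abs_le.mp hg).1 (abs_le.mp hg).2) hL0
        exact div_le_div_of_nonneg_right (by linarith) hV0.le
      · have ha0 : asc i w = 0 := if_neg ha
        rw [ha0, zero_mul, abs_zero]
        positivity
    refine (Finset.abs_sum_le_sum_abs _ _).trans ((Finset.sum_le_sum hi).trans (le_of_eq ?_))
    rw [Finset.sum_const, Finset.card_univ, Fintype.card_fin, nsmul_eq_mul]
    ring
  have hp : 2 * q / (1 + q) = V / D := by
    rw [div_eq_div_iff (by positivity) hD0.ne']
    linarith
  have hWf : avg q (fun w => W w * f (W w)) = σ / D * avg q S := by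
    have h1 : σ * avg q (fun w => W w * f (W w)) = V / D * avg q S := by
      rw [← hp, div_mul_eq_mul_div, eq_div_iff (by positivity), ← hSavg]
      ring
    rw [← hσ2] at h1
    have h2 : σ * avg q (fun w => W w * f (W w)) = σ * (σ / D * avg q S) := by
      rw [h1]; ring
    exact mul_left_cancel₀ hσ0.ne' h2
  -- As 2q/(1+q) = V/D, E[W f(W)] equals (σ/D) E[S]. Its first-order part is E[f'(W) drift]/D, which
  -- cancels E[f'(W)] up to the relative fluctuation of the drift.
  have key : avg q (fun w => h (W w)) - I =
      avg q fun w => f' (W w) * ((D - drift w) / D) -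
        σ / D * (S w - σ⁻¹ * drift w * f' (W w)) := by
    have h1 : avg q (fun w => h (W w)) - I = avg q fun w => f' (W w) - W w * f (W w) := by
      have h2 := avg_sub q (fun w => h (W w)) fun _ => I
      rw [avg_const hq] at h2
      rw [← h2]
      congr 1
      funext w
      exact (hs (W w)).symm
    rw [h1, avg_sub, hWf, ← avg_mul, ← avg_sub]
    congr 1
    funext w
    field_simp
    ring
  rw [key]
  have hpt : ∀ w, |f' (W w) * ((D - drift w) / D) - σ / D * (S w - σ⁻¹ * drift w * f' (W w))| ≤
      4 * M / D * |drift w - D| + 16 * L * n / (σ * D) := by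
    intro w
    refine (abs_sub _ _).trans (add_le_add ?_ ?_)
    · rw [abs_mul, abs_div, abs_sub_comm D, abs_of_pos hD0, div_mul_eq_mul_div, ← mul_div_assoc]
      gcongr
      exact hM' _
    · rw [abs_mul, abs_of_pos (div_pos hσ0 hD0)]
      refine (mul_le_mul_of_nonneg_left (hrem w) (by positivity)).trans (le_of_eq ?_)
      rw [← hσ2]
      field_simp
  refine (abs_avg_le hq _).trans ((avg_mono hq hpt).trans ?_)
  rw [avg_add, avg_mul, avg_const hq, add_mul]
  refine add_le_add ?_ ?_
  · have h1 := avg_abs_drift_sub_le hq hn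
    rw [← hD] at h1
    -- With D ≥ n/6 the constant is 4·6·15 = 360.
    calc _ ≤ 4 * M / D * (15 * √n) := by gcongr
      _ ≤ 4 * M / (n / 6) * (15 * √n) := by gcongr
      _ = 360 * M * (√n)⁻¹ := by
        rw [← Real.sqrt_div_self]
        field_simp
        ring
  -- Here 96 = 16·6 comes from D ≥ n/6, and σ² ≥ qn/6 leaves 96√6 < 236.
  · have hσn : 96 * (√q * √n) ≤ 236 * σ := by
      refine abs_le_of_sq_le_sq' ?_ (by positivity) |>.2
      rw [mul_pow, mul_pow, mul_pow, hs2, hr2, hσ2]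
      nlinarith
    calc _ ≤ 16 * L * n / (σ * (n / 6)) := by gcongr
      _ = L * (96 / σ) := by field_simp; ring
      _ ≤ L * (236 / (√q * √n)) := by
        gcongr L * ?_
        rw [div_le_div_iff₀ hσ0 (by positivity)]
        exact hσn
      _ = _ := by field_simp

theorem integrable_gaussian_of_bounded {h : ℝ → ℝ} (hc : Continuous h) {M : ℝ}
    (hM : ∀ x, |h x| ≤ M) : Integrable h (gaussianReal 0 1) :=
  Integrable.of_bound hc.aestronglyMeasurable M (Filter.Eventually.of_forall hM)

/-- The normal approximation for bounded Lipschitz test functions. -/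
theorem abs_avg_sub_integral_le {q : ℝ} (hq : 0 < q) (hq1 : q ≤ 1) (hn : 4 ≤ n)
    {h : ℝ → ℝ} {M L : ℝ} (hc : Continuous h)
    (hM : ∀ x, |h x| ≤ M) (hL : ∀ a b, |h b - h a| ≤ L * |b - a|) :
    |avg q (fun w : B n => h ((twoSidedDes w - desMean n q) / √(desVar n q))) -
        ∫ y, h y ∂gaussianReal 0 1| ≤ (360 * M + 236 * L * (√q)⁻¹) * (√n)⁻¹ := by
  have hL0 : 0 ≤ L := by simpa using (abs_nonneg _).trans (hL 0 1)
  refine le_of_forall_pos_le_add fun ε hε => ?_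
  obtain ⟨g, g', hg, hgM, hgL, hgh⟩ :=
    Stein.exists_smooth_approx hc hM hL (ε := ε / (2 * (L + 1))) (by positivity)
  have hδ : L * (ε / (2 * (L + 1))) ≤ ε / 2 := by
    rw [← mul_div_assoc, div_le_div_iff₀ (by positivity) (by positivity)]
    nlinarith
  have hgc : Continuous g := continuous_iff_continuousAt.mpr fun x => (hg x).continuousAt
  have h1 := abs_avg_sub_integral_le_of_smooth hq hq1 hn hg hgM hgL
  set W : B n → ℝ := fun w => (twoSidedDes w - desMean n q) / √(desVar n q) with hW
  have h2 : |avg q (fun w => h (W w)) - avg q (fun w => g (W w))| ≤ ε / 2 := by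
    rw [← avg_sub]
    refine (abs_avg_le hq _).trans ((avg_mono hq fun w => ?_).trans (avg_const hq (ε / 2)).le)
    rw [abs_sub_comm]
    exact (hgh _).trans hδ
  have h3 : |∫ y, g y ∂gaussianReal 0 1 - ∫ y, h y ∂gaussianReal 0 1| ≤ ε / 2 := by
    rw [← integral_sub (integrable_gaussian_of_bounded hgc hgM)
      (integrable_gaussian_of_bounded hc hM)]
    exact Stein.abs_integral_gaussian_le fun x => (hgh x).trans hδ
  rw [abs_le] at h1 h2 h3 ⊢
  constructor <;> linarith [h1.1, h1.2, h2.1, h2.2, h3.1, h3.2]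

end TypeB

/-! ### The symmetry w ↦ -w, and the conclusion for all q. -/

namespace TypeB

variable {n : ℕ}

/-- The signed permutation `k ↦ -k`. -/
def negOne (n : ℕ) : B n :=
  ⟨⟨fun k => -k, fun k => -k, fun k => Subtype.ext (neg_neg k.1), fun k => Subtype.ext (neg_neg k.1)⟩,
    fun _ => rfl⟩

theorem toPerm_negOne_mul (w : B n) {k : ℤ} (hk : |k| ≤ n) : toPerm (negOne n * w) k = -toPerm w k := by
  by_cases h0 : k = 0
  · rw [h0, toPerm_zero, toPerm_zero, neg_zero]
  rw [map_mul, Equiv.Perm.mul_apply]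
  exact toPerm_coe (negOne n) ⟨toPerm w k, mem_index.mpr (toPerm_mem w ⟨h0, hk⟩)⟩

theorem toPerm_negOne_mul_lt_iff (w : B n) (i : Fin n) :
    toPerm (negOne n * w) i < toPerm (negOne n * w) (i + 1) ↔ toPerm w (i + 1) < toPerm w i := by
  have := i.2
  rw [toPerm_negOne_mul w (by rw [abs_of_nonneg] <;> omega),
    toPerm_negOne_mul w (by rw [abs_of_nonneg] <;> omega), neg_lt_neg_iff]

theorem negOne_mul_negOne : negOne n * negOne n = 1 :=
  Subtype.ext (Equiv.ext fun k => Subtype.ext (neg_neg k.1))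

theorem negOne_mul_comm (w : B n) : negOne n * w = w * negOne n :=
  Subtype.ext (Equiv.ext fun k => (w.2 k).symm)

theorem negOne_mul_inv (w : B n) : (negOne n * w)⁻¹ = negOne n * w⁻¹ := by
  rw [mul_inv_rev, inv_eq_of_mul_eq_one_left negOne_mul_negOne, negOne_mul_comm]

theorem asc_negOne_mul (i : Fin n) (w : B n) : asc i (negOne n * w) = 1 - asc i w := by
  unfold asc
  simp only [toPerm_negOne_mul_lt_iff]
  rcases lt_or_gt_of_ne (toPerm_succ_ne w i) with h | h <;> simp [h, h.not_gt]

theorem des_negOne_mul (w : B n) : (des (negOne n * w) : ℝ) = n - des w := by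
  rw [des_eq, des_eq]
  simp only [asc_negOne_mul, Finset.sum_sub_distrib]
  simp

theorem twoSidedDes_negOne_mul (w : B n) :
    twoSidedDes (negOne n * w) = 2 * n - twoSidedDes w := by
  rw [twoSidedDes, twoSidedDes, negOne_mul_inv, des_negOne_mul, des_negOne_mul]
  ring

/-- Negation exchanges ascents and descents, so a generator that lengthens one of w, -w shortens the
other. -/
theorem length_add_length_negOne_mul (w : B n) :
    length w + length (negOne n * w) = length (1 : B n) + length (negOne n) := by
  have step : ∀ (w : B n) (i : Fin n), length (w * gen i) + length (negOne n * (w * gen i)) =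
      length w + length (negOne n * w) := by
    intro w i
    rw [← mul_assoc]
    rcases lt_or_gt_of_ne (toPerm_succ_ne w i) with h | h
    · have h1 := length_mul_gen h
      have hc : toPerm (negOne n * w) (i + 1) < toPerm (negOne n * w) i := by
        rcases lt_or_gt_of_ne (toPerm_succ_ne (negOne n * w) i) with h' | h'
        · exact absurd ((toPerm_negOne_mul_lt_iff w i).mp h') h.not_gt
        · exact h'
      have h2 := length_mul_gen_of_gt hc
      omega
    · have h1 := length_mul_gen_of_gt h
      have h2 := length_mul_gen ((toPerm_negOne_mul_lt_iff w i).mpr h)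
      omega
  obtain ⟨L, -, rfl⟩ := exists_prod_eq w
  induction L using List.reverseRecOn with
  | nil => rw [List.map_nil, List.prod_nil, mul_one]
  | append_singleton L i ih =>
    rw [List.map_append, List.prod_append, List.map_singleton, List.prod_singleton, step, ih]

theorem avg_negOne_mul {q : ℝ} (hq : 0 < q) (F : B n → ℝ) :
    avg q (fun w => F (negOne n * w)) = avg q⁻¹ F := by
  have h : ∀ F : B n → ℝ, ∑ w : B n, q ^ length w * F (negOne n * w) =
      q ^ (length (1 : B n) + length (negOne n)) * ∑ w : B n, q⁻¹ ^ length w * F w := by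
    intro F
    rw [← Equiv.sum_comp (Equiv.mulLeft (negOne n)) fun w => q⁻¹ ^ length w * F w, Finset.mul_sum]
    refine Finset.sum_congr rfl fun w _ => ?_
    rw [Equiv.coe_mulLeft, ← length_add_length_negOne_mul w, pow_add, inv_pow]
    field_simp
  have hZ := h fun _ => 1
  simp only [mul_one] at hZ
  rw [avg, avg, h, mallowsZ, mallowsZ, hZ, mul_div_mul_left _ _ (by positivity)]

theorem desMean_inv {q : ℝ} (hq : 0 < q) : desMean n q⁻¹ = 2 * n - desMean n q := by
  rw [desMean, ← avg_negOne_mul hq]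
  simp only [twoSidedDes_negOne_mul]
  rw [avg_sub, avg_const hq, desMean]

theorem desVar_inv {q : ℝ} (hq : 0 < q) : desVar n q⁻¹ = desVar n q := by
  rw [desVar, ← avg_negOne_mul hq, desMean_inv hq, desVar]
  congr 1
  funext w
  rw [twoSidedDes_negOne_mul]
  ring

theorem integral_gaussian_neg {h : ℝ → ℝ} (hc : Continuous h) :
    ∫ y, h (-y) ∂gaussianReal 0 1 = ∫ y, h y ∂gaussianReal 0 1 := by
  have h1 : (gaussianReal 0 1).map (fun x => -x) = gaussianReal 0 1 := by
    rw [gaussianReal_map_neg, neg_zero]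
  conv_rhs => rw [← h1]
  rw [integral_map (by fun_prop) hc.aestronglyMeasurable]

/-- The normal approximation for bounded Lipschitz test functions and all `q`. -/
theorem abs_avg_sub_integral_le_max {q : ℝ} (hq : 0 < q) (hn : 4 ≤ n)
    {h : ℝ → ℝ} {M L : ℝ} (hc : Continuous h)
    (hM : ∀ x, |h x| ≤ M) (hL : ∀ a b, |h b - h a| ≤ L * |b - a|) :
    |avg q (fun w : B n => h ((twoSidedDes w - desMean n q) / √(desVar n q))) -
        ∫ y, h y ∂gaussianReal 0 1| ≤ (360 * M + 236 * L * max (√q)⁻¹ √q) * (√n)⁻¹ := by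
  have hL0 : 0 ≤ L := by simpa using (abs_nonneg _).trans (hL 0 1)
  rcases le_total q 1 with hq1 | hq1
  · refine (abs_avg_sub_integral_le hq hq1 hn hc hM hL).trans ?_
    gcongr
    exact le_max_left _ _
  -- Negation changes the sign of the standardized statistic, so the case q⁻¹ ≤ 1 is applied to
  -- h(-·); the Gaussian is symmetric.
  · have h1 := abs_avg_sub_integral_le (n := n) (inv_pos.mpr hq) (inv_le_one_of_one_le₀ hq1) hn
      (h := fun x => h (-x)) (hc.comp continuous_neg) (fun x => hM _) fun a b => by
        rw [← abs_neg (b - a)]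
        convert hL (-a) (-b) using 3
        ring
    rw [integral_gaussian_neg hc, desMean_inv hq, desVar_inv hq, ← avg_negOne_mul hq,
      Real.sqrt_inv, inv_inv] at h1
    have e : (fun w : B n => h (-((twoSidedDes (negOne n * w) - (2 * n - desMean n q)) /
        √(desVar n q)))) = fun w => h ((twoSidedDes w - desMean n q) / √(desVar n q)) := by
      funext w
      rw [twoSidedDes_negOne_mul]
      congr 1
      ring
    rw [e] at h1
    refine h1.trans ?_
    gcongr
    exact le_max_right _ _

theorem integral_mallows {q : ℝ} (hq : 0 < q) (F : B n → ℝ) :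
    ∫ w, F w ∂mallows n q = avg q F := by
  have hF : ∀ w : B n, Integrable F
      (ENNReal.ofReal (q ^ length w / mallowsZ n q) • Measure.dirac w) := fun w =>
    (integrable_dirac (by simp)).smul_measure ENNReal.ofReal_ne_top
  rw [mallows, integral_finsetSum_measure fun w _ => hF w, avg, Finset.sum_div]
  refine Finset.sum_congr rfl fun w _ => ?_
  have := mallowsZ_pos (n := n) hq
  rw [integral_smul_measure, integral_dirac, ENNReal.toReal_ofReal (by positivity), smul_eq_mul]
  ring

theorem integral_comp_mallows {q : ℝ} (hq : 0 < q) {Ω : Type*} [MeasurableSpace Ω]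
    {P : Measure Ω} {w : Ω → B n} (hw : HasLaw w (mallows n q) P) (F : B n → ℝ) :
    ∫ ω, F (w ω) ∂P = avg q F := by
  rw [← integral_mallows hq]
  exact hw.integral_comp (measurable_from_top.aestronglyMeasurable)

end TypeB

theorem mainTheorem2 (n : ℕ) (hn : 4 ≤ n) (q : ℝ) (hq : 0 < q)
    {Ω : Type*} [MeasurableSpace Ω] (P : Measure Ω) [IsProbabilityMeasure P]
    (w : Ω → TypeB.B n) (hw : HasLaw w (TypeB.mallows n q) P)
    {Ω' : Type*} [MeasurableSpace Ω'] (P' : Measure Ω') [IsProbabilityMeasure P']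
    (Z : Ω' → ℝ) (hZ : HasLaw Z (gaussianReal 0 1) P')
    (h : ℝ → ℝ) (hh : PiecewiseC1 h) :
    ENNReal.ofReal
        |(∫ ω, h (standardized (fun ω' => TypeB.twoSidedDes (w ω')) P ω) ∂P)
          - ∫ ω', h (Z ω') ∂P'| ≤
      (360 * supNorm h
        + 236 * derivSupNorm h
          * ENNReal.ofReal (max (q ^ (-(1 / 2) : ℝ)) (q ^ ((1 / 2) : ℝ))))
        * ENNReal.ofReal ((n : ℝ) ^ (-(1 / 2) : ℝ)) := by
  have hn0 : (0 : ℝ) < n := by exact_mod_cast (by omega : 0 < n)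
  have hmean : ∫ ω, TypeB.twoSidedDes (w ω) ∂P = TypeB.desMean n q :=
    TypeB.integral_comp_mallows hq hw TypeB.twoSidedDes
  have hvar : Var[fun ω => TypeB.twoSidedDes (w ω); P] = TypeB.desVar n q := by
    have hX : Measurable (TypeB.twoSidedDes (n := n)) := measurable_from_top
    rw [variance_eq_integral (X := fun ω => TypeB.twoSidedDes (w ω))
      (hX.comp_aemeasurable hw.aemeasurable), hmean]
    exact TypeB.integral_comp_mallows hq hw fun v =>
      (TypeB.twoSidedDes v - TypeB.desMean n q) ^ 2
  have hleft : ∫ ω, h (standardized (fun ω' => TypeB.twoSidedDes (w ω')) P ω) ∂P =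
      TypeB.avg q fun v : TypeB.B n =>
        h ((TypeB.twoSidedDes v - TypeB.desMean n q) / √(TypeB.desVar n q)) := by
    simp only [standardized, hmean, hvar]
    exact TypeB.integral_comp_mallows hq hw fun v =>
      h ((TypeB.twoSidedDes v - TypeB.desMean n q) / √(TypeB.desVar n q))
  have hright : ∫ ω', h (Z ω') ∂P' = ∫ y, h y ∂gaussianReal 0 1 :=
    hZ.integral_comp hh.1.aestronglyMeasurable
  rw [hleft, hright, Real.rpow_neg hq.le, Real.rpow_neg hn0.le, ← Real.sqrt_eq_rpow,
    ← Real.sqrt_eq_rpow]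
  have hr : ENNReal.ofReal (√(n : ℝ))⁻¹ ≠ 0 := by
    rw [Ne, ENNReal.ofReal_eq_zero, not_le]
    positivity
  have hm0 : 0 < max (√q)⁻¹ √q := lt_max_of_lt_right (Real.sqrt_pos.mpr hq)
  have hm : ENNReal.ofReal (max (√q)⁻¹ √q) ≠ 0 := by
    rwa [Ne, ENNReal.ofReal_eq_zero, not_le]
  -- All factors multiplying the norms are nonzero, so an infinite norm makes the right-hand side
  -- infinite.
  by_cases hM : supNorm h = ⊤
  · rw [hM, ENNReal.mul_top (by norm_num), top_add, ENNReal.top_mul hr]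
    exact le_top
  by_cases hL : derivSupNorm h = ⊤
  · rw [hL, ENNReal.mul_top (by norm_num), ENNReal.top_mul hm, add_top, ENNReal.top_mul hr]
    exact le_top
  have hM' : ∀ x, |h x| ≤ (supNorm h).toReal := fun x => by
    rw [← Real.norm_eq_abs, ← toReal_enorm]
    exact ENNReal.toReal_mono hM (le_iSup (fun x => ‖h x‖ₑ) x)
  have hL' : ∀ x, DifferentiableAt ℝ h x → |deriv h x| ≤ (derivSupNorm h).toReal := fun x hx => by
    rw [← Real.norm_eq_abs, ← toReal_enorm]
    exact ENNReal.toReal_mono hL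
      (le_iSup₂ (f := fun (x : ℝ) (_ : DifferentiableAt ℝ h x) => ‖deriv h x‖ₑ) x hx)
  have key := TypeB.abs_avg_sub_integral_le_max hq hn hh.1 hM'
    (Stein.abs_sub_le_of_piecewiseC1 hh hL')
  refine (ENNReal.ofReal_le_ofReal key).trans (le_of_eq ?_)
  rw [ENNReal.ofReal_mul (by positivity), ENNReal.ofReal_add (by positivity) (by positivity),
    ENNReal.ofReal_mul (by positivity), ENNReal.ofReal_mul (by positivity),
    ENNReal.ofReal_mul (by positivity), ENNReal.ofReal_toReal hM, ENNReal.ofReal_toReal hL,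
    ENNReal.ofReal_ofNat, ENNReal.ofReal_ofNat]
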